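/- Let $G=(V,E)$ be a locally finite simple graph with countable vertex set $V$, and let $q:V\to\mathbb{R}$, $q_\pm=\max(\pm q,0)$. On functions on $V$ put $\Delta f(x)=\sum_{y\sim x}(f(x)-f(y))$, let $\deg$ be the vertex degree, and let $C_c(V)$ be the finitely supported complex functions in $\ell^2(V)$. By $A\le B$ on $C_c(V)$ we mean $\langle f,Af\rangle\le\langle f,Bf\rangle$ for all $f\in C_c(V)$. Assume $q\in\mathcal{K}_{0+}$, i.e. for every $\alpha\in(0,1)$ there is $C_\alpha\ge 0$ with $q_-\le\alpha(\Delta+q_+)+C_\alpha$ on $C_c(V)$. Let $\Delta+q$ be the self-adjoint operator in $\ell^2(V)$ given as the form sum (KLMN theorem) of $\Delta+q_+$, with domain $\{f\in\ell^2(V):(\Delta+q_+)f\in\ell^2(V)\}$, and $-q_-$; and let $\deg+q$ be the operator of multiplication with domain $\{f\in\ell^2(V):(\deg+q)f\in\ell^2(V)\}$. The following are equivalent: (i) $(G,q)$ is almost sparse: for every $\varepsilon>0$ there is $k_\varepsilon\ge0$ such that for every finite $W\subseteq V$, $$2|E_W|\le k_\varepsilon|W|+\varepsilon\Big(|\partial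 W|+\sum_{x\in W}q_+(x)\Big),$$ where $|E_W|$ is the number of edges with both ends in $W$ and $|\partial W|$ the number of edges with exactly one end in $W$. (ii) For every $\varepsilon>0$ there is $k_\varepsilon\ge0$ such that on $C_c(V)$ $$(1-\varepsilon)(\deg+q)-k_\varepsilon\le\Delta+q\le(1+\varepsilon)(\deg+q)+k_\varepsilon.$$ (iii) For every $\varepsilon>0$ there is $k_\varepsilon\ge0$ such that on $C_c(V)$ $$(1-\varepsilon)(\deg+q)-k_\varepsilon\le\Delta+q.$$ Moreover, if these conditions hold, then $\mathcal{D}(|\Delta+q|^{1/2})=\mathcal{D}(|\deg+q|^{1/2})$, and $\Delta+q$ has purely discrete spectrum if and only if $$\liminf_{|x|\to\infty}(\deg+q)(x):=\sup_{W\subseteq V\text{ finite}}\ \inf_{x\in V\setminus W}(\deg+q)(x)=\infty .$$ If $\Delta+q$ has purely discrete spectrum and $V$ is infinite, then the eigenvalues below the essential spectrum of each of the operators $T=\Delta+q$ and $T=\deg+q$, in increasing order and counted with multiplicity, form an infinite sequence $(\lambda_n(T))_{n\ge0}$, and $$\lim_{n\to\infty}\frac{\lambda_n(\Delta+q)}{\lambda_n(\deg+q)}=1.$$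 -/

import Mathlib

open Filter Topology
open scoped ComplexConjugate

noncomputable section

namespace SparseGraph

/-! ### Operators in a Hilbert space -/

section Operators

variable {H : Type*} [NormedAddCommGroup H] [InnerProductSpace ℂ H]

/-- The composition `S ∘ T` of partially defined operators, on its natural domain
`{x ∈ D(T) | T x ∈ D(S)}`. -/
def compOp (S T : H →ₗ.[ℂ] H) : H →ₗ.[ℂ] H where
  domain := (S.domain.comap T.toFun).map T.domain.subtype
  toFun :=
    { toFun := fun x => S ⟨T ⟨x.1, by obtain ⟨y, _, hy⟩ := x.2; exact hy ▸ y.2⟩, by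
        obtain ⟨x, y, hy, rfl⟩ := x; exact hy⟩
      map_add' := fun x y => by
        rw [← LinearPMap.map_add]
        congr 1
        ext
        exact LinearPMap.map_add T ⟨x.1, by obtain ⟨y, _, hy⟩ := x.2; exact hy ▸ y.2⟩
          ⟨y.1, by obtain ⟨z, _, hz⟩ := y.2; exact hz ▸ z.2⟩
      map_smul' := fun c x => by
        rw [RingHom.id_apply, ← LinearPMap.map_smul]
        congr 1
        ext
        exact LinearPMap.map_smul T c ⟨x.1, by obtain ⟨y, _, hy⟩ := x.2; exact hy ▸ y.2⟩ }

/-- `S` is a non-negative self-adjoint square root of `T`: `S = S* ≥ 0` and `S ∘ S = T`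
(including equality of domains). -/
def IsPosSqrt [CompleteSpace H] (S T : H →ₗ.[ℂ] H) : Prop :=
  IsSelfAdjoint S ∧ (∀ x : S.domain, 0 ≤ (inner ℂ (x : H) (S x)).re) ∧ compOp S S = T

open scoped Classical in
/-- The non-negative square root `T^{1/2}` of a non-negative self-adjoint operator `T`
(which exists and is unique; for other operators the value is meaningless). -/
def posSqrt [CompleteSpace H] (T : H →ₗ.[ℂ] H) : H →ₗ.[ℂ] H :=
  if h : ∃ S, IsPosSqrt S T then h.choose else 0

/-- The absolute value `|T| = (T* T)^{1/2}`. -/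
def absOp [CompleteSpace H] (T : H →ₗ.[ℂ] H) : H →ₗ.[ℂ] H :=
  posSqrt (compOp T.adjoint T)

/-- The form domain `D(|T|^{1/2})` of a self-adjoint operator `T`. -/
def formDomain [CompleteSpace H] (T : H →ₗ.[ℂ] H) : Submodule ℂ H :=
  (posSqrt (absOp T)).domain

/-- For `S = A^{1/2}` and `R = B^{1/2}`, the graph of the operator associated with the form
`t(h, f) = ⟨S h, S f⟩ - ⟨R h, R f⟩` on `D(S) ∩ D(R)`: the pairs `(f, g)` with `f` in the form domain
and `t(h, f) = ⟨h, g⟩` for all `h` in the form domain. -/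
def formDiffGraph (S R : H →ₗ.[ℂ] H) : Submodule ℂ (H × H) where
  carrier := {p | ∃ (hS : p.1 ∈ S.domain) (hR : p.1 ∈ R.domain),
    ∀ (h : H) (h₁ : h ∈ S.domain) (h₂ : h ∈ R.domain),
      inner ℂ (S ⟨h, h₁⟩) (S ⟨p.1, hS⟩) - inner ℂ (R ⟨h, h₂⟩) (R ⟨p.1, hR⟩) = inner ℂ h p.2}
  zero_mem' := by
    refine ⟨S.domain.zero_mem, R.domain.zero_mem, fun h h₁ h₂ => ?_⟩
    have e₁ : S ⟨(0 : H × H).1, S.domain.zero_mem⟩ = 0 := LinearPMap.map_zero S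
    have e₂ : R ⟨(0 : H × H).1, R.domain.zero_mem⟩ = 0 := LinearPMap.map_zero R
    rw [e₁, e₂]
    simp
  add_mem' := by
    rintro p p' ⟨hS, hR, hp⟩ ⟨hS', hR', hp'⟩
    refine ⟨S.domain.add_mem hS hS', R.domain.add_mem hR hR', fun h h₁ h₂ => ?_⟩
    have e₁ : S ⟨(p + p').1, S.domain.add_mem hS hS'⟩ = S ⟨p.1, hS⟩ + S ⟨p'.1, hS'⟩ :=
      LinearPMap.map_add S ⟨p.1, hS⟩ ⟨p'.1, hS'⟩
    have e₂ : R ⟨(p + p').1, R.domain.add_mem hR hR'⟩ = R ⟨p.1, hR⟩ + R ⟨p'.1, hR'⟩ :=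
      LinearPMap.map_add R ⟨p.1, hR⟩ ⟨p'.1, hR'⟩
    rw [e₁, e₂, Prod.snd_add, inner_add_right, inner_add_right, inner_add_right,
      ← hp h h₁ h₂, ← hp' h h₁ h₂]
    ring
  smul_mem' := by
    rintro c p ⟨hS, hR, hp⟩
    refine ⟨S.domain.smul_mem c hS, R.domain.smul_mem c hR, fun h h₁ h₂ => ?_⟩
    have e₁ : S ⟨(c • p).1, S.domain.smul_mem c hS⟩ = c • S ⟨p.1, hS⟩ :=
      LinearPMap.map_smul S c ⟨p.1, hS⟩
    have e₂ : R ⟨(c • p).1, R.domain.smul_mem c hR⟩ = c • R ⟨p.1, hR⟩ :=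
      LinearPMap.map_smul R c ⟨p.1, hR⟩
    have e₃ : (c • p).2 = c • p.2 := rfl
    rw [e₁, e₂, e₃, inner_smul_right, inner_smul_right, inner_smul_right,
      ← hp h h₁ h₂]
    ring

/-- The form sum of `A` and `-B` for non-negative self-adjoint operators `A` and `B`, where `B` is
form bounded with respect to `A` with bound less than one: the self-adjoint operator that is
associated with the form `⟨A^{1/2} h, A^{1/2} f⟩ - ⟨B^{1/2} h, B^{1/2} f⟩`. -/
def formDiff [CompleteSpace H] (A B : H →ₗ.[ℂ] H) : H →ₗ.[ℂ] H :=
  (formDiffGraph (posSqrt A) (posSqrt B)).toLinearPMap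

/-- The eigenspace `ker (T - z)`. -/
def eigenspaceOp (T : H →ₗ.[ℂ] H) (z : ℂ) : Submodule ℂ H :=
  (LinearMap.ker (T.toFun - z • T.domain.subtype)).map T.domain.subtype

/-- The spectrum of a closed operator `T`: all `z` for which `T - z : D(T) → H` is not bijective
(the inverse of a bijective `T - z` is bounded by the closed graph theorem). -/
def spectrumOp (T : H →ₗ.[ℂ] H) : Set ℂ :=
  {z | ¬ Function.Bijective (fun x : T.domain => T x - z • (x : H))}

/-- The discrete spectrum: isolated points of the spectrum that are eigenvalues of finite
multiplicity. -/
def discreteSpectrum (T : H →ₗ.[ℂ] H) : Set ℂ :=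
  {z | z ∈ spectrumOp T ∧ (∃ r > 0, ∀ w ∈ spectrumOp T, dist w z < r → w = z) ∧
    eigenspaceOp T z ≠ ⊥ ∧ FiniteDimensional ℂ (eigenspaceOp T z)}

/-- The essential spectrum of a self-adjoint operator. -/
def essentialSpectrum (T : H →ₗ.[ℂ] H) : Set ℂ := spectrumOp T \ discreteSpectrum T

/-- `T` has purely discrete spectrum. -/
def HasPurelyDiscreteSpectrum (T : H →ₗ.[ℂ] H) : Prop := essentialSpectrum T = ∅

/-- `lam 0 ≤ lam 1 ≤ …` are the eigenvalues of `T` below the essential spectrum, in increasing order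
and counted with multiplicity (and there are infinitely many of them). Such a sequence is unique. -/
def IsEigenvalueSequence (T : H →ₗ.[ℂ] H) (lam : ℕ → ℝ) : Prop :=
  Monotone lam ∧
  (∀ n, ∀ z ∈ essentialSpectrum T, lam n < z.re) ∧
  ∀ t : ℝ, (∀ z ∈ essentialSpectrum T, t < z.re) →
    {n | lam n = t}.encard = Cardinal.toENat (Module.rank ℂ (eigenspaceOp T (t : ℂ)))

end Operators

/-! ### Operators on `ℓ²(V)` -/

section Graph

variable {V : Type*}

/-- The complex Hilbert space `ℓ²(V)`. -/
abbrev L2 (V : Type*) : Type _ := lp (fun _ : V => ℂ) 2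

/-- The operator in `ℓ²(V)` that acts as `L` on the maximal domain `{φ ∈ ℓ²(V) | L φ ∈ ℓ²(V)}`. -/
def maxOp (L : (V → ℂ) →ₗ[ℂ] (V → ℂ)) : L2 V →ₗ.[ℂ] L2 V where
  domain :=
    { carrier := {φ | Memℓp (L (φ : V → ℂ)) 2}
      zero_mem' := by
        change Memℓp (L ((0 : L2 V) : V → ℂ)) 2
        rw [lp.coeFn_zero, map_zero]
        exact zero_memℓp
      add_mem' := by
        intro φ ψ hφ hψ
        change Memℓp (L ((φ + ψ : L2 V) : V → ℂ)) 2
        rw [lp.coeFn_add, map_add]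
        exact Memℓp.add hφ hψ
      smul_mem' := by
        intro c φ hφ
        change Memℓp (L ((c • φ : L2 V) : V → ℂ)) 2
        rw [lp.coeFn_smul, map_smul]
        exact Memℓp.const_smul hφ c }
  toFun :=
    { toFun := fun φ => ⟨L ((φ : L2 V) : V → ℂ), φ.2⟩
      map_add' := fun φ ψ => Subtype.ext (map_add L ((φ : L2 V) : V → ℂ) ((ψ : L2 V) : V → ℂ))
      map_smul' := fun c φ => Subtype.ext (map_smul L c ((φ : L2 V) : V → ℂ)) }

/-- Multiplication by a real function `g`, on arbitrary functions. -/
def mulMap (g : V → ℝ) : (V → ℂ) →ₗ[ℂ] (V → ℂ) where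
  toFun φ := fun x => (g x : ℂ) * φ x
  map_add' φ ψ := by funext x; simp [mul_add]
  map_smul' c φ := by funext x; simp; ring

/-- `(Δ + q) φ (x) = ∑_{y ∼ x} (φ(x) - φ(y)) + q(x) φ(x)`, on arbitrary functions. -/
def schrodingerMap (G : SimpleGraph V) [G.LocallyFinite] (q : V → ℝ) :
    (V → ℂ) →ₗ[ℂ] (V → ℂ) where
  toFun φ := fun x => ∑ y ∈ G.neighborFinset x, (φ x - φ y) + (q x : ℂ) * φ x
  map_add' φ ψ := by
    funext x
    simp only [Pi.add_apply, mul_add]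
    rw [add_add_add_comm, ← Finset.sum_add_distrib]
    congr 1
    exact Finset.sum_congr rfl fun y _ => by ring
  map_smul' c φ := by
    funext x
    simp only [Pi.smul_apply, smul_eq_mul, RingHom.id_apply, mul_add, Finset.mul_sum]
    congr 1
    · exact Finset.sum_congr rfl fun y _ => by ring
    · ring

/-- The operator of multiplication by `g` with domain `{φ ∈ ℓ²(V) | g φ ∈ ℓ²(V)}`. -/
def mulOp (g : V → ℝ) : L2 V →ₗ.[ℂ] L2 V := maxOp (mulMap g)

/-- The positive part `q₊ = max(q, 0)`. -/
def posPot (q : V → ℝ) : V → ℝ := fun x => max (q x) 0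

/-- The negative part `q₋ = max(-q, 0)`. -/
def negPot (q : V → ℝ) : V → ℝ := fun x => max (-q x) 0

/-- The Schrödinger operator `Δ + q`: the form sum of `Δ + q₊` (on its maximal domain)
and `-q₋`. -/
def schrodinger (G : SimpleGraph V) [G.LocallyFinite] (q : V → ℝ) : L2 V →ₗ.[ℂ] L2 V :=
  formDiff (maxOp (schrodingerMap G (posPot q))) (mulOp (negPot q))

/-- The function `deg + q`. -/
def degAdd (G : SimpleGraph V) [G.LocallyFinite] (q : V → ℝ) : V → ℝ :=
  fun x => (G.degree x : ℝ) + q x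

/-- `⟨f, L f⟩` for a finitely supported `f` (and a symmetric `L`). -/
def quadForm (L : (V → ℂ) →ₗ[ℂ] (V → ℂ)) (f : V →₀ ℂ) : ℝ :=
  (∑ x ∈ f.support, conj (f x) * L f x).re

/-- `‖f‖²` for a finitely supported `f`. -/
def normSqFin (f : V →₀ ℂ) : ℝ := ∑ x ∈ f.support, ‖f x‖ ^ 2

/-- `q` is in the class `K_α`: there is `C ≥ 0` with `q₋ ≤ α (Δ + q₊) + C` on the finitely
supported functions. -/
def InK (G : SimpleGraph V) [G.LocallyFinite] (α : ℝ) (q : V → ℝ) : Prop :=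
  ∃ C : ℝ, 0 ≤ C ∧ ∀ f : V →₀ ℂ,
    quadForm (mulMap (negPot q)) f ≤
      α * quadForm (schrodingerMap G (posPot q)) f + C * normSqFin f

/-- `q` is in `K_{0+}`, the intersection of the classes `K_α` for `α ∈ (0,1)`. -/
def InKZeroPlus (G : SimpleGraph V) [G.LocallyFinite] (q : V → ℝ) : Prop :=
  ∀ α ∈ Set.Ioo (0 : ℝ) 1, InK G α q

/-- `|E_W|`, the number of (non-oriented) edges of the subgraph induced by `W`. -/
def edgeCount (G : SimpleGraph V) (W : Finset V) : ℝ :=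
  ({p : V × V | p.1 ∈ W ∧ p.2 ∈ W ∧ G.Adj p.1 p.2}.ncard : ℝ) / 2

/-- `|∂W|`, the number of edges emanating from `W`. -/
def boundaryCount (G : SimpleGraph V) (W : Finset V) : ℝ :=
  ({p : V × V | p.1 ∈ W ∧ p.2 ∉ W ∧ G.Adj p.1 p.2}.ncard : ℝ)

/-- `(G, q)` is `(a, k)`-sparse. -/
def IsSparse (G : SimpleGraph V) (q : V → ℝ) (a k : ℝ) : Prop :=
  ∀ W : Finset V,
    2 * edgeCount G W ≤ k * (W.card : ℝ) + a * (boundaryCount G W + ∑ x ∈ W, posPot q x)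

/-- `(G, q)` is almost sparse. -/
def AlmostSparse (G : SimpleGraph V) (q : V → ℝ) : Prop :=
  ∀ ε : ℝ, 0 < ε → ∃ k : ℝ, 0 ≤ k ∧ IsSparse G q ε k

/-- `(1 - ε)(deg + q) - k ≤ Δ + q` on the finitely supported functions. -/
def LowerBound (G : SimpleGraph V) [G.LocallyFinite] (q : V → ℝ) (ε k : ℝ) : Prop :=
  ∀ f : V →₀ ℂ,
    (1 - ε) * quadForm (mulMap (degAdd G q)) f - k * normSqFin f ≤
      quadForm (schrodingerMap G q) f

/-- `Δ + q ≤ (1 + ε)(deg + q) + k` on the finitely supported functions. -/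
def UpperBound (G : SimpleGraph V) [G.LocallyFinite] (q : V → ℝ) (ε k : ℝ) : Prop :=
  ∀ f : V →₀ ℂ,
    quadForm (schrodingerMap G q) f ≤
      (1 + ε) * quadForm (mulMap (degAdd G q)) f + k * normSqFin f

/-- `liminf_{|x| → ∞} g(x)`, the supremum over finite `W` of the infimum of `g` off `W`,
as an extended real number. -/
def liminfAtInfinity (g : V → ℝ) : EReal :=
  ⨆ W : Finset V, ⨅ x : {x : V // x ∉ W}, ((g x : ℝ) : EReal)

end Graph

end SparseGraph

end

namespace SparseGraph

/-! ### Graphs of unbounded self-adjoint operators -/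

section GraphCalculus

variable {H : Type*} [NormedAddCommGroup H] [InnerProductSpace ℂ H]

/-! Equivalence of the form bounds and sparseness. Write D for the degree form, E for the energy, Q
for the form of `q₊`. Layer-cake decomposition of `u = |f|²` extends the sparseness inequality from
finite sets to functions: the sum of `min(u(x), u(y))` over oriented edges is at most `k ∑ u + a(P +
Q)`, where P is the sum of `(u(x) - u(y))₊` (`IsSparse.edgeSum_min_le`). Since min plus positive
part gives D, this reads `D + Q ≤ (1 + a)(P + Q) + k‖f‖²`. By `||f(x)|² - |f(y)|²| ≤ |f(x) -
f(y)||f(x) + f(y)|` and a weighted AM-GM inequality, P is controlled by E and the complementary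
energy `2D - E`; a weight slightly larger than one gives the lower bound for `q₊`. The
form-smallness of `q₋` transfers it to `q`. Applying the lower bound to `|f|`, whose energy is at
most `2D - E`, gives the upper bound, and indicator functions lead back to sparseness.

Spectral consequences. Both operators are written as `B⁻¹ - c` with the same `c` and `B = C N C`,
where C is bounded, self-adjoint and injective, with the form domain as its range, and N inverts a
bounded coercive M representing the shifted form (`IsFormRep`). For the Schrödinger operator, `C =
(Δ + q₊ + 1)^(-1/2)`; for multiplication, M is the identity. The work with unbounded operators thus
reduces to bounded ones: a quotient `b a⁻¹` of commuting bounded self-adjoint operators is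
self-adjoint, and its positive square roots are unique, which makes the chosen `posSqrt` explicit.

A form inequality on finitely supported functions becomes a bounded Y with `C Y = C'`
(`IsFormRep.exists_embedding`). This single factorization gives inclusion of form domains, transfer
of compactness of C, hence of discreteness of the spectrum, and the min-max comparison of
eigenvalues. Discreteness for multiplication by `deg + q` is the condition at infinity, because the
unit masses are eigenvectors. Finally `(1 - ε) μₙ - k ≤ λₙ ≤ (1 + ε) μₙ + k` for the shifted
eigenvalues, with `μₙ → ∞`, gives the ratio limit. -/

theorem mem_graph_compOp {S T : H →ₗ.[ℂ] H} {x z : H} :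
    (x, z) ∈ (compOp S T).graph ↔ ∃ y, (x, y) ∈ T.graph ∧ (y, z) ∈ S.graph := by
  constructor
  · intro h
    obtain ⟨⟨w, hw⟩, h1, h2⟩ := (LinearPMap.mem_graph_iff _).1 h
    have hw' := hw
    obtain ⟨y, hy, hyw⟩ := hw'
    simp only at h1 h2
    subst h1
    obtain rfl : (y : H) = w := hyw
    refine ⟨T y, T.mem_graph y, ?_⟩
    rw [← h2]
    exact S.mem_graph ⟨T y, hy⟩
  · rintro ⟨y, h1, h2⟩
    obtain ⟨u, hu, rfl⟩ := (LinearPMap.mem_graph_iff _).1 h1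
    obtain ⟨v, hv, rfl⟩ := (LinearPMap.mem_graph_iff _).1 h2
    simp only at hu hv
    subst hu
    have hd : (u : H) ∈ (compOp S T).domain :=
      ⟨u, by change T u ∈ S.domain; rw [← hv]; exact v.2, rfl⟩
    refine (LinearPMap.mem_graph_iff _).2 ⟨⟨u, hd⟩, rfl, ?_⟩
    change S ⟨T u, _⟩ = S v
    congr 1
    exact Subtype.ext hv.symm

variable [CompleteSpace H]

theorem _root_.IsSelfAdjoint.mem_graph_iff {S : H →ₗ.[ℂ] H} (hS : IsSelfAdjoint S) {x y : H} :
    (x, y) ∈ S.graph ↔ ∀ u v, (u, v) ∈ S.graph → inner ℂ v x = inner ℂ u y := by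
  conv_lhs => rw [← LinearPMap.isSelfAdjoint_def.1 hS,
    LinearPMap.adjoint_graph_eq_graph_adjoint hS.dense_domain]
  simp [Submodule.mem_adjoint_iff, sub_eq_zero]

theorem isSelfAdjoint_of_mem_graph_iff {S : H →ₗ.[ℂ] H} (hd : Dense (S.domain : Set H))
    (h : ∀ x y, (x, y) ∈ S.graph ↔ ∀ u v, (u, v) ∈ S.graph → inner ℂ v x = inner ℂ u y) :
    IsSelfAdjoint S := by
  rw [LinearPMap.isSelfAdjoint_def]
  apply LinearPMap.eq_of_eq_graph
  rw [LinearPMap.adjoint_graph_eq_graph_adjoint hd]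
  ext ⟨x, y⟩
  rw [h, Submodule.mem_adjoint_iff]
  simp [sub_eq_zero]

theorem _root_.IsSelfAdjoint.inner_graph {S : H →ₗ.[ℂ] H} (hS : IsSelfAdjoint S) {x y u v : H}
    (h : (x, y) ∈ S.graph) (h' : (u, v) ∈ S.graph) : inner ℂ v x = inner ℂ u y :=
  hS.mem_graph_iff.1 h u v h'

/-- Self-adjoint operators are maximal symmetric, so they have no proper self-adjoint extension. -/
theorem _root_.IsSelfAdjoint.eq_of_graph_le {S S' : H →ₗ.[ℂ] H} (hS : IsSelfAdjoint S)
    (hS' : IsSelfAdjoint S') (h : ∀ x y, (x, y) ∈ S.graph → (x, y) ∈ S'.graph) : S' = S := by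
  apply LinearPMap.eq_of_eq_graph
  ext ⟨x, y⟩
  refine ⟨fun hx => hS.mem_graph_iff.2 fun u v huv => ?_, h x y⟩
  exact hS'.inner_graph hx (h u v huv)

theorem clm_inner_left {a : H →L[ℂ] H} (ha : IsSelfAdjoint a) (x y : H) :
    inner ℂ (a x) y = inner ℂ x (a y) := by
  have := ContinuousLinearMap.adjoint_inner_left a y x
  rwa [ha.adjoint_eq] at this

theorem denseRange_of_injective {a : H →L[ℂ] H} (ha : IsSelfAdjoint a)
    (hi : Function.Injective a) : DenseRange a := by
  have : ((a : H →ₗ[ℂ] H).range).topologicalClosure = ⊤ := by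
    rw [Submodule.topologicalClosure_eq_top_iff, Submodule.eq_bot_iff]
    intro x hx
    apply hi
    rw [map_zero, ← inner_self_eq_zero (𝕜 := ℂ), ← clm_inner_left ha]
    exact (Submodule.mem_orthogonal _ _).1 hx _ ⟨a x, rfl⟩
  exact (Submodule.dense_iff_topologicalClosure_eq_top).2 this

end GraphCalculus

/-! ### Self-adjoint operators as quotients of bounded ones -/

section Quotients

variable {H : Type*} [NormedAddCommGroup H] [InnerProductSpace ℂ H]

/-- The operator `b a⁻¹` on the range of `a`, for bounded `a` and `b`. -/
noncomputable def quotOp (a b : H →L[ℂ] H) : H →ₗ.[ℂ] H :=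
  (LinearMap.range ((a : H →ₗ[ℂ] H).prod (b : H →ₗ[ℂ] H))).toLinearPMap

theorem mem_graph_quotOp {a b : H →L[ℂ] H} (ha : Function.Injective a) {x y : H} :
    (x, y) ∈ (quotOp a b).graph ↔ ∃ k, a k = x ∧ b k = y := by
  rw [quotOp, Submodule.toLinearPMap_graph_eq]
  · simp
  · rintro ⟨u, v⟩ ⟨k, hk⟩ rfl
    simp only [LinearMap.prod_apply, Function.prod_apply, ContinuousLinearMap.coe_coe, Prod.mk.injEq] at hk
    have : k = 0 := ha (by rw [hk.1, map_zero])
    simp [← hk.2, this]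

theorem quotOp_domain (a b : H →L[ℂ] H) :
    (quotOp a b).domain = LinearMap.range (a : H →ₗ[ℂ] H) := by
  rw [quotOp, Submodule.toLinearPMap_domain]
  ext x
  simp

theorem mem_quotOp_domain {a b : H →L[ℂ] H} (k : H) : a k ∈ (quotOp a b).domain := by
  rw [quotOp_domain]
  exact ⟨k, rfl⟩

theorem quotOp_apply {a b : H →L[ℂ] H} (ha : Function.Injective a) (k : H)
    (hk : a k ∈ (quotOp a b).domain) : quotOp a b ⟨a k, hk⟩ = b k := by
  have h1 := (quotOp a b).mem_graph ⟨a k, hk⟩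
  have h2 : (a k, b k) ∈ (quotOp a b).graph := (mem_graph_quotOp ha).2 ⟨k, rfl, rfl⟩
  exact LinearPMap.mem_graph_snd_inj _ h1 h2 rfl

variable [CompleteSpace H]

/-- Commuting bounded self-adjoint operators `a`, `b` with `a` injective and `a² + b²` invertible:
the hypotheses under which `b a⁻¹` is self-adjoint. -/
structure IsQuotPair (a b : H →L[ℂ] H) : Prop where
  left : IsSelfAdjoint a
  right : IsSelfAdjoint b
  comm : Commute a b
  inj : Function.Injective a
  unit : IsUnit (a * a + b * b)

namespace IsQuotPair

variable {a b : H →L[ℂ] H}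

theorem exists_inverse (h : IsQuotPair a b) : ∃ d : H →L[ℂ] H, (a * a + b * b) * d = 1 ∧
    Commute a d ∧ Commute b d := by
  obtain ⟨u, hu⟩ := h.unit
  refine ⟨↑u⁻¹, by rw [← hu]; exact u.mul_inv, ?_, ?_⟩
  · have : Commute a (u : H →L[ℂ] H) := by
      rw [hu]
      exact ((Commute.refl a).mul_right (Commute.refl a)).add_right (h.comm.mul_right h.comm)
    exact this.units_inv_right
  · have : Commute b (u : H →L[ℂ] H) := by
      rw [hu]
      exact (h.comm.symm.mul_right h.comm.symm).add_right
        ((Commute.refl b).mul_right (Commute.refl b))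
    exact this.units_inv_right

theorem isSelfAdjoint (h : IsQuotPair a b) : IsSelfAdjoint (quotOp a b) := by
  apply isSelfAdjoint_of_mem_graph_iff
  · rw [quotOp_domain]
    exact denseRange_of_injective h.left h.inj
  · intro x y
    constructor
    · intro hx u v huv
      obtain ⟨k, rfl, rfl⟩ := (mem_graph_quotOp h.inj).1 hx
      obtain ⟨l, rfl, rfl⟩ := (mem_graph_quotOp h.inj).1 huv
      rw [clm_inner_left h.right, clm_inner_left h.left]
      have := DFunLike.congr_fun h.comm k
      simp only [mul_apply_eq_comp] at this
      rw [this]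
    · intro hx
      obtain ⟨d, hd, had, hbd⟩ := h.exists_inverse
      have key : a y = b x := by
        apply ext_inner_left ℂ
        intro k
        rw [← clm_inner_left h.left, ← clm_inner_left h.right]
        exact (hx _ _ ((mem_graph_quotOp h.inj).2 ⟨k, rfl, rfl⟩)).symm
      rw [mem_graph_quotOp h.inj]
      have hd' : ∀ z, a (a (d z)) + b (b (d z)) = z := fun z => by
        simpa using DFunLike.congr_fun hd z
      have ha : ∀ z, a (d z) = d (a z) := fun z => by
        simpa using DFunLike.congr_fun had z
      have hb : ∀ z, b (d z) = d (b z) := fun z => by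
        simpa using DFunLike.congr_fun hbd z
      have hab : ∀ z, a (b z) = b (a z) := fun z => by
        simpa using DFunLike.congr_fun h.comm z
      -- The equations `a k = x`, `b k = y` force `(a² + b²) k = a x + b y`; conversely this `k`
      -- solves them because `a y = b x`.
      refine ⟨d (a x + b y), ?_, ?_⟩
      · rw [ha, map_add, hab, key]
        conv_rhs => rw [← hd' x]
        simp only [ha, hb, map_add]
      · rw [hb, map_add, ← hab, ← key]
        conv_rhs => rw [← hd' y]
        simp only [ha, hb, map_add]

theorem injective_sq (h : IsQuotPair a b) : Function.Injective (a * a : H →L[ℂ] H) := by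
  intro x y hxy
  exact h.inj (h.inj (by simpa using hxy))

/-- If `b g = a k`, then `g = a l` and `k = b l` for the common vector `l = d (a g + b k)`, with `d
= (a² + b²)⁻¹`. So the natural domain of the composition is exactly the range of `a²`. -/
theorem compOp_self (h : IsQuotPair a b) :
    compOp (quotOp a b) (quotOp a b) = quotOp (a * a) (b * b) := by
  apply LinearPMap.eq_of_eq_graph
  obtain ⟨d, hd, had, hbd⟩ := h.exists_inverse
  have hd' : ∀ z, a (a (d z)) + b (b (d z)) = z := fun z => by
    simpa using DFunLike.congr_fun hd z
  have ha : ∀ z, a (d z) = d (a z) := fun z => by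
    simpa using DFunLike.congr_fun had z
  have hb : ∀ z, b (d z) = d (b z) := fun z => by
    simpa using DFunLike.congr_fun hbd z
  have hab : ∀ z, a (b z) = b (a z) := fun z => by
    simpa using DFunLike.congr_fun h.comm z
  ext ⟨x, z⟩
  rw [mem_graph_compOp, mem_graph_quotOp h.injective_sq]
  constructor
  · rintro ⟨y, h1, h2⟩
    obtain ⟨g, rfl, rfl⟩ := (mem_graph_quotOp h.inj).1 h1
    obtain ⟨k, hk, rfl⟩ := (mem_graph_quotOp h.inj).1 h2
    have hg : a (d (a g + b k)) = g := by
      conv_rhs => rw [← hd' g]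
      simp only [ha, hb, map_add, hab, hk]
    have hg' : b (d (a g + b k)) = k := by
      conv_rhs => rw [← hd' k]
      simp only [ha, hb, map_add, ← hab, hk]
    refine ⟨d (a g + b k), ?_, ?_⟩
    · change a (a (d (a g + b k))) = a g
      rw [hg]
    · change b (b (d (a g + b k))) = b k
      rw [hg']
  · rintro ⟨k, rfl, rfl⟩
    refine ⟨a (b k), (mem_graph_quotOp h.inj).2 ⟨a k, rfl, (hab k).symm⟩,
      (mem_graph_quotOp h.inj).2 ⟨b k, rfl, rfl⟩⟩

theorem isPosSqrt (h : IsQuotPair a b) (hab : 0 ≤ a * b) :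
    IsPosSqrt (quotOp a b) (quotOp (a * a) (b * b)) := by
  refine ⟨h.isSelfAdjoint, ?_, h.compOp_self⟩
  rintro ⟨x, hx⟩
  obtain ⟨k, rfl, hk⟩ := (mem_graph_quotOp h.inj).1 ((quotOp a b).mem_graph ⟨x, hx⟩)
  rw [← hk, clm_inner_left h.left]
  have := ((ContinuousLinearMap.nonneg_iff_isPositive _).1 hab).re_inner_nonneg_right k
  simpa using this

end IsQuotPair

end Quotients
-- Uniqueness of non-negative square roots
section SquareRoots

variable {H : Type*} [NormedAddCommGroup H] [InnerProductSpace ℂ H]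

theorem re_inner_nonneg_of_nonneg {M : H →L[ℂ] H} (h : 0 ≤ M) (x : H) :
    0 ≤ (inner ℂ x (M x)).re :=
  ((ContinuousLinearMap.nonneg_iff_isPositive _).1 h).re_inner_nonneg_right x

variable [CompleteSpace H]

theorem isPositive_of_symm {M : H →L[ℂ] H} (h1 : ∀ x y, inner ℂ (M x) y = inner ℂ x (M y))
    (h2 : ∀ x, 0 ≤ (inner ℂ x (M x)).re) : 0 ≤ M := by
  rw [ContinuousLinearMap.nonneg_iff_isPositive, ContinuousLinearMap.isPositive_def']
  refine ⟨?_, fun x => ?_⟩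
  · rw [ContinuousLinearMap.isSelfAdjoint_iff_isSymmetric]
    exact h1
  · rw [ContinuousLinearMap.reApplyInnerSelf_apply, h1]
    exact h2 x

/-- Reduction to uniqueness of bounded positive square roots. With `d = (a² + b²)⁻¹`, the resolvent
`(1 + S²)⁻¹` is `a² d`, and `S (1 + S²)⁻¹` is bounded and positive with square `(a² d)(b² d)`, as is
`a b d`. Equality of the two determines `S` on the range of `a²`, and closedness does the rest. -/
theorem IsPosSqrt.eq_quotOp {a b : H →L[ℂ] H} (h : IsQuotPair a b) (hab : 0 ≤ a * b)
    {S : H →ₗ.[ℂ] H} (hS : IsPosSqrt S (quotOp (a * a) (b * b))) : S = quotOp a b := by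
  obtain ⟨hsa, hpos, hcomp⟩ := hS
  obtain ⟨d, hd, had, hbd⟩ := h.exists_inverse
  have hd' : ∀ z, a (a (d z)) + b (b (d z)) = z := fun z => by
    simpa using DFunLike.congr_fun hd z
  have ha : ∀ z, a (d z) = d (a z) := fun z => by
    simpa using DFunLike.congr_fun had z
  have hb : ∀ z, b (d z) = d (b z) := fun z => by
    simpa using DFunLike.congr_fun hbd z
  have hab' : ∀ z, a (b z) = b (a z) := fun z => by
    simpa using DFunLike.congr_fun h.comm z
  have hd'' : ∀ z, d (a (a z) + b (b z)) = z := fun z => by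
    rw [map_add, ← ha, ← ha, ← hb, ← hb, hd']
  have hgraph : ∀ x z, (∃ y, (x, y) ∈ S.graph ∧ (y, z) ∈ S.graph) ↔
      ∃ k, a (a k) = x ∧ b (b k) = z := by
    intro x z
    rw [← mem_graph_compOp, hcomp, mem_graph_quotOp h.injective_sq]
    rfl
  -- the bounded operator `S (1 + S²)⁻¹`
  have hex : ∀ k, ∃ y, (a (a (d k)), y) ∈ S.graph ∧ (y, b (b (d k))) ∈ S.graph :=
    fun k => (hgraph _ _).2 ⟨d k, rfl, rfl⟩
  choose m hm1 hm2 using hex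
  have hval : ∀ {x y y'}, (x, y) ∈ S.graph → (x, y') ∈ S.graph → y = y' := fun h1 h2 =>
    LinearPMap.mem_graph_snd_inj _ h1 h2 rfl
  -- Injectivity of `1 + S²`: if `x + S² x = 0` then `‖x‖² + ‖S x‖² = 0`.
  have huniq : ∀ x y z, (x, y) ∈ S.graph → (y, z) ∈ S.graph → x + z = 0 → x = 0 := by
    intro x y z h1 h2 h3
    have h4 : inner ℂ z x = inner ℂ y y := hsa.inner_graph h1 h2
    rw [← inner_self_eq_zero (𝕜 := ℂ)]
    have h5 : inner ℂ x x + inner ℂ y y = 0 := by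
      rw [← h4, ← inner_add_left, h3, inner_zero_left]
    have h6 := congrArg Complex.re h5
    rw [inner_self_eq_norm_sq_to_K, inner_self_eq_norm_sq_to_K] at h6
    norm_cast at h6
    have : ‖x‖ = 0 := by
      have := sq_nonneg ‖x‖
      have := sq_nonneg ‖y‖
      have h7 : ‖x‖ ^ 2 + ‖y‖ ^ 2 = 0 := by exact_mod_cast h6
      have : ‖x‖ ^ 2 = 0 := by linarith
      simpa using this
    simp [norm_eq_zero.1 this]
  have hpos' : ∀ x y, (x, y) ∈ S.graph → 0 ≤ (inner ℂ x y).re := by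
    intro x y hxy
    obtain ⟨u, hu, rfl⟩ := (LinearPMap.mem_graph_iff _).1 hxy
    simp only at hu
    subst hu
    exact hpos u
  let M₀ : H →ₗ[ℂ] H :=
    { toFun := m
      map_add' := fun x y => hval (hm1 _) (by
        have := S.graph.add_mem (hm1 x) (hm1 y)
        simpa using this)
      map_smul' := fun c x => hval (hm1 _) (by
        have := S.graph.smul_mem c (hm1 x)
        simpa using this) }
  have hinner : ∀ x y, inner ℂ (m x) y = inner ℂ x (m y) := by
    intro x y
    have e1 : inner ℂ (m x) (a (a (d y))) = inner ℂ (a (a (d x))) (m y) :=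
      hsa.inner_graph (hm1 y) (hm1 x)
    have e2 : inner ℂ (b (b (d x))) (m y) = inner ℂ (m x) (b (b (d y))) :=
      hsa.inner_graph (hm2 y) (hm2 x)
    conv_lhs => rw [← hd' y]
    conv_rhs => rw [← hd' x]
    rw [inner_add_left, inner_add_right, e1, e2]
  let M : H →L[ℂ] H := ⟨M₀, LinearMap.IsSymmetric.continuous (T := M₀) hinner⟩
  have hM : ∀ x, M x = m x := fun _ => rfl
  have hMpos : 0 ≤ M := by
    refine isPositive_of_symm hinner fun x => ?_
    rw [hM]
    conv =>
      enter [2, 1, 2]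
      rw [← hd' x]
    have e2 : inner ℂ (b (b (d x))) (m x) = inner ℂ (m x) (b (b (d x))) :=
      hsa.inner_graph (hm2 x) (hm2 x)
    rw [inner_add_left, e2, Complex.add_re]
    exact add_nonneg (hpos' _ _ (hm1 x)) (hpos' _ _ (hm2 x))
  have hMM : M * M = (a * a * d) * (b * b * d) := by
    ext x
    change m (m x) = a (a (d (b (b (d x)))))
    have e1 : (a (a (d (m x))), m (m x)) ∈ S.graph := hm1 _
    have e2 : (m x, b (b (d x))) ∈ S.graph := hm2 _
    -- `w = (1 + S²)⁻¹ a² d x`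
    set f := a (a (d x)) with hf
    have hw1 := hm1 f
    have hw2 := hm2 f
    obtain ⟨y3, hy3⟩ : ∃ y3, (b (b (d f)), y3) ∈ S.graph := by
      have hsum := hd' f
      refine ⟨m x - m f, ?_⟩
      have := S.graph.sub_mem (hm1 x) hw1
      rw [show b (b (d f)) = f - a (a (d f)) by rw [eq_sub_iff_add_eq, add_comm, hsum]]
      simpa using this
    -- The resolvent commutes with `S`: both sides solve `(1 + S²) w = m x`, and `huniq` applies to
    -- their difference.
    have hv : a (a (d (m x))) = m f := by
      have k1 : (a (a (d (m x))) - m f, m (m x) - b (b (d f))) ∈ S.graph := by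
        simpa using S.graph.sub_mem e1 hw2
      have k2 : (m (m x) - b (b (d f)), b (b (d (m x))) - y3) ∈ S.graph := by
        simpa using S.graph.sub_mem (hm2 (m x)) hy3
      have k3 : m f + y3 = m x := by
        have := S.graph.add_mem hw1 hy3
        rw [Prod.mk_add_mk, hd'] at this
        exact hval this (hm1 x)
      have := huniq _ _ _ k1 k2 (by
        rw [sub_add_sub_comm, hd', k3, sub_self])
      exact sub_eq_zero.1 this
    have hfin : m (m x) = b (b (d f)) := by
      rw [hv] at e1
      exact hval e1 hw2
    rw [hfin, hf]
    simp only [ha, hb, hab']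
  have hN : (0 : H →L[ℂ] H) ≤ a * b * d := by
    have hsymm : ∀ x y, inner ℂ (a (b x)) y = inner ℂ x (a (b y)) := fun x y => by
      rw [clm_inner_left h.left, clm_inner_left h.right, hab']
    have hdsymm : ∀ x y, inner ℂ (d x) y = inner ℂ x (d y) := fun x y => by
      conv_lhs => rw [← hd' y]
      conv_rhs => rw [← hd' x]
      rw [inner_add_left, inner_add_right, clm_inner_left h.left, clm_inner_left h.left,
        clm_inner_left h.right, clm_inner_left h.right]
    refine isPositive_of_symm (fun x y => ?_) fun x => ?_
    · change inner ℂ (a (b (d x))) y = inner ℂ x (a (b (d y)))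
      rw [hsymm, hdsymm]
      simp only [ha, hb]
    · change 0 ≤ (inner ℂ x (a (b (d x)))).re
      conv =>
        enter [2, 1, 2]
        rw [← hd' x]
      rw [inner_add_left, Complex.add_re, clm_inner_left h.left, clm_inner_left h.right]
      have p1 := re_inner_nonneg_of_nonneg hab (a (d x))
      have p2 := re_inner_nonneg_of_nonneg hab (b (d x))
      simp only [mul_apply_eq_comp] at p1 p2
      rw [← hab'] at p1
      rw [hab' (b (d x))] at p2
      exact add_nonneg p1 p2
  have hNN : (a * b * d) * (a * b * d) = (a * a * d) * (b * b * d) := by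
    ext x
    change a (b (d (a (b (d x))))) = a (a (d (b (b (d x)))))
    simp only [ha, hb, hab']
  have hMN : M = a * b * d := by
    rw [← CFC.sqrt_unique hMM hMpos, ← CFC.sqrt_unique hNN hN]
  have hmem : ∀ k, (a (a k), b (a k)) ∈ S.graph := by
    intro k
    have := hm1 (a (a k) + b (b k))
    rw [hd''] at this
    have h2 : m (a (a k) + b (b k)) = b (a k) := by
      rw [← hM, hMN]
      change a (b (d _)) = _
      rw [hd'', hab']
    rwa [h2] at this
  refine (h.isSelfAdjoint.eq_of_graph_le hsa ?_)
  intro x y hxy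
  obtain ⟨k, rfl, rfl⟩ := (mem_graph_quotOp h.inj).1 hxy
  -- The relation `S (a k) = b k` is known for `k` in the dense range of `a`, and it is closed in
  -- `k`.
  have hcl : IsClosed {k : H | (a k, b k) ∈ S.graph} :=
    IsClosed.preimage (f := fun k => (a k, b k)) (by fun_prop) hsa.isClosed
  have := (denseRange_of_injective h.left h.inj).induction_on (p := fun k => (a k, b k) ∈ S.graph)
    k hcl hmem
  exact this

/-- Uniqueness turns the arbitrary choice in `posSqrt` into a formula. -/
theorem posSqrt_quotOp {a b : H →L[ℂ] H} (h : IsQuotPair a b) (hab : 0 ≤ a * b) :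
    posSqrt (quotOp (a * a) (b * b)) = quotOp a b := by
  have hex : ∃ S, IsPosSqrt S (quotOp (a * a) (b * b)) := ⟨_, h.isPosSqrt hab⟩
  rw [posSqrt, dif_pos hex]
  exact IsPosSqrt.eq_quotOp h hab hex.choose_spec

theorem isQuotPair_cfc {B : H →L[ℂ] H} (hB : IsSelfAdjoint B) {f g : ℝ → ℝ}
    (hf : ContinuousOn f (spectrum ℝ B)) (hg : ContinuousOn g (spectrum ℝ B))
    (hinj : Function.Injective (cfc f B : H →L[ℂ] H)) (h0 : ∀ x ∈ spectrum ℝ B, f x * f x + g x * g x ≠ 0) :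
    IsQuotPair (cfc f B) (cfc g B) where
  left := cfc_predicate f B
  right := cfc_predicate g B
  comm := cfc_commute_cfc f g B
  inj := hinj
  unit := by
    rw [← cfc_mul f f B, ← cfc_mul g g B, ← cfc_add B (fun x => f x * f x) (fun x => g x * g x)]
    rw [isUnit_cfc_iff (fun x => f x * f x + g x * g x) B]
    exact h0

end SquareRoots

/-! ### Operators given by a shifted bounded inverse -/

section Resolvents

variable {H : Type*} [NormedAddCommGroup H] [InnerProductSpace ℂ H]

/-- The operator `B⁻¹ - c`. -/
noncomputable def invSubOp (B : H →L[ℂ] H) (c : ℝ) : H →ₗ.[ℂ] H := quotOp B (1 - (c : ℂ) • B)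

theorem mem_eigenspaceOp_invSubOp {B : H →L[ℂ] H} (hi : Function.Injective B) (c : ℝ) (z : ℂ)
    (x : H) : x ∈ eigenspaceOp (invSubOp B c) z ↔ (c + z) • B x = x := by
  have key : x ∈ eigenspaceOp (invSubOp B c) z ↔ (x, z • x) ∈ (invSubOp B c).graph := by
    rw [eigenspaceOp, Submodule.mem_map, LinearPMap.mem_graph_iff]
    simp only [LinearMap.mem_ker, LinearMap.sub_apply, sub_eq_zero]
    constructor
    · rintro ⟨y, hy, rfl⟩
      exact ⟨y, rfl, hy⟩
    · rintro ⟨y, rfl, hy⟩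
      exact ⟨y, hy, rfl⟩
  rw [key, invSubOp, mem_graph_quotOp hi]
  constructor
  · rintro ⟨k, rfl, hk⟩
    have : k = (c + z) • B k := by
      simp only [sub_apply, one_apply_eq_self,
        smul_apply, sub_eq_iff_eq_add] at hk
      rw [add_smul, add_comm, ← hk]
    conv_rhs => rw [this]
    simp
  · intro h
    refine ⟨(c + z) • x, by simpa using h, ?_⟩
    simp only [sub_apply, one_apply_eq_self,
      smul_apply, map_smul]
    rw [smul_sub, smul_comm, h, add_smul, add_sub_cancel_left]

variable [CompleteSpace H]

theorem cfc_id_of_nonneg {B : H →L[ℂ] H} (hB : 0 ≤ B) : cfc (fun x : ℝ => x) B = B :=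
  cfc_id' ℝ B (IsSelfAdjoint.of_nonneg hB)

theorem cfc_one_sub {B : H →L[ℂ] H} (hB : 0 ≤ B) (c : ℝ) :
    cfc (fun x : ℝ => 1 - c * x) B = 1 - (c : ℂ) • B := by
  have hsa := IsSelfAdjoint.of_nonneg hB
  rw [cfc_sub (fun _ : ℝ => (1 : ℝ)) (fun x : ℝ => c * x) B, cfc_const_one ℝ B,
    cfc_const_mul c (fun x : ℝ => x) B, cfc_id' ℝ B]
  simp

theorem cfc_sqrt_mul_self {B : H →L[ℂ] H} (hB : 0 ≤ B) : cfc Real.sqrt B * cfc Real.sqrt B = B := by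
  rw [← cfc_mul Real.sqrt Real.sqrt B]
  conv_rhs => rw [← cfc_id_of_nonneg hB]
  exact cfc_congr fun x hx => Real.mul_self_sqrt (spectrum_nonneg_of_nonneg hB hx)

theorem cfc_sqrt_injective {B : H →L[ℂ] H} (hB : 0 ≤ B) (hi : Function.Injective B) :
    Function.Injective (cfc Real.sqrt B : H →L[ℂ] H) := by
  intro x y hxy
  apply hi
  rw [← cfc_sqrt_mul_self hB]
  simp [hxy]

theorem isQuotPair_invSubOp {B : H →L[ℂ] H} (hB : 0 ≤ B) (hi : Function.Injective B) (c : ℝ) :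
    IsQuotPair B (1 - (c : ℂ) • B) := by
  have h := isQuotPair_cfc (IsSelfAdjoint.of_nonneg hB) (f := fun x => x) (g := fun x => 1 - c * x)
    (by fun_prop) (by fun_prop) (by rwa [cfc_id_of_nonneg hB]) (by
      intro x _ h
      have h1 : x = 0 := by nlinarith [mul_self_nonneg x, mul_self_nonneg (1 - c * x)]
      subst h1
      norm_num at h)
  rwa [cfc_id_of_nonneg hB, cfc_one_sub hB] at h

theorem isSelfAdjoint_invSubOp {B : H →L[ℂ] H} (hB : 0 ≤ B) (hi : Function.Injective B) (c : ℝ) :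
    IsSelfAdjoint (invSubOp B c) :=
  (isQuotPair_invSubOp hB hi c).isSelfAdjoint

theorem isQuotPair_sqrt {B : H →L[ℂ] H} (hB : 0 ≤ B) (hi : Function.Injective B) (c : ℝ) :
    IsQuotPair (cfc Real.sqrt B) (cfc (fun x => Real.sqrt |1 - c * x|) B) := by
  refine isQuotPair_cfc (IsSelfAdjoint.of_nonneg hB) (by fun_prop) (by fun_prop)
    (cfc_sqrt_injective hB hi) ?_
  intro x hx h
  have hx0 := spectrum_nonneg_of_nonneg hB hx
  rw [Real.mul_self_sqrt hx0, Real.mul_self_sqrt (abs_nonneg _)] at h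
  have h1 : x = 0 := by linarith [abs_nonneg (1 - c * x)]
  subst h1
  norm_num at h

theorem posSqrt_quotOp_abs {B : H →L[ℂ] H} (hB : 0 ≤ B) (hi : Function.Injective B) (c : ℝ) :
    posSqrt (quotOp B (cfc (fun x => |1 - c * x|) B)) =
      quotOp (cfc Real.sqrt B) (cfc (fun x => Real.sqrt |1 - c * x|) B) := by
  rw [← posSqrt_quotOp (isQuotPair_sqrt hB hi c), cfc_sqrt_mul_self hB,
    ← cfc_mul (fun x => Real.sqrt |1 - c * x|) (fun x => Real.sqrt |1 - c * x|) B]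
  · congr 2
    exact cfc_congr fun x _ => (Real.mul_self_sqrt (abs_nonneg _)).symm
  · rw [← cfc_mul Real.sqrt (fun x => Real.sqrt |1 - c * x|) B]
    exact cfc_nonneg fun x _ => by positivity

theorem absOp_invSubOp {B : H →L[ℂ] H} (hB : 0 ≤ B) (hi : Function.Injective B) (c : ℝ) :
    absOp (invSubOp B c) = quotOp B (cfc (fun x => |1 - c * x|) B) := by
  have h := isQuotPair_invSubOp hB hi c
  have h' : IsQuotPair B (cfc (fun x => |1 - c * x|) B) := by
    have := isQuotPair_cfc (IsSelfAdjoint.of_nonneg hB) (f := fun x => x)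
      (g := fun x => |1 - c * x|) (by fun_prop) (by fun_prop) (by rwa [cfc_id_of_nonneg hB]) (by
        intro x _ h
        rw [abs_mul_abs_self] at h
        have h1 : x = 0 := by nlinarith [mul_self_nonneg x, mul_self_nonneg (1 - c * x)]
        subst h1
        norm_num at h)
    rwa [cfc_id_of_nonneg hB] at this
  rw [absOp, LinearPMap.isSelfAdjoint_def.1 (isSelfAdjoint_invSubOp hB hi c), invSubOp,
    h.compOp_self, ← posSqrt_quotOp h']
  · congr 2
    rw [← cfc_one_sub hB, ← cfc_mul _ _ B, ← cfc_mul _ _ B]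
    exact cfc_congr fun x _ => (abs_mul_abs_self _).symm
  · conv_rhs => enter [1]; rw [← cfc_id_of_nonneg hB]
    rw [← cfc_mul _ _ B]
    exact cfc_nonneg fun x hx => mul_nonneg (spectrum_nonneg_of_nonneg hB hx) (abs_nonneg _)

/-- The functional calculus gives `|B⁻¹ - c|^(1/2) = |1 - c B|^(1/2) B^(-1/2)`, and its domain does
not depend on the shift `c`. -/
theorem formDomain_invSubOp {B : H →L[ℂ] H} (hB : 0 ≤ B) (hi : Function.Injective B) (c : ℝ) :
    formDomain (invSubOp B c) = LinearMap.range ((cfc Real.sqrt B : H →L[ℂ] H) : H →ₗ[ℂ] H) := by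
  rw [formDomain, absOp_invSubOp hB hi, posSqrt_quotOp_abs hB hi, quotOp_domain]

/-- On `x = B k` the operator `B⁻¹ - c - z` acts as `(1 - (c + z) B) k`, and `k ↦ B k` is a
bijection onto the domain. -/
theorem spectrumOp_invSubOp {B : H →L[ℂ] H} (hi : Function.Injective B) (c : ℝ) (z : ℂ) :
    z ∈ spectrumOp (invSubOp B c) ↔ ¬ IsUnit (1 - (c + z) • B) := by
  rw [spectrumOp, Set.mem_ofPred_eq, ContinuousLinearMap.isUnit_iff_bijective, not_iff_not]
  let e : H ≃ (invSubOp B c).domain := Equiv.ofBijective (fun k => ⟨B k, mem_quotOp_domain k⟩) (by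
    constructor
    · intro x y hxy
      exact hi (congrArg Subtype.val hxy)
    · rintro ⟨x, hx⟩
      have hx' := hx
      rw [invSubOp, quotOp_domain] at hx'
      obtain ⟨k, rfl⟩ := hx'
      exact ⟨k, rfl⟩)
  rw [← e.bijective.of_comp_iff]
  have : ((fun x : (invSubOp B c).domain => invSubOp B c x - z • (x : H)) ∘ e) =
      ⇑(1 - (c + z) • B) := by
    funext k
    change quotOp B (1 - (c : ℂ) • B) ⟨B k, mem_quotOp_domain k⟩ - z • B k = _
    rw [quotOp_apply hi]
    simp [add_smul, sub_sub]
  rw [this]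

end Resolvents
-- Increasing enumeration of a proper family of reals
section Sorting

theorem exists_equiv_nat_monotone {ι : Type*} [Infinite ι] (g : ι → ℝ)
    (hg : ∀ M : ℝ, {i | g i ≤ M}.Finite) : ∃ σ : ℕ ≃ ι, Monotone (g ∘ σ) := by
  have hc : Countable ι := by
    rw [← Set.countable_univ_iff]
    have : (Set.univ : Set ι) = ⋃ n : ℕ, {i | g i ≤ n} := by
      ext i
      simpa using exists_nat_ge (g i)
    rw [this]
    exact Set.countable_iUnion fun n => (hg n).countable
  obtain ⟨code, hcode⟩ := exists_injective_nat ι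
  -- The injective code breaks ties, so that each index gets a distinct rank: the number of strictly
  -- smaller keys.
  let κ : ι → ℝ ×ₗ ℕ := fun i => toLex (g i, code i)
  have hκ : Function.Injective κ := fun i j hij => hcode (by
    have := congrArg (fun p => (ofLex p).2) hij
    exact this)
  have hκg : ∀ i j, κ i ≤ κ j → g i ≤ g j := fun i j hij => by
    rcases (Prod.Lex.le_iff).1 hij with h | h
    · exact h.le
    · exact h.1.le
  have hfin : ∀ i, {j | κ j < κ i}.Finite := fun i =>
    (hg (g i)).subset fun j hj => hκg j i (le_of_lt hj)
  let r : ι → ℕ := fun i => (hfin i).toFinset.card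
  have hr : ∀ i j, κ i < κ j → r i < r j := by
    intro i j hij
    apply Finset.card_lt_card
    rw [Finset.ssubset_iff_of_subset]
    · exact ⟨i, by simpa using hij, by simp⟩
    · intro k hk
      simp only [Set.Finite.mem_toFinset, Set.mem_ofPred_eq] at hk ⊢
      exact hk.trans hij
  have hri : Function.Injective r := by
    intro i j hij
    by_contra hne
    rcases lt_or_gt_of_ne (fun h => hne (hκ h)) with h | h
    · exact absurd hij (hr _ _ h).ne
    · exact absurd hij (hr _ _ h).ne'
  have hinf : Infinite (Set.range r) := (Set.infinite_range_of_injective hri).to_subtype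
  classical
  let σ₁ := Nat.Subtype.orderIsoOfNat (Set.range r)
  let σ₂ := Equiv.ofInjective r hri
  refine ⟨σ₁.toEquiv.trans σ₂.symm, fun m n hmn => ?_⟩
  have h1 : ((σ₁ m : Set.range r) : ℕ) ≤ σ₁ n := σ₁.monotone hmn
  apply hκg
  by_contra hlt
  rw [not_le] at hlt
  have h2 := hr _ _ hlt
  have h3 : ∀ k, r (σ₂.symm (σ₁ k)) = σ₁ k := fun k =>
    congrArg Subtype.val (Equiv.apply_symm_apply σ₂ (σ₁ k))
  have h4 : r (σ₂.symm (σ₁ n)) < r (σ₂.symm (σ₁ m)) := h2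
  rw [h3, h3] at h4
  exact absurd h1 (not_le.2 h4)

end Sorting

/-! ### Compact inverses and discrete spectrum -/

section Discrete

variable {H : Type*} [NormedAddCommGroup H] [InnerProductSpace ℂ H]

/-- Infinitely many such indices would give images `B (e i)` at mutual distance at least `δ` inside
a compact set. -/
theorem finite_setOf_le_norm_eigenvalue {B : H →L[ℂ] H} (hB : IsCompactOperator B) {ι : Type*}
    {e : ι → H} (he : Orthonormal ℂ e) {κ : ι → ℂ} (hκ : ∀ i, B (e i) = κ i • e i) {δ : ℝ}
    (hδ : 0 < δ) : {i | δ ≤ ‖κ i‖}.Finite := by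
  by_contra hinf
  let u : ℕ → ι := fun n => Set.Infinite.natEmbedding _ hinf n
  have hu : Function.Injective u := fun m n h =>
    (Set.Infinite.natEmbedding _ hinf).injective (Subtype.ext h)
  have hu' : ∀ n, δ ≤ ‖κ (u n)‖ := fun n => (Set.Infinite.natEmbedding _ hinf n).2
  obtain ⟨K, hK, hKB⟩ := hB.image_closedBall_subset_compact (f := (B : H →ₗ[ℂ] H)) 1
  have hmem : ∀ n, B (e (u n)) ∈ K := fun n => hKB ⟨e (u n), by simp [he.1], rfl⟩
  obtain ⟨x, -, φ, hφ, hlim⟩ := hK.tendsto_subseq hmem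
  have hcau := hlim.cauchySeq
  obtain ⟨N, hN⟩ := Metric.cauchySeq_iff'.1 hcau δ hδ
  have h1 := hN (N + 1) (Nat.le_succ N)
  have hne : u (φ (N + 1)) ≠ u (φ N) := fun h => by
    have := hφ.injective (hu h)
    omega
  simp only [Function.comp_apply, dist_eq_norm, hκ] at h1
  have h2 : ‖κ (u (φ (N + 1)))‖ * 1 ≤ ‖κ (u (φ (N + 1))) • e (u (φ (N + 1))) -
      κ (u (φ N)) • e (u (φ N))‖ := by
    have h3 : inner ℂ (e (u (φ (N + 1)))) (κ (u (φ (N + 1))) • e (u (φ (N + 1))) -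
      κ (u (φ N)) • e (u (φ N))) = κ (u (φ (N + 1))) := by
      rw [inner_sub_right, inner_smul_right, inner_smul_right, he.2 hne,
        inner_self_eq_norm_sq_to_K, he.1]
      simp
    rw [mul_one]
    conv_lhs => rw [← h3]
    refine (norm_inner_le_norm _ _).trans ?_
    rw [he.1, one_mul]
  have := hu' (φ (N + 1))
  linarith

theorem eq_sum_of_total {ι : Type*} {e : ι → H} (he : Orthonormal ℂ e)
    (htot : ∀ x, (∀ i, inner ℂ (e i) x = 0) → x = 0) (s : Finset ι) {x : H}
    (hx : ∀ i, i ∉ s → inner ℂ (e i) x = 0) : x = ∑ i ∈ s, inner ℂ (e i) x • e i := by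
  classical
  rw [← sub_eq_zero]
  apply htot
  intro j
  rw [inner_sub_right]
  by_cases hj : j ∈ s
  · rw [he.inner_right_sum _ hj, sub_self]
  · rw [hx j hj, inner_sum, Finset.sum_eq_zero, sub_zero]
    intro i hi
    rw [inner_smul_right, he.2 (fun h : j = i => hj (h ▸ hi)), mul_zero]

theorem infinite_of_total {ι : Type*} {e : ι → H} (he : Orthonormal ℂ e)
    (htot : ∀ x, (∀ i, inner ℂ (e i) x = 0) → x = 0) (hH : ¬ FiniteDimensional ℂ H) :
    Infinite ι := by
  by_contra hfin
  rw [not_infinite_iff_finite] at hfin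
  have := Fintype.ofFinite ι
  apply hH
  have : (⊤ : Submodule ℂ H) = Submodule.span ℂ (Set.range e) := by
    symm
    rw [eq_top_iff]
    intro x _
    rw [eq_sum_of_total he htot Finset.univ (x := x) (by simp)]
    exact Submodule.sum_mem _ fun i _ => Submodule.smul_mem _ _ (Submodule.subset_span ⟨i, rfl⟩)
  apply Module.Finite.of_fg_top
  rw [this]
  exact Submodule.fg_span (Set.finite_range e)

theorem exists_sorted_eigenbasis {B : H →L[ℂ] H} (hK : IsCompactOperator B)
    (hH : ¬ FiniteDimensional ℂ H) {ι : Type*} {e : ι → H} {β : ι → ℝ} (he : Orthonormal ℂ e)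
    (htot : ∀ x, (∀ i, inner ℂ (e i) x = 0) → x = 0) (hβ : ∀ i, B (e i) = (β i : ℂ) • e i)
    (hpos : ∀ i, 0 < β i) : ∃ σ : ℕ ≃ ι, (Monotone fun n => (β (σ n))⁻¹) ∧
      (∀ δ > 0, {n | δ ≤ β (σ n)}.Finite) := by
  have hfin : ∀ δ > 0, {i | δ ≤ β i}.Finite := fun δ hδ => by
    refine (finite_setOf_le_norm_eigenvalue hK he hβ hδ).subset fun i hi => ?_
    rw [Set.mem_ofPred_eq, Complex.norm_real, Real.norm_of_nonneg (hpos i).le]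
    exact hi
  have := infinite_of_total he htot hH
  obtain ⟨σ, hσ⟩ := exists_equiv_nat_monotone (fun i => (β i)⁻¹) (fun M => by
    -- The maximum with `1` keeps the threshold for `β` positive when `M ≤ 0`.
    refine (hfin (max M 1)⁻¹ (by positivity)).subset fun i hi => ?_
    rw [Set.mem_ofPred_eq] at hi ⊢
    rw [inv_le_comm₀ (by positivity) (hpos i)]
    exact hi.trans (le_max_left _ _))
  exact ⟨σ, hσ, fun δ hδ => Set.Finite.preimage (f := σ) σ.injective.injOn (hfin δ hδ)⟩

variable [CompleteSpace H]

/-- As the essential spectrum is empty, every real `t` must be tested: expansion in the basis shows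
that its eigenspace is spanned by the finitely many `e n` with `(β n)⁻¹ - c = t`. -/
theorem isEigenvalueSequence_invSubOp {B : H →L[ℂ] H} (hB : 0 ≤ B) (hi : Function.Injective B)
    {c : ℝ} (hess : HasPurelyDiscreteSpectrum (invSubOp B c)) {e : ℕ → H} (he : Orthonormal ℂ e)
    (htot : ∀ x, (∀ n, inner ℂ (e n) x = 0) → x = 0) {β : ℕ → ℝ} (hβ : ∀ n, B (e n) = (β n : ℂ) • e n)
    (hpos : ∀ n, 0 < β n) (hanti : Monotone fun n => (β n)⁻¹) (hfin : ∀ δ > 0, {n | δ ≤ β n}.Finite) :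
    IsEigenvalueSequence (invSubOp B c) fun n => (β n)⁻¹ - c := by
  have hess' : essentialSpectrum (invSubOp B c) = ∅ := hess
  refine ⟨fun m n hmn => sub_le_sub_right (hanti hmn) c, by simp [hess'], fun t _ => ?_⟩
  set s : Set ℕ := {n | (β n)⁻¹ - c = t} with hs
  have hsfin : s.Finite := by
    by_cases hne : s.Nonempty
    · obtain ⟨n, hn⟩ := hne
      refine (hfin (β n) (hpos n)).subset fun m hm => ?_
      have h1 : (β m)⁻¹ = (β n)⁻¹ := by
        have h1 : (β m)⁻¹ - c = t := hm
        have h2 : (β n)⁻¹ - c = t := hn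
        linarith
      exact (inv_injective h1).symm.le
    · rw [Set.not_nonempty_iff_eq_empty.1 hne]
      exact Set.finite_empty
  have hmem : ∀ n, n ∈ s ↔ ((c + t : ℝ) : ℂ) * β n = 1 := by
    intro n
    have := (hpos n).ne'
    rw [hs, Set.mem_ofPred_eq]
    norm_cast
    rw [sub_eq_iff_eq_add, inv_eq_iff_eq_inv, eq_comm, ← one_div, add_comm t c]
    constructor
    · intro h
      rw [← h]
      have hne : c + t ≠ 0 := by
        intro h0
        rw [h0] at h
        simp at h
        exact this h.symm
      field_simp
    · intro h
      have hne : c + t ≠ 0 := by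
        intro h0
        simp [h0] at h
      field_simp
      linarith
  have hspan : eigenspaceOp (invSubOp B c) (t : ℂ) = Submodule.span ℂ (e '' s) := by
    ext x
    rw [mem_eigenspaceOp_invSubOp hi]
    constructor
    · intro hx
      rw [eq_sum_of_total he htot hsfin.toFinset (x := x)]
      · refine Submodule.sum_mem _ fun i hi => Submodule.smul_mem _ _ (Submodule.subset_span ⟨i, ?_, rfl⟩)
        simpa using hi
      · intro n hn
        simp only [Set.Finite.mem_toFinset, hmem] at hn
        have h1 : inner ℂ (e n) x = ((c + t : ℝ) : ℂ) * β n * inner ℂ (e n) x := by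
          conv_lhs => rw [← hx]
          rw [inner_smul_right, ← clm_inner_left (IsSelfAdjoint.of_nonneg hB), hβ,
            inner_smul_left, Complex.conj_ofReal]
          push_cast
          ring
        have h2 : (1 - ((c + t : ℝ) : ℂ) * β n) * inner ℂ (e n) x = 0 := by
          linear_combination h1
        rcases mul_eq_zero.1 h2 with h | h
        · exact absurd (sub_eq_zero.1 h).symm hn
        · exact h
    · intro hx
      refine Submodule.span_induction (p := fun x _ => ((c : ℂ) + t) • B x = x) ?_ (by simp) ?_ ?_ hx
      · rintro _ ⟨n, hn, rfl⟩
        rw [hβ, smul_smul]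
        have := (hmem n).1 hn
        push_cast at this
        rw [this, one_smul]
      · intro x y _ _ h1 h2
        rw [map_add, smul_add, h1, h2]
      · intro a x _ h
        rw [map_smul, smul_comm, h]
  rw [hspan, rank_span_set]
  · change s.encard = (e '' s).encard
    rw [he.linearIndependent.injective.encard_image]
  · have := he.linearIndependent.linearIndepOn_id
    exact this.mono (Set.image_subset_range e s)

/-- By the Fredholm alternative, `z` in the spectrum makes `(c + z)⁻¹` a nonzero eigenvalue of `B`.
These eigenvalues have finite multiplicity, and only finitely many `z` lie in any bounded region. -/
theorem hasPurelyDiscreteSpectrum_of_isCompactOperator {B : H →L[ℂ] H} (hB : 0 ≤ B)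
    (hi : Function.Injective B) (hK : IsCompactOperator B) (c : ℝ) :
    HasPurelyDiscreteSpectrum (invSubOp B c) := by
  have hsymm : (B : H →ₗ[ℂ] H).IsSymmetric := fun x y =>
    clm_inner_left (IsSelfAdjoint.of_nonneg hB) x y
  -- points of the spectrum correspond to nonzero eigenvalues of `B`
  have key : ∀ z ∈ spectrumOp (invSubOp B c), (c + z) ≠ 0 ∧
      Module.End.HasEigenvalue (B : Module.End ℂ H) (c + z)⁻¹ := by
    intro z hz
    rw [spectrumOp_invSubOp hi] at hz
    have h0 : (c : ℂ) + z ≠ 0 := by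
      intro h0
      simp [h0] at hz
    refine ⟨h0, ?_⟩
    rw [hK.hasEigenvalue_iff_mem_spectrum (inv_ne_zero h0), spectrum.mem_iff]
    intro hu
    apply hz
    have h1 : (1 - ((c : ℂ) + z) • B) =
        ((c : ℂ) + z) • (algebraMap ℂ (H →L[ℂ] H) ((c : ℂ) + z)⁻¹ - B) := by
      rw [Algebra.algebraMap_eq_smul_one, smul_sub, smul_smul, mul_inv_cancel₀ h0, one_smul]
    rw [h1, Algebra.smul_def]
    exact ((IsUnit.mk0 _ h0).map (algebraMap ℂ (H →L[ℂ] H))).mul hu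
  have hfin : ∀ R > 0, {z ∈ spectrumOp (invSubOp B c) | ‖(c : ℂ) + z‖ ≤ R}.Finite := by
    intro R hR
    have hev : ∀ z : spectrumOp (invSubOp B c), ∃ v : H, ‖v‖ = 1 ∧
        B v = ((c : ℂ) + z)⁻¹ • v := by
      rintro ⟨z, hz⟩
      obtain ⟨v, hv⟩ := (key z hz).2.exists_hasEigenvector
      refine ⟨((‖v‖ : ℂ)⁻¹) • v, ?_, ?_⟩
      · rw [norm_smul, norm_inv, Complex.norm_real, norm_norm,
          inv_mul_cancel₀ (norm_ne_zero_iff.2 hv.2)]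
      · have := hv.apply_eq_smul
        rw [map_smul, smul_comm]
        congr 1
    choose v hv1 hv2 using hev
    have hortho : Orthonormal ℂ v := by
      refine ⟨hv1, fun z z' hzz' => ?_⟩
      have h1 := hsymm (v z) (v z')
      have hne : ((c : ℂ) + z)⁻¹ ≠ ((c : ℂ) + z')⁻¹ := fun h =>
        hzz' (Subtype.ext (add_left_cancel (inv_injective h)))
      have hm1 : v z ∈ Module.End.eigenspace (B : Module.End ℂ H) ((c : ℂ) + z)⁻¹ :=
        Module.End.mem_eigenspace_iff.2 (hv2 z)
      have hm2 : v z' ∈ Module.End.eigenspace (B : Module.End ℂ H) ((c : ℂ) + z')⁻¹ :=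
        Module.End.mem_eigenspace_iff.2 (hv2 z')
      exact hsymm.orthogonalFamily_eigenspaces hne ⟨_, hm1⟩ ⟨_, hm2⟩
    have := finite_setOf_le_norm_eigenvalue hK hortho hv2 (inv_pos.2 hR)
    refine (this.image Subtype.val).subset ?_
    rintro z ⟨hz, hzR⟩
    refine ⟨⟨z, hz⟩, ?_, rfl⟩
    rw [Set.mem_ofPred_eq, norm_inv]
    exact inv_anti₀ (norm_pos_iff.2 (key z hz).1) hzR
  rw [HasPurelyDiscreteSpectrum, essentialSpectrum, Set.sdiff_eq_empty]
  intro z hz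
  have heig : eigenspaceOp (invSubOp B c) z =
      Module.End.eigenspace (B : Module.End ℂ H) (c + z)⁻¹ := by
    ext x
    rw [mem_eigenspaceOp_invSubOp hi, Module.End.mem_eigenspace_iff,
      eq_inv_smul_iff₀ (key z hz).1]
    rfl
  refine ⟨hz, ?_, ?_, ?_⟩
  · have hF := (hfin (‖(c : ℂ) + z‖ + 1) (by positivity)).subset
      (Set.sdiff_subset (t := {z}))
    obtain ⟨r, hr, hball⟩ := Metric.isOpen_iff.1 hF.isClosed.isOpen_compl z (by simp)
    refine ⟨min r 1, by positivity, fun w hw hwz => ?_⟩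
    by_contra hne
    have h1 : w ∈ Metric.ball z r := lt_of_lt_of_le hwz (min_le_left _ _)
    apply hball h1
    refine ⟨⟨hw, ?_⟩, hne⟩
    have h2 : ‖w - z‖ ≤ 1 := by
      rw [← dist_eq_norm]
      exact (hwz.le.trans (min_le_right _ _))
    calc ‖(c : ℂ) + w‖ = ‖((c : ℂ) + z) + (w - z)‖ := by congr 1; ring
      _ ≤ _ := (norm_add_le _ _).trans (by linarith)
  · rw [heig]
    exact (key z hz).2
  · rw [heig]
    exact ContinuousLinearMap.finite_dimensional_eigenspace hK _ (inv_ne_zero (key z hz).1)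

/-- Orthonormal bases of the eigenspaces for nonzero eigenvalues are glued together. The eigenvalues
are real and positive because they equal `⟨e, B e⟩`; injectivity excludes the kernel, so the system
is total. -/
theorem exists_eigenbasis {B : H →L[ℂ] H} (hB : 0 ≤ B) (hi : Function.Injective B)
    (hK : IsCompactOperator B) : ∃ (ι : Type) (e : ι → H) (β : ι → ℝ), Orthonormal ℂ e ∧
      (∀ x, (∀ i, inner ℂ (e i) x = 0) → x = 0) ∧ (∀ i, B (e i) = (β i : ℂ) • e i) ∧
      ∀ i, 0 < β i := by
  have hsymm : (B : H →ₗ[ℂ] H).IsSymmetric := fun x y =>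
    clm_inner_left (IsSelfAdjoint.of_nonneg hB) x y
  have hfd : ∀ w : {w : ℂ // w ≠ 0}, FiniteDimensional ℂ
      (Module.End.eigenspace (B : Module.End ℂ H) w) := fun w =>
    ContinuousLinearMap.finite_dimensional_eigenspace hK _ w.2
  let b := fun w : {w : ℂ // w ≠ 0} =>
    stdOrthonormalBasis ℂ (Module.End.eigenspace (B : Module.End ℂ H) w)
  let ι := Σ w : {w : ℂ // w ≠ 0},
    Fin (Module.finrank ℂ (Module.End.eigenspace (B : Module.End ℂ H) w))
  let e : ι → H := fun i => (b i.1 i.2 : H)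
  have hBe : ∀ i, B (e i) = (i.1 : ℂ) • e i := fun i =>
    Module.End.mem_eigenspace_iff.1 (b i.1 i.2).2
  have hfam : OrthogonalFamily ℂ (fun w : {w : ℂ // w ≠ 0} =>
      (Module.End.eigenspace (B : Module.End ℂ H) (w : ℂ)))
      (fun w => (Module.End.eigenspace (B : Module.End ℂ H) (w : ℂ)).subtypeₗᵢ) :=
    hsymm.orthogonalFamily_eigenspaces.comp Subtype.val_injective
  have he : Orthonormal ℂ e := hfam.orthonormal_sigma_orthonormal (fun w => (b w).orthonormal)
  have hval : ∀ i : ι, (i.1 : ℂ) = inner ℂ (e i) (B (e i)) := fun i => by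
    rw [hBe, inner_smul_right, inner_self_eq_norm_sq_to_K, he.1]
    simp
  have hre : ∀ i : ι, (((i.1 : ℂ).re : ℝ) : ℂ) = i.1 := fun i => by
    rw [← Complex.conj_eq_iff_re]
    conv_lhs => rw [hval i, inner_conj_symm, clm_inner_left (IsSelfAdjoint.of_nonneg hB), ← hval i]
  refine ⟨ι, e, fun i => (i.1 : ℂ).re, he, ?_, fun i => ?_, fun i => ?_⟩
  · intro x hx
    have hmem : x ∈ (⨆ μ, Module.End.eigenspace (B : Module.End ℂ H) μ)ᗮ := by
      rw [Submodule.mem_orthogonal]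
      intro u hu
      refine Submodule.iSup_induction _ (motive := fun u => inner ℂ u x = 0) hu ?_ (by simp) ?_
      · intro μ u hu
        by_cases hμ : μ = 0
        · have : B u = 0 := by
            have := Module.End.mem_eigenspace_iff.1 hu
            simpa [hμ] using this
          rw [hi (this.trans (map_zero B).symm), inner_zero_left]
        · have hsum := (b ⟨μ, hμ⟩).sum_repr ⟨u, hu⟩
          have hsum' := congrArg Subtype.val hsum
          rw [Submodule.coe_sum] at hsum'
          have hsum2 : u = ∑ i, ((b ⟨μ, hμ⟩).repr ⟨u, hu⟩ i) • e ⟨⟨μ, hμ⟩, i⟩ := hsum'.symm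
          rw [hsum2, sum_inner]
          refine Finset.sum_eq_zero fun i _ => ?_
          rw [inner_smul_left, hx, mul_zero]
      · intro u v hu hv
        rw [inner_add_left, hu, hv, add_zero]
    rw [ContinuousLinearMap.orthogonalComplement_iSup_eigenspaces_eq_bot hK hsymm] at hmem
    simpa using hmem
  · rw [hre]
    exact hBe i
  · have h1 : 0 ≤ (i.1 : ℂ).re := by
      rw [hval i]
      exact re_inner_nonneg_of_nonneg hB _
    refine lt_of_le_of_ne h1 fun h => i.1.2 ?_
    rw [← hre i]
    exact_mod_cast h.symm

end Discrete
-- Discrete spectrum forces a compact square root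
section CompactSquareRoot

variable {H : Type*} [NormedAddCommGroup H] [InnerProductSpace ℂ H]

theorem isCompactOperator_of_forall_mem {E : H →L[ℂ] H} {K : Submodule ℂ H} [FiniteDimensional ℂ K]
    (h : ∀ x, E x ∈ K) : IsCompactOperator E := by
  have := LocallyCompactSpace.of_finiteDimensional_of_complete ℂ K
  exact ((isCompactOperator_id (E := K)).comp_clm (E.codRestrict K h)).clm_comp K.subtypeL

variable [CompleteSpace H]

/-- Positive points of the spectrum of `B` are isolated with finite-dimensional eigenspaces. The
spectral projection onto `[δ, ∞)` therefore has finite rank, and cutting off below `δ` changes the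
square root by at most `√δ` in norm. -/
theorem isCompactOperator_sqrt_of_hasPurelyDiscreteSpectrum {B : H →L[ℂ] H} (hB : 0 ≤ B)
    (hi : Function.Injective B) {c : ℝ} (hd : HasPurelyDiscreteSpectrum (invSubOp B c)) :
    IsCompactOperator (cfc Real.sqrt B : H →L[ℂ] H) := by
  have hsa := IsSelfAdjoint.of_nonneg hB
  have hdisc : ∀ w ∈ spectrum ℝ B, 0 < w →
      ((w⁻¹ - c : ℝ) : ℂ) ∈ discreteSpectrum (invSubOp B c) := by
    intro w hw hw0
    have hz : ((w⁻¹ - c : ℝ) : ℂ) ∈ spectrumOp (invSubOp B c) := by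
      rw [spectrumOp_invSubOp hi]
      intro hu
      rw [spectrum.mem_iff] at hw
      apply hw
      have h1 : algebraMap ℝ (H →L[ℂ] H) w - B = algebraMap ℝ (H →L[ℂ] H) w *
          (1 - ((c : ℂ) + ((w⁻¹ - c : ℝ) : ℂ)) • B) := by
        rw [← Algebra.smul_def, ← Complex.ofReal_add, add_sub_cancel, Complex.coe_smul, smul_sub,
          smul_smul, mul_inv_cancel₀ hw0.ne', one_smul, Algebra.algebraMap_eq_smul_one]
      rw [h1]
      exact ((IsUnit.mk0 w hw0.ne').map (algebraMap ℝ (H →L[ℂ] H))).mul hu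
    by_contra hnot
    have : ((w⁻¹ - c : ℝ) : ℂ) ∈ essentialSpectrum (invSubOp B c) := ⟨hz, hnot⟩
    rw [show essentialSpectrum (invSubOp B c) = ∅ from hd] at this
    exact this
  have hfd : ∀ w ∈ spectrum ℝ B, 0 < w →
      FiniteDimensional ℂ (eigenspaceOp (invSubOp B c) ((w⁻¹ - c : ℝ) : ℂ)) :=
    fun w hw hw0 => (hdisc w hw hw0).2.2.2
  have hiso : ∀ w ∈ spectrum ℝ B, 0 < w → ∀ᶠ w' in 𝓝 w, w' ∈ spectrum ℝ B → w' = w := by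
    intro w hw hw0
    obtain ⟨-, ⟨r, hr, hr'⟩, -⟩ := hdisc w hw hw0
    have hcont : ContinuousAt (fun w' : ℝ => ((w'⁻¹ - c : ℝ) : ℂ)) w := by
      refine Complex.continuous_ofReal.continuousAt.comp ?_
      exact (continuousAt_inv₀ hw0.ne').sub continuousAt_const
    filter_upwards [hcont (Metric.ball_mem_nhds _ hr), lt_mem_nhds hw0] with w' h1 h2 hw'
    have h3 := hr' _ (hdisc w' hw' h2).1 h1
    have h4 : w'⁻¹ - c = w⁻¹ - c := by exact_mod_cast h3
    exact inv_injective (by linarith)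
  -- Isolation makes the indicator of a single point continuous on the spectrum, hence admissible in
  -- the continuous functional calculus.
  have hsing : ∀ w ∈ spectrum ℝ B, 0 < w →
      ContinuousOn (fun x : ℝ => if x = w then (1 : ℝ) else 0) (spectrum ℝ B) := by
    intro w hw hw0 x hx
    by_cases hxw : x = w
    · subst hxw
      refine ContinuousWithinAt.congr_of_eventuallyEq (f := fun _ => 1)
        continuousWithinAt_const ?_ (by simp)
      rw [eventuallyEq_nhdsWithin_iff]
      filter_upwards [hiso x hx hw0] with y hy hyσ
      simp [hy hyσ]
    · refine ContinuousWithinAt.congr_of_eventuallyEq (f := fun _ => 0)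
        continuousWithinAt_const ?_ (by simp [hxw])
      refine eventually_nhdsWithin_of_eventually_nhds ?_
      filter_upwards [isOpen_ne.mem_nhds hxw] with y hy
      rw [if_neg hy]
  have hEw : ∀ w ∈ spectrum ℝ B, 0 < w →
      IsCompactOperator (cfc (fun x : ℝ => if x = w then (1 : ℝ) else 0) B : H →L[ℂ] H) := by
    intro w hw hw0
    have := hfd w hw hw0
    refine isCompactOperator_of_forall_mem
      (K := eigenspaceOp (invSubOp B c) ((w⁻¹ - c : ℝ) : ℂ)) fun x => ?_
    rw [mem_eigenspaceOp_invSubOp hi, ← Complex.ofReal_add, add_sub_cancel]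
    have h1 : B * cfc (fun x : ℝ => if x = w then (1 : ℝ) else 0) B =
        w • cfc (fun x : ℝ => if x = w then (1 : ℝ) else 0) B := by
      conv_lhs => enter [1]; rw [← cfc_id_of_nonneg hB]
      rw [← cfc_mul _ _ B (by fun_prop) (hsing w hw hw0), ← cfc_const_mul _ _ _ (hsing w hw hw0)]
      refine cfc_congr fun y _ => ?_
      by_cases hy : y = w <;> simp [hy]
    have h2 := DFunLike.congr_fun h1 x
    simp only [mul_apply_eq_comp] at h2
    rw [h2, Complex.coe_smul, smul_apply, smul_smul, inv_mul_cancel₀ hw0.ne', one_smul]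
  have hcpt : ∀ δ > 0, ∃ F : H →L[ℂ] H, IsCompactOperator F ∧
      ‖(cfc Real.sqrt B : H →L[ℂ] H) - F‖ ≤ Real.sqrt δ := by
    intro δ hδ
    have hcs : IsCompact (spectrum ℝ B ∩ Set.Ici δ) :=
      (spectrum.isCompact B).inter_right isClosed_Ici
    -- A compact set of isolated points is finite: `t` is the whole spectrum in `[δ, ∞)`.
    obtain ⟨t, ht, htc⟩ := hcs.elim_nhds_subcover (fun w => {w' | w' ∈ spectrum ℝ B → w' = w})
      (fun w hw => hiso w hw.1 (lt_of_lt_of_le hδ hw.2))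
    have hmem : ∀ w, w ∈ spectrum ℝ B → (w ∈ t ↔ δ ≤ w) := by
      intro w hw
      refine ⟨fun h => (ht w h).2, fun h => ?_⟩
      have := htc ⟨hw, h⟩
      simp only [Set.mem_iUnion] at this
      obtain ⟨u, hu, huw⟩ := this
      rw [huw hw]
      exact hu
    set P : H →L[ℂ] H := cfc (fun x => ∑ w ∈ t, if x = w then (1 : ℝ) else 0) B with hP
    have hc1 : ∀ w ∈ t, ContinuousOn (fun x : ℝ => if x = w then (1 : ℝ) else 0) (spectrum ℝ B) :=
      fun w hw => hsing w (ht w hw).1 (lt_of_lt_of_le hδ (ht w hw).2)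
    have hc2 : ContinuousOn (fun x : ℝ => ∑ w ∈ t, if x = w then (1 : ℝ) else 0) (spectrum ℝ B) :=
      continuousOn_finsetSum _ hc1
    have hPc : IsCompactOperator P := by
      have h1 : P = ∑ w ∈ t, (cfc (fun x : ℝ => if x = w then (1 : ℝ) else 0) B : H →L[ℂ] H) := by
        rw [hP]
        rw [← cfc_sum _ B t hc1]
        congr 1
        funext x
        simp only [Finset.sum_apply]
      rw [h1]
      exact Submodule.sum_mem (compactOperator (RingHom.id ℂ) H H)
        (f := fun w => (cfc (fun x : ℝ => if x = w then (1 : ℝ) else 0) B : H →L[ℂ] H)) fun w hw =>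
        hEw w (ht w hw).1 (lt_of_lt_of_le hδ (ht w hw).2)
    refine ⟨cfc Real.sqrt B * P, hPc.clm_comp (cfc Real.sqrt B : H →L[ℂ] H), ?_⟩
    rw [hP, ← cfc_mul Real.sqrt _ B (by fun_prop) hc2, ← cfc_sub Real.sqrt
      (fun x => Real.sqrt x * ∑ w ∈ t, if x = w then (1 : ℝ) else 0) B (by fun_prop)
      (ContinuousOn.mul (by fun_prop) hc2)]
    refine norm_cfc_le (Real.sqrt_nonneg _) fun x hx => ?_
    rw [Finset.sum_ite_eq]
    by_cases hxd : δ ≤ x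
    · simp [(hmem x hx).2 hxd]
    · rw [if_neg (fun h => hxd ((hmem x hx).1 h)), mul_zero, sub_zero,
        Real.norm_of_nonneg (Real.sqrt_nonneg _)]
      exact Real.sqrt_le_sqrt (not_le.1 hxd).le
  have hcl : IsClosed {f : H →L[ℂ] H | IsCompactOperator f} := isClosed_setOfPred_isCompactOperator
  have : (cfc Real.sqrt B : H →L[ℂ] H) ∈ closure {f : H →L[ℂ] H | IsCompactOperator f} := by
    rw [Metric.mem_closure_iff]
    intro ε hε
    obtain ⟨F, hF, hF'⟩ := hcpt ((ε / 2) ^ 2) (by positivity)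
    refine ⟨F, hF, ?_⟩
    rw [dist_eq_norm]
    rw [Real.sqrt_sq (by positivity)] at hF'
    linarith
  rwa [hcl.closure_eq] at this

theorem spectrum_le_one {R : H →L[ℂ] H} (hR1 : ‖R‖ ≤ 1) {x : ℝ} (hx : x ∈ spectrum ℝ R) : x ≤ 1 := by
  by_cases hH : Nontrivial (H →L[ℂ] H)
  · have := spectrum.norm_le_norm_of_mem hx
    rw [Real.norm_eq_abs] at this
    exact (le_abs_self x).trans (this.trans hR1)
  · rw [not_nontrivial_iff_subsingleton] at hH
    rw [spectrum.of_subsingleton] at hx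
    exact hx.elim

/-- For `R = (A + 1)⁻¹` this computes `A^(1/2) = (1 - R)^(1/2) R^(-1/2)`; the norm bound gives `1 -
R ≥ 0`, which removes the absolute value. -/
theorem exists_posSqrt_invSubOp_one {R : H →L[ℂ] H} (hR0 : 0 ≤ R) (hR1 : ‖R‖ ≤ 1)
    (hi : Function.Injective R) : ∃ C s : H →L[ℂ] H, IsSelfAdjoint C ∧ IsSelfAdjoint s ∧
      Function.Injective C ∧ C * C = R ∧ s * s = 1 - R ∧
      posSqrt (invSubOp R 1) = quotOp C s := by
  have h1R : cfc (fun x : ℝ => |1 - 1 * x|) R = 1 - ((1 : ℝ) : ℂ) • R := by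
    rw [← cfc_one_sub hR0]
    exact cfc_congr fun x hx => abs_of_nonneg (by linarith [spectrum_le_one hR1 hx])
  refine ⟨cfc Real.sqrt R, cfc (fun x => Real.sqrt |1 - 1 * x|) R, cfc_predicate _ R,
    cfc_predicate _ R, cfc_sqrt_injective hR0 hi, cfc_sqrt_mul_self hR0, ?_, ?_⟩
  · have h1 : cfc (fun x => Real.sqrt |1 - 1 * x|) R * cfc (fun x => Real.sqrt |1 - 1 * x|) R =
        cfc (fun x : ℝ => |1 - 1 * x|) R := by
      rw [← cfc_mul _ _ R]
      exact cfc_congr fun x _ => Real.mul_self_sqrt (abs_nonneg _)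
    rw [h1, h1R, Complex.ofReal_one, one_smul]
  · rw [invSubOp, ← h1R, posSqrt_quotOp_abs hR0 hi]

theorem exists_root_invSubOp {B : H →L[ℂ] H} (hB : 0 ≤ B) (hi : Function.Injective B) (c : ℝ) :
    ∃ S : H →L[ℂ] H, IsSelfAdjoint S ∧ Function.Injective S ∧ S * S = B ∧
      formDomain (invSubOp B c) = LinearMap.range (S : H →ₗ[ℂ] H) ∧
      (HasPurelyDiscreteSpectrum (invSubOp B c) → IsCompactOperator S) :=
  ⟨cfc Real.sqrt B, cfc_predicate _ B, cfc_sqrt_injective hB hi, cfc_sqrt_mul_self hB,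
    formDomain_invSubOp hB hi c, isCompactOperator_sqrt_of_hasPurelyDiscreteSpectrum hB hi⟩

end CompactSquareRoot
-- Sums over oriented edges
section EdgeSums

variable {V : Type*} (G : SimpleGraph V)

open scoped Classical in
/-- The sum of `F` over the oriented edges with both ends in `S`. -/
noncomputable def edgeSum (S : Finset V) (F : V → V → ℝ) : ℝ :=
  ∑ x ∈ S, ∑ y ∈ S, if G.Adj x y then F x y else 0

variable {G}

theorem edgeSum_swap (S : Finset V) (F : V → V → ℝ) :
    edgeSum G S F = edgeSum G S fun x y => F y x := by
  classical
  rw [edgeSum, edgeSum, Finset.sum_comm]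
  refine Finset.sum_congr rfl fun x _ => Finset.sum_congr rfl fun y _ => ?_
  by_cases h : G.Adj x y
  · rw [if_pos h, if_pos h.symm]
  · rw [if_neg h, if_neg fun h' => h h'.symm]

theorem edgeSum_add (S : Finset V) (F F' : V → V → ℝ) :
    edgeSum G S (fun x y => F x y + F' x y) = edgeSum G S F + edgeSum G S F' := by
  simp only [edgeSum, ← Finset.sum_add_distrib]
  refine Finset.sum_congr rfl fun x _ => Finset.sum_congr rfl fun y _ => ?_
  split_ifs <;> simp

theorem edgeSum_mul (S : Finset V) (c : ℝ) (F : V → V → ℝ) :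
    edgeSum G S (fun x y => c * F x y) = c * edgeSum G S F := by
  simp only [edgeSum, Finset.mul_sum]
  refine Finset.sum_congr rfl fun x _ => Finset.sum_congr rfl fun y _ => ?_
  split_ifs <;> simp

theorem edgeSum_mono (S : Finset V) {F F' : V → V → ℝ} (h : ∀ x y, F x y ≤ F' x y) :
    edgeSum G S F ≤ edgeSum G S F' := by
  refine Finset.sum_le_sum fun x _ => Finset.sum_le_sum fun y _ => ?_
  split_ifs
  · exact h x y
  · exact le_rfl

theorem edgeSum_nonneg (S : Finset V) {F : V → V → ℝ} (h : ∀ x y, 0 ≤ F x y) :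
    0 ≤ edgeSum G S F := by
  refine Finset.sum_nonneg fun x _ => Finset.sum_nonneg fun y _ => ?_
  split_ifs
  · exact h x y
  · exact le_rfl

variable (G) [G.LocallyFinite]

open scoped Classical in
/-- The union of `T` with the neighbours of its elements. -/
noncomputable def closedNeighbors (T : Finset V) : Finset V :=
  T ∪ T.biUnion fun x => G.neighborFinset x

variable {G}

theorem subset_closedNeighbors (T : Finset V) : T ⊆ closedNeighbors G T := by
  classical
  intro x hx
  simp [closedNeighbors, hx]

theorem mem_closedNeighbors_of_adj {T : Finset V} {x y : V} (hx : x ∈ T) (h : G.Adj x y) :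
    y ∈ closedNeighbors G T := by
  classical
  simp only [closedNeighbors, Finset.mem_union, Finset.mem_biUnion, SimpleGraph.mem_neighborFinset]
  exact Or.inr ⟨x, hx, h⟩

/-- The closed neighbourhood contains both ends of every edge meeting `T`. This gives a finite sum
that is symmetric in the two ends, so orientations can be exchanged. -/
theorem sum_neighborFinset_eq_edgeSum (T : Finset V) {F : V → V → ℝ}
    (hF : ∀ x y, x ∉ T → F x y = 0) :
    ∑ x ∈ T, ∑ y ∈ G.neighborFinset x, F x y = edgeSum G (closedNeighbors G T) F := by
  classical
  rw [edgeSum, ← Finset.sum_subset (subset_closedNeighbors (G := G) T)]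
  · refine Finset.sum_congr rfl fun x hx => ?_
    rw [← Finset.sum_filter]
    refine Finset.sum_congr ?_ fun _ _ => rfl
    ext y
    simp only [SimpleGraph.mem_neighborFinset, Finset.mem_filter]
    exact ⟨fun h => ⟨mem_closedNeighbors_of_adj hx h, h⟩, fun h => h.2⟩
  · intro x _ hx
    refine Finset.sum_eq_zero fun y _ => ?_
    simp [hF x y hx]

theorem sum_degree_eq_edgeSum (T : Finset V) {u : V → ℝ} (hu : ∀ x, x ∉ T → u x = 0) :
    ∑ x ∈ T, (G.degree x : ℝ) * u x = edgeSum G (closedNeighbors G T) fun x _ => u x := by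
  rw [← sum_neighborFinset_eq_edgeSum T fun x _ hx => hu x hx]
  refine Finset.sum_congr rfl fun x _ => ?_
  rw [Finset.sum_const, SimpleGraph.card_neighborFinset_eq_degree, nsmul_eq_mul]

open scoped Classical in
theorem ncard_adj_eq_edgeSum (W : Finset V) {S : Finset V} (hS : closedNeighbors G W ⊆ S)
    (p : V → Prop) :
    (({e : V × V | e.1 ∈ W ∧ p e.2 ∧ G.Adj e.1 e.2}.ncard : ℕ) : ℝ) =
      edgeSum G S fun x y => if x ∈ W ∧ p y then 1 else 0 := by
  have h : {e : V × V | e.1 ∈ W ∧ p e.2 ∧ G.Adj e.1 e.2} =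
      ((S ×ˢ S).filter fun e : V × V => e.1 ∈ W ∧ p e.2 ∧ G.Adj e.1 e.2 : Finset (V × V)) := by
    ext ⟨x, y⟩
    simp only [Set.mem_ofPred_eq, Finset.coe_filter, Finset.mem_product]
    exact ⟨fun h => ⟨⟨hS (subset_closedNeighbors W h.1),
      hS (mem_closedNeighbors_of_adj h.1 h.2.2)⟩, h⟩, fun h => h.2⟩
  rw [h, Set.ncard_coe_finset, Finset.card_filter, Finset.sum_product, edgeSum]
  push_cast
  refine Finset.sum_congr rfl fun x _ => Finset.sum_congr rfl fun y _ => ?_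
  by_cases h1 : x ∈ W <;> by_cases h2 : p y <;> by_cases h3 : G.Adj x y <;> simp [h1, h2, h3]

end EdgeSums

/-! ### Quadratic forms on finitely supported functions -/

section Forms

variable {V : Type*} {G : SimpleGraph V} [G.LocallyFinite]

theorem normSqFin_nonneg (f : V →₀ ℂ) : 0 ≤ normSqFin f :=
  Finset.sum_nonneg fun _ _ => by positivity

theorem quadForm_mulMap (g : V → ℝ) (f : V →₀ ℂ) :
    quadForm (mulMap g) f = ∑ x ∈ f.support, g x * ‖f x‖ ^ 2 := by
  rw [quadForm, Complex.re_sum]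
  refine Finset.sum_congr rfl fun x _ => ?_
  change (conj (f x) * ((g x : ℂ) * f x)).re = _
  rw [mul_left_comm, Complex.conj_mul']
  norm_cast

/-- The energy `½ ∑_{x ∼ y} |f(x) - f(y)|²`. -/
noncomputable def energy (G : SimpleGraph V) [G.LocallyFinite] (f : V →₀ ℂ) : ℝ :=
  edgeSum G (closedNeighbors G f.support) (fun x y => ‖f x - f y‖ ^ 2) / 2

/-- The form `∑ deg(x) |f(x)|²`. -/
noncomputable def degForm (G : SimpleGraph V) [G.LocallyFinite] (f : V →₀ ℂ) : ℝ :=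
  edgeSum G (closedNeighbors G f.support) fun x _ => ‖f x‖ ^ 2

theorem energy_nonneg (f : V →₀ ℂ) : 0 ≤ energy G f :=
  div_nonneg (edgeSum_nonneg _ fun _ _ => by positivity) two_pos.le

theorem degForm_nonneg (f : V →₀ ℂ) : 0 ≤ degForm G f :=
  edgeSum_nonneg _ fun _ _ => by positivity

theorem quadForm_schrodingerMap (q : V → ℝ) (f : V →₀ ℂ) :
    quadForm (schrodingerMap G q) f = energy G f + quadForm (mulMap q) f := by
  have h1 : quadForm (schrodingerMap G q) f =
      ∑ x ∈ f.support, ∑ y ∈ G.neighborFinset x, (conj (f x) * (f x - f y)).re +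
        quadForm (mulMap q) f := by
    rw [quadForm, quadForm, Complex.re_sum, Complex.re_sum, ← Finset.sum_add_distrib]
    refine Finset.sum_congr rfl fun x _ => ?_
    change (conj (f x) * (∑ y ∈ G.neighborFinset x, (f x - f y) + (q x : ℂ) * f x)).re = _
    rw [mul_add, Complex.add_re, Finset.mul_sum, Complex.re_sum]
    rfl
  rw [h1, add_left_inj, sum_neighborFinset_eq_edgeSum, energy]
  · set S := closedNeighbors G f.support
    -- Averaging over the two orientations of each edge turns the pairing into `|f(x) - f(y)|²`.
    have h2 := edgeSum_swap (G := G) S fun x y => (conj (f x) * (f x - f y)).re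
    have h3 := edgeSum_add (G := G) S (fun x y => (conj (f x) * (f x - f y)).re)
      fun x y => (conj (f y) * (f y - f x)).re
    have h4 : (fun x y => (conj (f x) * (f x - f y)).re + (conj (f y) * (f y - f x)).re) =
        fun x y => ‖f x - f y‖ ^ 2 := by
      funext x y
      rw [← Complex.normSq_eq_norm_sq, Complex.normSq_apply]
      simp only [Complex.mul_re, Complex.conj_re, Complex.conj_im, Complex.sub_re, Complex.sub_im]
      ring
    rw [h4, ← h2] at h3
    rw [h3]
    ring
  · intro x y hx
    simp [Finsupp.notMem_support_iff.1 hx]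

theorem quadForm_degAdd (q : V → ℝ) (f : V →₀ ℂ) :
    quadForm (mulMap (degAdd G q)) f = degForm G f + quadForm (mulMap q) f := by
  rw [quadForm_mulMap, quadForm_mulMap, degForm,
    ← sum_degree_eq_edgeSum (u := fun x => ‖f x‖ ^ 2), ← Finset.sum_add_distrib]
  · refine Finset.sum_congr rfl fun x _ => ?_
    rw [degAdd]
    ring
  · intro x hx
    simp [Finsupp.notMem_support_iff.1 hx]

theorem quadForm_eq_posPot_sub (q : V → ℝ) (f : V →₀ ℂ) :
    quadForm (mulMap q) f = quadForm (mulMap (posPot q)) f - quadForm (mulMap (negPot q)) f := by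
  simp only [quadForm_mulMap, ← Finset.sum_sub_distrib]
  refine Finset.sum_congr rfl fun x _ => ?_
  rw [← sub_mul]
  congr 1
  rw [posPot, negPot]
  rcases le_total 0 (q x) with h | h
  · rw [max_eq_left h, max_eq_right (by linarith)]
    ring
  · rw [max_eq_right h, max_eq_left (by linarith)]
    ring

theorem quadForm_mulMap_nonneg {g : V → ℝ} (hg : ∀ x, 0 ≤ g x) (f : V →₀ ℂ) :
    0 ≤ quadForm (mulMap g) f := by
  rw [quadForm_mulMap]
  exact Finset.sum_nonneg fun x _ => mul_nonneg (hg x) (by positivity)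

theorem posPot_nonneg (q : V → ℝ) (x : V) : 0 ≤ posPot q x := le_max_right _ _

theorem negPot_nonneg (q : V → ℝ) (x : V) : 0 ≤ negPot q x := le_max_right _ _

/-- The energy `½ ∑_{x ∼ y} |f(x) + f(y)|²` complements `energy` to twice the degree form. -/
theorem edgeSum_norm_add_sq (f : V →₀ ℂ) :
    edgeSum G (closedNeighbors G f.support) (fun x y => ‖f x + f y‖ ^ 2) / 2 =
      2 * degForm G f - energy G f := by
  set S := closedNeighbors G f.support with hS
  have h1 := edgeSum_add (G := G) S (fun x y => ‖f x + f y‖ ^ 2) fun x y => ‖f x - f y‖ ^ 2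
  have h2 : (fun x y => ‖f x + f y‖ ^ 2 + ‖f x - f y‖ ^ 2) =
      fun x y => 2 * ‖f x‖ ^ 2 + 2 * ‖f y‖ ^ 2 := by
    funext x y
    have := parallelogram_law_with_norm ℝ (f x) (f y)
    linarith
  have h3 := edgeSum_swap (G := G) S fun _ y => 2 * ‖f y‖ ^ 2
  rw [h2, edgeSum_add, h3, edgeSum_mul] at h1
  rw [degForm, energy, ← hS]
  linarith

theorem energy_le (f : V →₀ ℂ) : energy G f ≤ 2 * degForm G f := by
  have := edgeSum_norm_add_sq (G := G) f
  have h : 0 ≤ edgeSum G (closedNeighbors G f.support) (fun x y => ‖f x + f y‖ ^ 2) / 2 :=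
    div_nonneg (edgeSum_nonneg _ fun _ _ => by positivity) two_pos.le
  linarith

/-- The form inequality `∑ min(u(x), u(y)) ≤ k ∑ u + a (∑ (u(x) - u(y))₊ + ∑ q₊ u)` for non-negative
functions, which reduces to indicator functions of level sets. -/
theorem IsSparse.edgeSum_min_le {q : V → ℝ} {a k : ℝ} (h : IsSparse G q a k) (T : Finset V) :
    ∀ (n : ℕ) (u : V → ℝ), (∀ x, 0 ≤ u x) → (∀ x, x ∉ T → u x = 0) →
      (T.filter fun x => 0 < u x).card = n →
      edgeSum G (closedNeighbors G T) (fun x y => min (u x) (u y)) ≤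
        k * ∑ x ∈ T, u x + a * (edgeSum G (closedNeighbors G T) (fun x y => max (u x - u y) 0) +
          ∑ x ∈ T, posPot q x * u x) := by
  classical
  intro n
  induction n using Nat.strong_induction_on with
  | _ n ih =>
    intro u hu0 huT hn
    set S := closedNeighbors G T with hS
    set W := T.filter fun x => 0 < u x with hW
    have hWm : ∀ x, x ∈ W ↔ 0 < u x := fun x => by
      rw [hW, Finset.mem_filter]
      refine ⟨fun h => h.2, fun h => ⟨?_, h⟩⟩
      by_contra hx
      rw [huT x hx] at h
      exact lt_irrefl _ h
    have hW0 : ∀ x, x ∉ W → u x = 0 := fun x hx => by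
      rw [hWm, not_lt] at hx
      exact le_antisymm hx (hu0 x)
    by_cases hne : W.Nonempty
    · obtain ⟨x₀, hx₀, hmin⟩ := Finset.exists_min_image W u hne
      -- One layer is removed: `u = t 1_W + u'`, with `t` the least positive value of `u`. The point
      -- `x₀` leaves the positive set, which drives the induction.
      set t := u x₀ with ht
      have ht0 : 0 < t := (hWm _).1 hx₀
      let u' : V → ℝ := fun x => if x ∈ W then u x - t else 0
      have hu' : ∀ x, 0 ≤ u' x := fun x => by
        by_cases hx : x ∈ W
        · simpa [u', hx] using hmin x hx
        · simp [u', hx]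
      have hWT : W ⊆ T := Finset.filter_subset _ _
      have hu'T : ∀ x, x ∉ T → u' x = 0 := fun x hx => by
        have : x ∉ W := fun h => hx (hWT h)
        simp [u', this]
      have hcard : (T.filter fun x => 0 < u' x).card < n := by
        rw [← hn]
        apply Finset.card_lt_card
        rw [Finset.ssubset_iff_of_subset]
        · exact ⟨x₀, hx₀, by simp [u', hx₀, ht]⟩
        · intro x hx
          rw [Finset.mem_filter] at hx
          by_contra hxW
          simp [u', hxW] at hx
      have hrec := ih _ hcard u' hu' hu'T rfl
      have hsub : closedNeighbors G W ⊆ S := by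
        rw [hS, closedNeighbors, closedNeighbors]
        exact Finset.union_subset_union hWT (Finset.biUnion_subset_biUnion_of_subset_left _ hWT)
      have hWsp' := h W
      rw [edgeCount, boundaryCount, mul_div_cancel₀ _ (two_ne_zero' ℝ),
        ncard_adj_eq_edgeSum W hsub (fun y => y ∈ W),
        ncard_adj_eq_edgeSum W hsub (fun y => y ∉ W)] at hWsp'
      have hWsp : edgeSum G S (fun x y => if x ∈ W ∧ y ∈ W then (1 : ℝ) else 0) ≤
          k * W.card + a * (edgeSum G S (fun x y => if x ∈ W ∧ y ∉ W then (1 : ℝ) else 0) +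
            ∑ x ∈ W, posPot q x) := by
        convert hWsp'
      -- Edge terms split along the layer because `u` vanishes off `W` and is at least `t` on it;
      -- sparseness is then used for `W` alone, multiplied by `t`.
      have e1 : edgeSum G S (fun x y => min (u x) (u y)) =
          t * edgeSum G S (fun x y => if x ∈ W ∧ y ∈ W then 1 else 0) +
            edgeSum G S (fun x y => min (u' x) (u' y)) := by
        rw [← edgeSum_mul, ← edgeSum_add]
        congr 1
        funext x y
        by_cases hx : x ∈ W <;> by_cases hy : y ∈ W
        · simp [u', hx, hy, min_sub_sub_right]
        · simp [u', hx, hy, hW0 y hy, hu0 x, hmin x hx]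
        · simp [u', hx, hy, hW0 x hx, hu0 y, hmin y hy]
        · simp [u', hx, hy, hW0 x hx, hW0 y hy]
      have e2 : edgeSum G S (fun x y => max (u x - u y) 0) =
          t * edgeSum G S (fun x y => if x ∈ W ∧ y ∉ W then 1 else 0) +
            edgeSum G S (fun x y => max (u' x - u' y) 0) := by
        rw [← edgeSum_mul, ← edgeSum_add]
        congr 1
        funext x y
        by_cases hx : x ∈ W <;> by_cases hy : y ∈ W
        · simp [u', hx, hy]
        · simp [u', hx, hy, hW0 y hy, hu0 x, hmin x hx]
        · simp [u', hx, hy, hW0 x hx, hu0 y, hmin y hy]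
        · simp [u', hx, hy, hW0 x hx, hW0 y hy]
      have e0 : ∀ x, u x = t * (if x ∈ W then 1 else 0) + u' x := fun x => by
        by_cases hx : x ∈ W
        · simp [u', hx]
        · simp [u', hx, hW0 x hx]
      have e3 : ∑ x ∈ T, u x = t * W.card + ∑ x ∈ T, u' x := by
        rw [Finset.sum_congr rfl fun x _ => e0 x, Finset.sum_add_distrib, ← Finset.mul_sum,
          ← Finset.sum_filter, Finset.filter_mem_eq_inter, Finset.inter_eq_right.2 hWT]
        simp
      have e4 : ∑ x ∈ T, posPot q x * u x =
          t * ∑ x ∈ W, posPot q x + ∑ x ∈ T, posPot q x * u' x := by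
        rw [Finset.sum_congr rfl fun x _ => congrArg (posPot q x * ·) (e0 x)]
        simp only [mul_add]
        rw [Finset.sum_add_distrib]
        congr 1
        rw [← Finset.inter_eq_right.2 hWT, ← Finset.filter_mem_eq_inter, Finset.sum_filter,
          Finset.mul_sum]
        refine Finset.sum_congr rfl fun x hx => ?_
        by_cases hxW : x ∈ W
        · simp [hxW, hx, mul_comm]
        · simp [hxW]
      rw [e1, e2, e3, e4]
      have := mul_le_mul_of_nonneg_left hWsp ht0.le
      linarith
    · have hu : ∀ x, u x = 0 := fun x => hW0 x (by
        rw [Finset.not_nonempty_iff_eq_empty.1 hne]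
        simp)
      simp [hu, edgeSum]

end Forms
-- Equivalence of sparseness and form bounds
section Equivalences

variable {V : Type*} {G : SimpleGraph V} [G.LocallyFinite]

/-- The level-set inequality for `|f|²`, combined with `2θAB ≤ θ²A² + B²` for `A = |f(x) - f(y)|`,
`B = |f(x) + f(y)|`. The free weight `θ` favours one of the two complementary energies. -/
theorem IsSparse.form_le {q : V → ℝ} {a k : ℝ} (ha : 0 ≤ a) (h : IsSparse G q a k) {θ : ℝ}
    (hθ : 0 < θ) (f : V →₀ ℂ) :
    2 * θ * (degForm G f + quadForm (mulMap (posPot q)) f) - 2 * θ * k * normSqFin f ≤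
      (1 + a) * (θ ^ 2 * (energy G f + quadForm (mulMap (posPot q)) f) +
        (2 * degForm G f - energy G f + quadForm (mulMap (posPot q)) f)) := by
  have h1 := h.edgeSum_min_le f.support _ (fun x => ‖f x‖ ^ 2) (fun x => by positivity)
    (fun x hx => by simp [Finsupp.notMem_support_iff.1 hx]) rfl
  set S := closedNeighbors G f.support with hS
  rw [quadForm_mulMap, ← edgeSum_norm_add_sq, ← hS, energy, ← hS]
  set Q := ∑ x ∈ f.support, posPot q x * ‖f x‖ ^ 2 with hQ
  have hQ0 : 0 ≤ Q := Finset.sum_nonneg fun x _ => mul_nonneg (posPot_nonneg q x) (by positivity)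
  set P := edgeSum G S (fun x y => max (‖f x‖ ^ 2 - ‖f y‖ ^ 2) 0) with hP
  have e1 : edgeSum G S (fun x y => min (‖f x‖ ^ 2) (‖f y‖ ^ 2)) + P = degForm G f := by
    rw [hP, ← edgeSum_add, degForm]
    congr 1
    funext x y
    rcases le_total (‖f x‖ ^ 2) (‖f y‖ ^ 2) with h | h
    · rw [min_eq_left h, max_eq_right (by linarith), add_zero]
    · rw [min_eq_right h, max_eq_left (by linarith)]
      ring
  have e2 : 2 * P = edgeSum G S (fun x y => |‖f x‖ ^ 2 - ‖f y‖ ^ 2|) := by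
    have h2 := edgeSum_swap (G := G) S fun x y => max (‖f x‖ ^ 2 - ‖f y‖ ^ 2) 0
    have h3 := edgeSum_add (G := G) S (fun x y => max (‖f x‖ ^ 2 - ‖f y‖ ^ 2) 0)
      fun x y => max (‖f y‖ ^ 2 - ‖f x‖ ^ 2) 0
    rw [← h2, ← hP] at h3
    rw [two_mul, ← h3]
    congr 1
    funext x y
    rcases le_total (‖f x‖ ^ 2) (‖f y‖ ^ 2) with h | h
    · rw [max_eq_right (by linarith), max_eq_left (by linarith), abs_of_nonpos (by linarith)]
      ring
    · rw [max_eq_left (by linarith), max_eq_right (by linarith), abs_of_nonneg (by linarith)]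
      ring
  have e3 : 2 * θ * (2 * P) ≤ θ ^ 2 * edgeSum G S (fun x y => ‖f x - f y‖ ^ 2) +
      edgeSum G S (fun x y => ‖f x + f y‖ ^ 2) := by
    rw [e2, ← edgeSum_mul, ← edgeSum_mul, ← edgeSum_add]
    refine edgeSum_mono S fun x y => ?_
    have h4 : |‖f x‖ ^ 2 - ‖f y‖ ^ 2| ≤ ‖f x - f y‖ * ‖f x + f y‖ := by
      have h5 : ‖f x‖ ^ 2 - ‖f y‖ ^ 2 = ((f x - f y) * conj (f x + f y)).re := by
        rw [← Complex.normSq_eq_norm_sq, ← Complex.normSq_eq_norm_sq, Complex.normSq_apply,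
          Complex.normSq_apply]
        simp only [Complex.mul_re, Complex.conj_re, Complex.conj_im, Complex.sub_re,
          Complex.sub_im, Complex.add_re, Complex.add_im]
        ring
      rw [h5]
      refine (Complex.abs_re_le_norm _).trans ?_
      rw [norm_mul, Complex.norm_conj]
    nlinarith [sq_nonneg (θ * ‖f x - f y‖ - ‖f x + f y‖)]
  have e4 : normSqFin f = ∑ x ∈ f.support, ‖f x‖ ^ 2 := rfl
  rw [← e4] at h1
  have e5 : degForm G f + Q - k * normSqFin f ≤ (1 + a) * (P + Q) := by linarith
  -- The potential is handled by `2θ ≤ θ² + 1`, the edge part by half of `e3`.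
  have e6 : 2 * θ * (P + Q) ≤ θ ^ 2 * (edgeSum G S (fun x y => ‖f x - f y‖ ^ 2) / 2 + Q) +
      (edgeSum G S (fun x y => ‖f x + f y‖ ^ 2) / 2 + Q) := by
    nlinarith [mul_nonneg (sq_nonneg (θ - 1)) hQ0]
  have e7 := mul_le_mul_of_nonneg_left e5 (show 0 ≤ 2 * θ by positivity)
  have e8 := mul_le_mul_of_nonneg_left e6 (show 0 ≤ 1 + a by positivity)
  linarith

theorem AlmostSparse.posPot_lower (q : V → ℝ) (h : AlmostSparse G q) {ε : ℝ} (h0 : 0 < ε)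
    (h1 : ε ≤ 1) : ∃ k : ℝ, 0 ≤ k ∧ ∀ f : V →₀ ℂ,
      (1 - ε) * (degForm G f + quadForm (mulMap (posPot q)) f) - k * normSqFin f ≤
        energy G f + quadForm (mulMap (posPot q)) f := by
  set δ := ε / 8 with hδ
  have hδ0 : 0 < δ := by positivity
  -- With weight `1 + δ` the leading terms in D cancel and leave `2δ(1 - δ) D` against `δ(1 + δ²)(2
  -- + δ) E`. The sparseness error must be of order `δ²` to survive the division by `δ`; then `ε =
  -- 8δ` leaves room for the constants.
  obtain ⟨k, hk, hsp⟩ := h (δ ^ 2) (by positivity)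
  refine ⟨4 * k / δ, by positivity, fun f => ?_⟩
  have key := hsp.form_le (by positivity) (show 0 < 1 + δ by positivity) f
  set D := degForm G f + quadForm (mulMap (posPot q)) f with hD
  set E := energy G f + quadForm (mulMap (posPot q)) f with hE
  have hD0 : 0 ≤ D := add_nonneg (degForm_nonneg f) (quadForm_mulMap_nonneg (posPot_nonneg q) f)
  have hE0 : 0 ≤ E := add_nonneg (energy_nonneg f) (quadForm_mulMap_nonneg (posPot_nonneg q) f)
  have hN := normSqFin_nonneg f
  have e1 : 2 * degForm G f - energy G f + quadForm (mulMap (posPot q)) f = 2 * D - E := by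
    rw [hD, hE]
    ring
  rw [e1] at key
  have hδ1 : δ ≤ 1 / 8 := by linarith
  have e2 : δ * (2 * (1 - δ) * D) ≤
      δ * ((1 + δ ^ 2) * (2 + δ) * E + 2 * (1 + δ) * (k / δ) * normSqFin f) := by
    have : δ * (2 * (1 + δ) * (k / δ) * normSqFin f) = 2 * (1 + δ) * k * normSqFin f := by
      field_simp
    rw [mul_add δ ((1 + δ ^ 2) * (2 + δ) * E), this]
    nlinarith
  have e3 := le_of_mul_le_mul_left e2 hδ0
  set N' := (k / δ) * normSqFin f with hN'
  have hN'0 : 0 ≤ N' := by positivity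
  have e4 : 2 * (1 + δ) * (k / δ) * normSqFin f = 2 * (1 + δ) * N' := by
    rw [hN']
    ring
  rw [e4] at e3
  have e5 : 4 * k / δ * normSqFin f = 4 * N' := by
    rw [hN']
    ring
  rw [e5]
  have hε : ε = 8 * δ := by
    rw [hδ]
    ring
  rw [hε]
  -- compare the constants
  set c := (1 + δ ^ 2) * (2 + δ) with hc
  have hc2 : 2 ≤ c := by nlinarith [pow_pos hδ0 2, pow_pos hδ0 3]
  have hc3 : (1 - 8 * δ) * c ≤ 2 * (1 - δ) := by
    have : c ≤ 2 + 4 * δ := by nlinarith [pow_pos hδ0 2, pow_pos hδ0 3]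
    nlinarith [pow_pos hδ0 2]
  have e6 : c * ((1 - 8 * δ) * D) ≤ c * (E + 4 * N') := by
    have := mul_le_mul_of_nonneg_right hc3 hD0
    nlinarith
  have := le_of_mul_le_mul_left e6 (by linarith)
  linarith

/-- Since the energy is at most twice the degree form, the bound with `α = 1/2` gives `q₋ ≤ deg + q₊
/ 2 + C`. -/
theorem InK.degAdd_form_ge {q : V → ℝ} {C : ℝ}
    (hC : ∀ f : V →₀ ℂ, quadForm (mulMap (negPot q)) f ≤
      1 / 2 * quadForm (schrodingerMap G (posPot q)) f + C * normSqFin f) (f : V →₀ ℂ) :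
    0 ≤ quadForm (mulMap (degAdd G q)) f + C * normSqFin f := by
  have h1 := hC f
  rw [quadForm_schrodingerMap] at h1
  rw [quadForm_degAdd, quadForm_eq_posPot_sub]
  have := energy_le (G := G) f
  have := quadForm_mulMap_nonneg (posPot_nonneg q) f
  linarith

theorem AlmostSparse.lowerBound {q : V → ℝ} (hq : InKZeroPlus G q) (h : AlmostSparse G q) {ε : ℝ}
    (hε : 0 < ε) : ∃ k : ℝ, 0 ≤ k ∧ LowerBound G q ε k := by
  obtain ⟨C, hC0, hC⟩ := hq (1 / 2) (by norm_num)
  set ε₁ := min ε 1 with hε₁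
  have h1 : 0 < ε₁ := by positivity
  have h1' : ε₁ ≤ 1 := min_le_right _ _
  obtain ⟨k, hk, hlow⟩ := h.posPot_lower q (ε := ε₁ / 2) (by positivity) (by linarith)
  refine ⟨k + 2 * C + |1 - ε| * C, by positivity, fun f => ?_⟩
  have hD := InK.degAdd_form_ge hC f
  have hl := hlow f
  have hCf := hC f
  have hN := normSqFin_nonneg f
  have hQm := quadForm_mulMap_nonneg (negPot_nonneg q) f
  have hEq := quadForm_schrodingerMap (G := G) q f
  have hDq := quadForm_degAdd (G := G) q f
  rw [quadForm_schrodingerMap] at hCf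
  rw [quadForm_eq_posPot_sub q] at hEq hDq
  set D := quadForm (mulMap (degAdd G q)) f
  set E := quadForm (schrodingerMap G q) f
  set Qm := quadForm (mulMap (negPot q)) f
  set N := normSqFin f
  have e1 : degForm G f + quadForm (mulMap (posPot q)) f = D + Qm := by linarith
  have e2 : energy G f + quadForm (mulMap (posPot q)) f = E + Qm := by linarith
  rw [e1, e2] at hl
  rw [e2] at hCf
  -- Rearranged form-smallness. As `Qm` enters with the factor `ε₁ / 2`, a fixed relative bound
  -- suffices here; it moves `ε₁ / 2` times `E` to the right-hand side.
  have hQE : Qm ≤ E + 2 * C * N := by linarith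
  have hCN : 0 ≤ C * N := by positivity
  have e3 : (1 - ε₁ / 2) * D - k * N - ε₁ / 2 * (E + 2 * C * N) ≤ E := by nlinarith
  have e4 : (1 + ε₁ / 2) * ((1 - ε₁) * (D + C * N)) ≤
      (1 + ε₁ / 2) * (E + (k + 2 * C) * N) := by
    have e5 : (1 + ε₁ / 2) * (1 - ε₁) ≤ 1 - ε₁ / 2 := by nlinarith
    have e6 := mul_le_mul_of_nonneg_right e5 hD
    have hkN : 0 ≤ k * N := by positivity
    nlinarith
  have e7 := le_of_mul_le_mul_left e4 (by positivity)
  -- Passing from `ε₁ = min ε 1` back to `ε` needs a non-negative form, hence the shift by `C`; the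
  -- term `|1 - ε| * C` in the constant then pays for removing it.
  have e8 : (1 - ε) * (D + C * N) ≤ (1 - ε₁) * (D + C * N) :=
    mul_le_mul_of_nonneg_right (by linarith [min_le_left ε 1]) hD
  have e9 : -(1 - ε) * (C * N) ≤ |1 - ε| * (C * N) :=
    mul_le_mul_of_nonneg_right (neg_le_abs _) hCN
  linarith

/-- The pointwise absolute value of a finitely supported function. -/
noncomputable def absFin (f : V →₀ ℂ) : V →₀ ℂ := f.mapRange (fun z => (‖z‖ : ℂ)) (by simp)

theorem absFin_apply (f : V →₀ ℂ) (x : V) : absFin f x = (‖f x‖ : ℂ) := by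
  simp [absFin]

theorem support_absFin (f : V →₀ ℂ) : (absFin f).support = f.support := by
  ext x
  simp [absFin_apply]

/-- Replacing `f` by `|f|` preserves the degree and potential forms, while `||f(x)| - |f(y)|| ≤
|f(x) + f(y)|` bounds the energy by `2D - E`. The lower bound for `|f|` therefore bounds E from
above with the same constants. -/
theorem LowerBound.upperBound {q : V → ℝ} {ε k : ℝ} (h : LowerBound G q ε k) :
    UpperBound G q ε k := by
  intro f
  have h1 := h (absFin f)
  have eq : ∀ g : V → ℝ, quadForm (mulMap g) (absFin f) = quadForm (mulMap g) f := fun g => by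
    rw [quadForm_mulMap, quadForm_mulMap, support_absFin]
    simp [absFin_apply]
  have eN : normSqFin (absFin f) = normSqFin f := by
    rw [normSqFin, normSqFin, support_absFin]
    simp [absFin_apply]
  have hE : energy G (absFin f) ≤ 2 * degForm G f - energy G f := by
    rw [← edgeSum_norm_add_sq, energy, support_absFin]
    refine div_le_div_of_nonneg_right (edgeSum_mono _ fun x y => ?_) two_pos.le
    rw [absFin_apply, absFin_apply, ← Complex.ofReal_sub, Complex.norm_real, Real.norm_eq_abs,
      sq_abs]
    have h2 := abs_norm_sub_norm_le (f x) (-f y)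
    rw [norm_neg, sub_neg_eq_add] at h2
    rw [← sq_abs]
    exact pow_le_pow_left₀ (abs_nonneg _) h2 2
  rw [eN, eq, quadForm_schrodingerMap, eq] at h1
  rw [quadForm_schrodingerMap]
  have e1 := quadForm_degAdd (G := G) q f
  linarith

theorem almostSparse_of_lowerBound {q : V → ℝ}
    (h : ∀ ε : ℝ, 0 < ε → ∃ k : ℝ, 0 ≤ k ∧ LowerBound G q ε k) : AlmostSparse G q := by
  classical
  intro ε hε
  -- This choice makes `1 - ε / (1 + ε)` the inverse of `1 + ε`. On the indicator of `W` the energy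
  -- is `|∂W|` and the degree form `2|E_W| + |∂W|`; after multiplication by `1 + ε` the negative
  -- part of `q` has a favourable sign.
  obtain ⟨k, hk, hlow⟩ := h (ε / (1 + ε)) (by positivity)
  refine ⟨(1 + ε) * k, by positivity, fun W => ?_⟩
  let f : V →₀ ℂ := Finsupp.indicator W fun _ _ => 1
  have hf : ∀ x, f x = if x ∈ W then 1 else 0 := fun x => by
    by_cases hx : x ∈ W
    · simp [f, hx]
    · simp [f, hx]
  have hsupp : f.support = W := by
    ext x
    simp [hf]
  have h1 := hlow f
  have hq : ∀ g : V → ℝ, quadForm (mulMap g) f = ∑ x ∈ W, g x := fun g => by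
    rw [quadForm_mulMap, hsupp]
    exact Finset.sum_congr rfl fun x hx => by simp [hf, hx]
  have hN : normSqFin f = W.card := by
    rw [normSqFin, hsupp, Finset.sum_congr rfl fun x hx => by rw [hf, if_pos hx]]
    simp
  set S := closedNeighbors G W with hS
  have hb : boundaryCount G W = edgeSum G S fun x y => if x ∈ W ∧ y ∉ W then 1 else 0 := by
    rw [boundaryCount, ncard_adj_eq_edgeSum W subset_rfl (fun y => y ∉ W)]
    congr!
  have he : 2 * edgeCount G W = edgeSum G S fun x y => if x ∈ W ∧ y ∈ W then 1 else 0 := by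
    rw [edgeCount, mul_div_cancel₀ _ (two_ne_zero' ℝ),
      ncard_adj_eq_edgeSum W subset_rfl (fun y => y ∈ W)]
    congr!
  have hD : degForm G f = 2 * edgeCount G W + boundaryCount G W := by
    rw [he, hb, ← edgeSum_add, degForm, hsupp]
    congr 1
    funext x y
    by_cases hx : x ∈ W <;> by_cases hy : y ∈ W <;> simp [hf, hx, hy]
  have hE : energy G f = boundaryCount G W := by
    have h2 := edgeSum_swap (G := G) S fun x y => if x ∈ W ∧ y ∉ W then (1 : ℝ) else 0
    have h3 := edgeSum_add (G := G) S (fun x y => if x ∈ W ∧ y ∉ W then (1 : ℝ) else 0)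
      fun x y => if y ∈ W ∧ x ∉ W then (1 : ℝ) else 0
    rw [← h2, ← hb] at h3
    rw [energy, hsupp, ← hS, div_eq_iff two_ne_zero, mul_two, ← h3]
    congr 1
    funext x y
    by_cases hx : x ∈ W <;> by_cases hy : y ∈ W <;> simp [hf, hx, hy]
  rw [quadForm_degAdd, quadForm_schrodingerMap, hE, hD, hN, quadForm_eq_posPot_sub, hq, hq] at h1
  have hm : 0 ≤ ∑ x ∈ W, negPot q x := Finset.sum_nonneg fun x _ => negPot_nonneg q x
  set Qm := ∑ x ∈ W, negPot q x
  set Qp := ∑ x ∈ W, posPot q x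
  have h4 : 1 - ε / (1 + ε) = 1 / (1 + ε) := by
    field_simp
    ring
  rw [h4] at h1
  have h5 := mul_le_mul_of_nonneg_left h1 (show 0 ≤ 1 + ε by positivity)
  have h6 : (1 + ε) * (1 / (1 + ε) * (2 * edgeCount G W + boundaryCount G W + (Qp - Qm)) -
      k * W.card) = 2 * edgeCount G W + boundaryCount G W + (Qp - Qm) - (1 + ε) * k * W.card := by
    field_simp
  rw [h6] at h5
  nlinarith [mul_nonneg hε.le hm]

theorem tfae_almostSparse {q : V → ℝ} (hq : InKZeroPlus G q) :
    List.TFAE [AlmostSparse G q,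
      ∀ ε : ℝ, 0 < ε → ∃ k : ℝ, 0 ≤ k ∧ LowerBound G q ε k ∧ UpperBound G q ε k,
      ∀ ε : ℝ, 0 < ε → ∃ k : ℝ, 0 ≤ k ∧ LowerBound G q ε k] := by
  tfae_have 1 → 3 := fun h _ hε => h.lowerBound hq hε
  tfae_have 3 → 2 := fun h ε hε => by
    obtain ⟨k, hk, hl⟩ := h ε hε
    exact ⟨k, hk, hl, hl.upperBound⟩
  tfae_have 2 → 1 := fun h => almostSparse_of_lowerBound fun ε hε => by
    obtain ⟨k, hk, hl, _⟩ := h ε hε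
    exact ⟨k, hk, hl⟩
  tfae_finish

end Equivalences
-- Local symmetric operators on the sequence space
theorem denseRange_of_orthogonal {H : Type*} [NormedAddCommGroup H] [InnerProductSpace ℂ H]
    [CompleteSpace H] {E : Type*} [AddCommGroup E] [Module ℂ E] (L : E →ₗ[ℂ] H)
    (h : ∀ x, (∀ e, inner ℂ (L e) x = 0) → x = 0) : DenseRange L := by
  have : (LinearMap.range L).topologicalClosure = ⊤ := by
    rw [Submodule.topologicalClosure_eq_top_iff, Submodule.eq_bot_iff]
    intro x hx
    exact h x fun e => (Submodule.mem_orthogonal _ _).1 hx _ ⟨e, rfl⟩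
  exact (Submodule.dense_iff_topologicalClosure_eq_top).2 this

section SequenceSpace

variable {V : Type*}

theorem continuous_eval (x : V) : Continuous fun u : L2 V => (u : V → ℂ) x := by
  have h : ∀ u v : L2 V, ‖(u : V → ℂ) x - (v : V → ℂ) x‖ ≤ 1 * ‖u - v‖ := fun u v => by
    have := lp.norm_apply_le_norm (p := 2) (by norm_num) (u - v) x
    rw [one_mul]
    rwa [lp.coeFn_sub, Pi.sub_apply] at this
  exact (LipschitzWith.of_dist_le_mul (K := 1) (by simpa [dist_eq_norm] using h)).continuous

theorem inner_eq_sum_of_support {u v : L2 V} {S : Finset V} (h : ∀ x, x ∉ S → u x = 0) :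
    inner ℂ u v = ∑ x ∈ S, conj (u x) * v x := by
  rw [lp.inner_eq_tsum, tsum_eq_sum (s := S)]
  · refine Finset.sum_congr rfl fun x _ => ?_
    rw [RCLike.inner_apply, mul_comm]
  · intro x hx
    rw [h x hx, inner_zero_left]

/-- Operators on functions that preserve finite supports, are pointwise continuous on `ℓ²`, and are
formally symmetric. -/
structure IsLocalSymm (L : (V → ℂ) →ₗ[ℂ] (V → ℂ)) : Prop where
  fin : ∀ f : V →₀ ℂ, {x | L f x ≠ 0}.Finite
  cont : ∀ x, Continuous fun u : L2 V => L u x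
  symm : ∀ (f : V →₀ ℂ) (u v : L2 V), (v : V → ℂ) = L f →
    inner ℂ v u = ∑ x ∈ f.support, conj (f x) * L u x

theorem isLocalSymm_mulMap (g : V → ℝ) : IsLocalSymm (mulMap g) where
  fin f := f.support.finite_toSet.subset fun x hx => by
    rw [Finset.mem_coe, Finsupp.mem_support_iff]
    rintro h
    apply hx
    change (g x : ℂ) * f x = 0
    rw [h, mul_zero]
  cont x := continuous_const.mul (continuous_eval x)
  symm f u v hv := by
    have hv' : ∀ x, v x = (g x : ℂ) * f x := fun x => congrFun hv x
    rw [inner_eq_sum_of_support (S := f.support)]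
    · refine Finset.sum_congr rfl fun x _ => ?_
      rw [hv', map_mul, Complex.conj_ofReal]
      change _ = conj (f x) * ((g x : ℂ) * u x)
      ring
    · intro x hx
      rw [hv', Finsupp.notMem_support_iff.1 hx, mul_zero]

theorem isLocalSymm_id : IsLocalSymm (LinearMap.id : (V → ℂ) →ₗ[ℂ] (V → ℂ)) := by
  have : (LinearMap.id : (V → ℂ) →ₗ[ℂ] (V → ℂ)) = mulMap fun _ => 1 := by
    ext f x
    simp [mulMap]
  rw [this]
  exact isLocalSymm_mulMap _

theorem schrodingerMap_apply (G : SimpleGraph V) [G.LocallyFinite] (p : V → ℝ) (u : V → ℂ) (x : V) :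
    schrodingerMap G p u x =
      ((G.degree x : ℂ) + p x) * u x - ∑ y ∈ G.neighborFinset x, u y := by
  change ∑ y ∈ G.neighborFinset x, (u x - u y) + (p x : ℂ) * u x = _
  rw [Finset.sum_sub_distrib, Finset.sum_const, SimpleGraph.card_neighborFinset_eq_degree,
    nsmul_eq_mul]
  ring

theorem isLocalSymm_schrodingerMap (G : SimpleGraph V) [G.LocallyFinite] (p : V → ℝ) :
    IsLocalSymm (schrodingerMap G p) := by
  classical
  have hfin : ∀ (f : V →₀ ℂ) (x : V), x ∉ closedNeighbors G f.support →
      schrodingerMap G p f x = 0 := by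
    intro f x hx
    rw [schrodingerMap_apply, Finsupp.notMem_support_iff.1 fun h => hx (subset_closedNeighbors _ h),
      mul_zero, zero_sub, neg_eq_zero]
    refine Finset.sum_eq_zero fun y hy => Finsupp.notMem_support_iff.1 fun h => hx ?_
    exact mem_closedNeighbors_of_adj h ((SimpleGraph.mem_neighborFinset _ _ _).1 hy).symm
  refine ⟨fun f => ?_, fun x => ?_, fun f u v hv => ?_⟩
  · refine (closedNeighbors G f.support).finite_toSet.subset fun x hx => ?_
    by_contra h
    exact hx (hfin f x h)
  · simp only [schrodingerMap_apply]
    exact (continuous_const.mul (continuous_eval x)).sub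
      (continuous_finsetSum _ fun y _ => continuous_eval y)
  -- Expanding the image of `f` in point masses moves the operator onto `u` through finite sums, so
  -- `u` need not lie in any domain.
  · have hdecomp : v = ∑ x ∈ f.support, (lp.single 2 x (((G.degree x : ℂ) + p x) * f x) -
        ∑ y ∈ G.neighborFinset x, lp.single 2 y (f x)) := by
      ext z
      rw [hv, schrodingerMap_apply, lp.coeFn_sum, Finset.sum_apply]
      simp only [lp.coeFn_sub, lp.coeFn_sum, Pi.sub_apply, Finset.sum_apply, lp.coeFn_single,
        Finset.sum_sub_distrib]
      congr 1
      · simp only [Pi.single_apply]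
        rw [Finset.sum_ite_eq]
        split_ifs with h
        · rfl
        · rw [Finsupp.notMem_support_iff.1 h, mul_zero]
      · simp only [Pi.single_apply, Finset.sum_ite_eq, SimpleGraph.mem_neighborFinset]
        rw [← Finset.sum_filter]
        symm
        rw [← Finset.sum_filter_ne_zero (s := G.neighborFinset z)]
        refine Finset.sum_congr ?_ fun _ _ => rfl
        ext y
        simp only [Finset.mem_filter, Finsupp.mem_support_iff, SimpleGraph.mem_neighborFinset]
        rw [G.adj_comm]
        exact and_comm
    rw [hdecomp, sum_inner]
    refine Finset.sum_congr rfl fun x _ => ?_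
    rw [inner_sub_left, sum_inner, lp.inner_single_left, schrodingerMap_apply, mul_sub,
      Finset.mul_sum, RCLike.inner_apply]
    congr 1
    · rw [map_mul, map_add, map_natCast, Complex.conj_ofReal]
      ring
    · refine Finset.sum_congr rfl fun y _ => ?_
      rw [lp.inner_single_left, RCLike.inner_apply, mul_comm]

/-- The restriction of `L` to the finitely supported functions, as a map into `ℓ²(V)`. -/
noncomputable def finOp (L : (V → ℂ) →ₗ[ℂ] (V → ℂ)) (hL : IsLocalSymm L) :
    (V →₀ ℂ) →ₗ[ℂ] L2 V where
  toFun f := ⟨L f, (memℓp_zero (hL.fin f)).of_exponent_ge zero_le⟩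
  map_add' f g := Subtype.ext (show L ⇑(f + g) = L f + L g by rw [Finsupp.coe_add, map_add])
  map_smul' c f := Subtype.ext (show L ⇑(c • f) = c • L f by rw [Finsupp.coe_smul, map_smul])

theorem finOp_coe {L : (V → ℂ) →ₗ[ℂ] (V → ℂ)} (hL : IsLocalSymm L) (f : V →₀ ℂ) :
    ((finOp L hL f : L2 V) : V → ℂ) = L f := rfl

theorem inner_finOp {L : (V → ℂ) →ₗ[ℂ] (V → ℂ)} (hL : IsLocalSymm L) (f : V →₀ ℂ) (u : L2 V) :
    inner ℂ (finOp L hL f) u = ∑ x ∈ f.support, conj (f x) * L u x :=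
  hL.symm f u _ rfl

/-- The inclusion of the finitely supported functions into `ℓ²(V)`. -/
noncomputable def toL2 : (V →₀ ℂ) →ₗ[ℂ] L2 V := finOp LinearMap.id isLocalSymm_id

theorem toL2_coe (f : V →₀ ℂ) : ((toL2 f : L2 V) : V → ℂ) = f := rfl

theorem inner_toL2 (f : V →₀ ℂ) (u : L2 V) :
    inner ℂ (toL2 f) u = ∑ x ∈ f.support, conj (f x) * u x :=
  inner_finOp isLocalSymm_id f u

theorem re_inner_toL2_finOp {L : (V → ℂ) →ₗ[ℂ] (V → ℂ)} (hL : IsLocalSymm L) (f : V →₀ ℂ) :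
    (inner ℂ (toL2 f) (finOp L hL f)).re = quadForm L f := by
  rw [inner_toL2]
  rfl

theorem norm_toL2_sq (f : V →₀ ℂ) : ‖toL2 f‖ ^ 2 = normSqFin f := by
  rw [← inner_self_eq_norm_sq (𝕜 := ℂ), inner_toL2, normSqFin, map_sum]
  refine Finset.sum_congr rfl fun x _ => ?_
  rw [toL2_coe, Complex.conj_mul']
  norm_cast

theorem norm_finOp_mulMap_sq (g : V → ℝ) (f : V →₀ ℂ) :
    ‖finOp (mulMap g) (isLocalSymm_mulMap g) f‖ ^ 2 = quadForm (mulMap fun x => g x ^ 2) f := by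
  rw [← inner_self_eq_norm_sq (𝕜 := ℂ), inner_finOp, quadForm]
  change (Finset.sum _ _ : ℂ).re = _
  congr 1
  refine Finset.sum_congr rfl fun x _ => ?_
  change conj (f x) * ((g x : ℂ) * ((g x : ℂ) * f x)) = conj (f x) * (((g x ^ 2 : ℝ) : ℂ) * f x)
  push_cast
  ring

/-- By formal symmetry, testing with point masses shows that a vector orthogonal to the range
satisfies `L u = 0` pointwise. -/
theorem denseRange_finOp {L : (V → ℂ) →ₗ[ℂ] (V → ℂ)} (hL : IsLocalSymm L)
    (h : ∀ u : L2 V, L u = 0 → u = 0) : DenseRange (finOp L hL) := by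
  refine denseRange_of_orthogonal _ fun u hu => h u ?_
  funext x
  have := hu (Finsupp.single x 1)
  rw [inner_finOp, Finsupp.support_single x one_ne_zero] at this
  simpa using this

theorem summable_norm_sq (u : L2 V) : Summable fun x => ‖u x‖ ^ 2 := by
  have := (lp.memℓp u).summable (by norm_num)
  simpa using this

variable {G : SimpleGraph V} [G.LocallyFinite] {p : V → ℝ}

/-- The maximum principle: `Δ + p` with `p ≥ 1` has no kernel in `ℓ²(V)`. -/
theorem eq_zero_of_schrodingerMap_eq_zero (hp : ∀ x, 1 ≤ p x) (u : L2 V)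
    (hu : schrodingerMap G p u = 0) : u = 0 := by
  by_contra hne
  obtain ⟨x₀, hx₀⟩ : ∃ x, u x ≠ 0 := by
    by_contra! h
    exact hne (lp.ext (funext h))
  have hpos : 0 < ‖u x₀‖ ^ 2 := by positivity
  -- Square-summability makes `|u|` attain its maximum. There the equation would give `(deg + p)|u|
  -- ≤ deg |u|`, contradicting `p ≥ 1`.
  have hfin : {x | ‖u x₀‖ ^ 2 ≤ ‖u x‖ ^ 2}.Finite := by
    have := (summable_norm_sq u).tendsto_cofinite_zero.eventually (gt_mem_nhds hpos)
    rw [Filter.eventually_cofinite] at this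
    simpa using this
  obtain ⟨x, hx, hmax⟩ := Set.exists_max_image _ (fun x => ‖u x‖) hfin ⟨x₀, le_refl (‖u x₀‖ ^ 2)⟩
  have hx' : ‖u x₀‖ ≤ ‖u x‖ := (sq_le_sq₀ (norm_nonneg _) (norm_nonneg _)).1 hx
  have hglob : ∀ y, ‖u y‖ ≤ ‖u x‖ := by
    intro y
    by_cases hy : ‖u x₀‖ ^ 2 ≤ ‖u y‖ ^ 2
    · exact hmax y hy
    · have : ‖u y‖ ≤ ‖u x₀‖ := (sq_le_sq₀ (norm_nonneg _) (norm_nonneg _)).1 (not_le.1 hy).le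
      exact this.trans hx'
  have h1 := congrFun hu x
  rw [schrodingerMap_apply, Pi.zero_apply, sub_eq_zero] at h1
  have h2 := congrArg norm h1
  have h3 : ‖∑ y ∈ G.neighborFinset x, u y‖ ≤ G.degree x * ‖u x‖ := by
    refine (norm_sum_le _ _).trans ?_
    refine (Finset.sum_le_sum fun y _ => hglob y).trans ?_
    rw [Finset.sum_const, SimpleGraph.card_neighborFinset_eq_degree, nsmul_eq_mul]
  have h4 : ‖(G.degree x : ℂ) + p x‖ = G.degree x + p x := by
    have : (G.degree x : ℂ) + p x = ((G.degree x + p x : ℝ) : ℂ) := by push_cast; rfl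
    rw [this, Complex.norm_real, Real.norm_of_nonneg]
    linarith [hp x, (Nat.cast_nonneg (G.degree x) : (0 : ℝ) ≤ _)]
  rw [norm_mul, h4] at h2
  have h5 : 0 < ‖u x‖ := (norm_pos_iff.2 hx₀).trans_le hx'
  nlinarith [hp x]

theorem normSqFin_le_quadForm (hp : ∀ x, 1 ≤ p x) (f : V →₀ ℂ) :
    normSqFin f ≤ quadForm (schrodingerMap G p) f := by
  rw [quadForm_schrodingerMap, quadForm_mulMap, normSqFin]
  have := energy_nonneg (G := G) f
  have h : ∑ x ∈ f.support, ‖f x‖ ^ 2 ≤ ∑ x ∈ f.support, p x * ‖f x‖ ^ 2 :=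
    Finset.sum_le_sum fun x _ => le_mul_of_one_le_left (by positivity) (hp x)
  linarith

-- The maximum principle makes the image of the finitely supported functions dense, and `p ≥ 1`
-- gives `‖f‖ ≤ ‖(Δ + p) f‖`. So the inverse extends by continuity, and pointwise continuity of `Δ +
-- p` keeps it a right inverse.
variable (G) in
theorem exists_resolvent (hp : ∀ x, 1 ≤ p x) : ∃ R : L2 V →L[ℂ] L2 V, 0 ≤ R ∧ ‖R‖ ≤ 1 ∧
    ∀ h : L2 V, schrodingerMap G p (R h) = h := by
  set hL := isLocalSymm_schrodingerMap G p
  set K := finOp (schrodingerMap G p) hL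
  have hd : DenseRange K := denseRange_finOp hL fun u hu => eq_zero_of_schrodingerMap_eq_zero hp u hu
  have hnorm : ∀ f, ‖toL2 f‖ ≤ 1 * ‖K f‖ := by
    intro f
    rw [one_mul]
    have h1 := normSqFin_le_quadForm (G := G) hp f
    rw [← norm_toL2_sq, ← re_inner_toL2_finOp hL] at h1
    have h2 := re_inner_le_norm (𝕜 := ℂ) (toL2 f) (K f)
    have h3 : ‖toL2 f‖ ^ 2 ≤ ‖toL2 f‖ * ‖K f‖ := h1.trans h2
    by_cases h0 : ‖toL2 f‖ = 0
    · rw [h0]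
      exact norm_nonneg _
    · have : 0 < ‖toL2 f‖ := lt_of_le_of_ne (norm_nonneg _) (Ne.symm h0)
      nlinarith
  let R : L2 V →L[ℂ] L2 V := (toL2 : (V →₀ ℂ) →ₗ[ℂ] L2 V).extendOfNorm K
  have hR : ∀ f, R (K f) = toL2 f := LinearMap.extendOfNorm_eq hd ⟨1, hnorm⟩
  refine ⟨R, ?_, ?_, fun h => ?_⟩
  · refine isPositive_of_symm (fun x y => ?_) fun x => ?_
    · refine hd.induction_on₂ (p := fun x y => inner ℂ (R x) y = inner ℂ x (R y))
        (isClosed_eq (by fun_prop) (by fun_prop)) (fun f g => ?_) x y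
      rw [hR, hR, inner_toL2, inner_finOp]
      rfl
    · refine hd.induction_on (p := fun x => 0 ≤ (inner ℂ x (R x)).re) x
        (isClosed_le (by fun_prop) (by fun_prop)) fun f => ?_
      rw [hR, ← inner_conj_symm, Complex.conj_re, re_inner_toL2_finOp]
      exact (normSqFin_nonneg f).trans (normSqFin_le_quadForm hp f)
  · refine ContinuousLinearMap.opNorm_le_bound _ zero_le_one fun x => ?_
    exact LinearMap.norm_extendOfNorm_apply_le hd 1 hnorm x
  · funext x
    refine hd.induction_on (p := fun h => schrodingerMap G p (R h) x = h x) h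
      (isClosed_eq ((hL.cont x).comp R.continuous) (continuous_eval x)) fun f => ?_
    rw [hR]
    rfl

end SequenceSpace
-- Multiplication operators
section Multiplication

variable {V : Type*}

theorem memℓp_mul_of_bounded {g : V → ℝ} {C : ℝ} (hg : ∀ x, |g x| ≤ C) (φ : L2 V) :
    Memℓp (mulMap g φ) 2 := by
  refine memℓp_gen ?_
  have hs := (summable_norm_sq φ).mul_left (C ^ 2)
  refine Summable.of_nonneg_of_le (fun x => by positivity) (fun x => ?_) hs
  change ‖(g x : ℂ) * φ x‖ ^ (2 : ENNReal).toReal ≤ _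
  rw [norm_mul, Complex.norm_real, Real.norm_eq_abs]
  simp only [ENNReal.toReal_ofNat, Real.rpow_ofNat]
  rw [mul_pow]
  exact mul_le_mul_of_nonneg_right (pow_le_pow_left₀ (abs_nonneg _) (hg x) 2) (by positivity)

theorem norm_sq_eq_tsum (u : L2 V) : ‖u‖ ^ 2 = ∑' x, ‖u x‖ ^ 2 := by
  have := lp.norm_rpow_eq_tsum (p := 2) (by norm_num) u
  simpa using this

theorem norm_le_of_norm_apply_le {u v : L2 V} {C : ℝ} (hC : 0 ≤ C)
    (h : ∀ x, ‖u x‖ ≤ C * ‖v x‖) : ‖u‖ ≤ C * ‖v‖ := by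
  rw [← sq_le_sq₀ (norm_nonneg _) (by positivity), mul_pow, norm_sq_eq_tsum, norm_sq_eq_tsum,
    ← tsum_mul_left]
  refine (summable_norm_sq u).tsum_le_tsum (fun x => ?_) ((summable_norm_sq v).mul_left _)
  rw [← mul_pow]
  exact pow_le_pow_left₀ (norm_nonneg _) (h x) 2

open scoped Classical in
/-- Multiplication by a bounded real function, as a bounded operator in `ℓ²(V)`. -/
noncomputable def mulCLM (g : V → ℝ) : L2 V →L[ℂ] L2 V :=
  if h : ∃ C, ∀ x, |g x| ≤ C then
    LinearMap.mkContinuous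
      { toFun := fun φ => ⟨mulMap g φ, memℓp_mul_of_bounded h.choose_spec φ⟩
        map_add' := fun φ ψ => Subtype.ext (map_add (mulMap g) (φ : V → ℂ) ψ)
        map_smul' := fun c φ => Subtype.ext (map_smul (mulMap g) c (φ : V → ℂ)) }
      |h.choose| fun φ => norm_le_of_norm_apply_le (abs_nonneg _) fun x => by
        change ‖(g x : ℂ) * φ x‖ ≤ _
        rw [norm_mul, Complex.norm_real, Real.norm_eq_abs]
        exact mul_le_mul_of_nonneg_right ((h.choose_spec x).trans (le_abs_self _)) (norm_nonneg _)
  else 0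

theorem mulCLM_apply {g : V → ℝ} {C : ℝ} (hg : ∀ x, |g x| ≤ C) (φ : L2 V) (x : V) :
    mulCLM g φ x = (g x : ℂ) * φ x := by
  have h : ∃ C, ∀ x, |g x| ≤ C := ⟨C, hg⟩
  rw [mulCLM, dif_pos h]
  rfl

theorem mulCLM_mul {g h : V → ℝ} {C C' : ℝ} (hg : ∀ x, |g x| ≤ C) (hh : ∀ x, |h x| ≤ C') :
    mulCLM g * mulCLM h = mulCLM fun x => g x * h x := by
  ext φ x
  have hgh : ∀ x, |g x * h x| ≤ C * C' := fun x => by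
    rw [abs_mul]
    exact mul_le_mul (hg x) (hh x) (abs_nonneg _) ((abs_nonneg _).trans (hg x))
  rw [mul_apply_eq_comp, mulCLM_apply hg, mulCLM_apply hh, mulCLM_apply hgh]
  push_cast
  ring

theorem inner_mulCLM {g : V → ℝ} {C : ℝ} (hg : ∀ x, |g x| ≤ C) (u v : L2 V) :
    inner ℂ (mulCLM g u) v = inner ℂ u (mulCLM g v) := by
  rw [lp.inner_eq_tsum, lp.inner_eq_tsum]
  refine tsum_congr fun x => ?_
  rw [mulCLM_apply hg, mulCLM_apply hg, RCLike.inner_apply, RCLike.inner_apply, map_mul,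
    Complex.conj_ofReal]
  ring

theorem isSelfAdjoint_mulCLM {g : V → ℝ} {C : ℝ} (hg : ∀ x, |g x| ≤ C) :
    IsSelfAdjoint (mulCLM g) := by
  rw [ContinuousLinearMap.isSelfAdjoint_iff_isSymmetric]
  exact inner_mulCLM hg

theorem mulCLM_nonneg {g : V → ℝ} {C : ℝ} (hg : ∀ x, |g x| ≤ C) (h0 : ∀ x, 0 ≤ g x) :
    0 ≤ mulCLM g := by
  refine isPositive_of_symm (inner_mulCLM hg) fun u => ?_
  have hs : Summable fun x => inner ℂ (u x) (mulCLM g u x) :=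
    lp.summable_inner (𝕜 := ℂ) u (mulCLM g u)
  rw [lp.inner_eq_tsum, Complex.re_tsum hs]
  refine tsum_nonneg fun x => ?_
  rw [mulCLM_apply hg, RCLike.inner_apply, mul_assoc, Complex.mul_conj, ← Complex.ofReal_mul,
    Complex.ofReal_re]
  exact mul_nonneg (h0 x) (Complex.normSq_nonneg _)

theorem injective_mulCLM {g : V → ℝ} {C : ℝ} (hg : ∀ x, |g x| ≤ C) (h0 : ∀ x, g x ≠ 0) :
    Function.Injective (mulCLM g) := by
  intro u v huv
  ext x
  have := congrArg (fun w : L2 V => w x) huv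
  simp only [mulCLM_apply hg] at this
  exact mul_left_cancel₀ (Complex.ofReal_ne_zero.2 (h0 x)) this

theorem mem_graph_maxOp {L : (V → ℂ) →ₗ[ℂ] (V → ℂ)} {φ ψ : L2 V} :
    (φ, ψ) ∈ (maxOp L).graph ↔ L φ = ψ := by
  rw [LinearPMap.mem_graph_iff]
  constructor
  · rintro ⟨y, rfl, rfl⟩
    rfl
  · intro h
    have hm : Memℓp (L (φ : V → ℂ)) 2 := by
      rw [h]
      exact lp.memℓp ψ
    exact ⟨⟨φ, hm⟩, rfl, Subtype.ext h⟩

theorem mulOp_eq_quotOp {g a b : V → ℝ} {C C' δ : ℝ} (ha : ∀ x, |a x| ≤ C) (hb : ∀ x, |b x| ≤ C')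
    (ha0 : ∀ x, a x ≠ 0) (hδ : 0 < δ) (hab : ∀ x, δ ≤ a x ^ 2 + b x ^ 2)
    (hg : ∀ x, g x * a x = b x) : mulOp g = quotOp (mulCLM a) (mulCLM b) := by
  apply LinearPMap.eq_of_eq_graph
  ext ⟨φ, ψ⟩
  rw [mem_graph_quotOp (injective_mulCLM ha ha0), mulOp, mem_graph_maxOp]
  constructor
  · intro h
    have hd : ∀ x, |(a x ^ 2 + b x ^ 2)⁻¹| ≤ δ⁻¹ := fun x => by
      rw [abs_of_nonneg (by positivity)]
      exact inv_anti₀ hδ (hab x)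
    have hψ : ∀ x, ψ x = (g x : ℂ) * φ x := fun x => (congrFun h x).symm
    have hne : ∀ x, ((a x : ℂ) ^ 2 + (b x : ℂ) ^ 2) ≠ 0 := fun x => by
      exact_mod_cast (hδ.trans_le (hab x)).ne'
    refine ⟨mulCLM (fun x => (a x ^ 2 + b x ^ 2)⁻¹) (mulCLM a φ + mulCLM b ψ), ?_, ?_⟩
    · ext x
      rw [mulCLM_apply ha, mulCLM_apply hd, lp.coeFn_add, Pi.add_apply, mulCLM_apply ha,
        mulCLM_apply hb, hψ]
      have := hne x
      have hg' : (g x : ℂ) * a x = b x := by exact_mod_cast hg x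
      push_cast
      field_simp
      rw [← hg']
      ring
    · ext x
      rw [mulCLM_apply hb, mulCLM_apply hd, lp.coeFn_add, Pi.add_apply, mulCLM_apply ha,
        mulCLM_apply hb, hψ]
      have := hne x
      have hg' : (g x : ℂ) * a x = b x := by exact_mod_cast hg x
      push_cast
      field_simp
      rw [← hg']
      ring
  · rintro ⟨k, rfl, rfl⟩
    funext x
    change (g x : ℂ) * mulCLM a k x = mulCLM b k x
    rw [mulCLM_apply ha, mulCLM_apply hb, ← hg x]
    push_cast
    ring

theorem mulOp_eq_invSubOp {g : V → ℝ} {c : ℝ} (hg : ∀ x, 1 ≤ g x + c) :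
    mulOp g = invSubOp (mulCLM fun x => (g x + c)⁻¹) c := by
  have hb : ∀ x, |(g x + c)⁻¹| ≤ 1 := fun x => by
    rw [abs_of_nonneg (inv_nonneg.2 (by linarith [hg x]))]
    exact inv_le_one_of_one_le₀ (hg x)
  have hne : ∀ x, g x + c ≠ 0 := fun x => by linarith [hg x]
  apply LinearPMap.eq_of_eq_graph
  ext ⟨φ, ψ⟩
  rw [invSubOp, mem_graph_quotOp (injective_mulCLM hb fun x => inv_ne_zero (hne x)), mulOp,
    mem_graph_maxOp]
  have hne' : ∀ x, (g x : ℂ) + c ≠ 0 := fun x => by exact_mod_cast hne x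
  constructor
  · intro h
    have hψ : ∀ x, ψ x = (g x : ℂ) * φ x := fun x => (congrFun h x).symm
    have h1 : mulCLM (fun x => (g x + c)⁻¹) (ψ + (c : ℂ) • φ) = φ := by
      ext x
      rw [mulCLM_apply hb, lp.coeFn_add, Pi.add_apply, hψ, lp.coeFn_smul, Pi.smul_apply,
        smul_eq_mul]
      have := hne' x
      push_cast
      field_simp
    refine ⟨ψ + (c : ℂ) • φ, h1, ?_⟩
    rw [sub_apply, smul_apply, h1, one_apply_eq_self, add_sub_cancel_right]
  · rintro ⟨k, rfl, rfl⟩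
    funext x
    rw [sub_apply, smul_apply, one_apply_eq_self, lp.coeFn_sub, Pi.sub_apply, lp.coeFn_smul,
      Pi.smul_apply, smul_eq_mul]
    change (g x : ℂ) * mulCLM (fun x => (g x + c)⁻¹) k x = _
    rw [mulCLM_apply hb]
    have := hne' x
    push_cast
    field_simp
    ring

theorem posSqrt_mulOp {g : V → ℝ} (hg : ∀ x, 0 ≤ g x) :
    posSqrt (mulOp g) = mulOp fun x => Real.sqrt (g x) := by
  set s : V → ℝ := fun x => Real.sqrt (g x) with hs
  have hs0 : ∀ x, 0 ≤ s x := fun x => Real.sqrt_nonneg _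
  have hss : ∀ x, s x * s x = g x := fun x => Real.mul_self_sqrt (hg x)
  -- The functions `a = 1 / (1 + √g)` and `b = √g / (1 + √g)` are bounded even if `g` is not, with
  -- `b / a = √g`. From `a + b = 1` come `a² + b² ≥ 1/2` and `a⁴ + b⁴ ≥ 1/8`.
  set a : V → ℝ := fun x => (1 + s x)⁻¹ with ha
  set b : V → ℝ := fun x => s x * (1 + s x)⁻¹ with hb
  have hpos : ∀ x, 0 < 1 + s x := fun x => by linarith [hs0 x]
  have ha0 : ∀ x, 0 < a x := fun x => inv_pos.2 (hpos x)
  have hb0 : ∀ x, 0 ≤ b x := fun x => mul_nonneg (hs0 x) (ha0 x).le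
  have hsum : ∀ x, a x + b x = 1 := fun x => by
    have := (hpos x).ne'
    simp only [ha, hb]
    field_simp
  have ha1 : ∀ x, |a x| ≤ 1 := fun x => by
    rw [abs_of_nonneg (ha0 x).le]
    linarith [hsum x, hb0 x]
  have hb1 : ∀ x, |b x| ≤ 1 := fun x => by
    rw [abs_of_nonneg (hb0 x)]
    linarith [hsum x, ha0 x]
  have haa1 : ∀ x, |a x * a x| ≤ 1 := fun x => by
    rw [abs_mul]
    exact mul_le_one₀ (ha1 x) (abs_nonneg _) (ha1 x)
  have hbb1 : ∀ x, |b x * b x| ≤ 1 := fun x => by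
    rw [abs_mul]
    exact mul_le_one₀ (hb1 x) (abs_nonneg _) (hb1 x)
  have hlow : ∀ x, 1 / 2 ≤ a x ^ 2 + b x ^ 2 := fun x => by
    nlinarith [hsum x, sq_nonneg (a x - b x)]
  have hlow' : ∀ x, 1 / 8 ≤ (a x * a x) ^ 2 + (b x * b x) ^ 2 := fun x => by
    nlinarith [hlow x, sq_nonneg (a x ^ 2 - b x ^ 2)]
  have e1 : mulOp s = quotOp (mulCLM a) (mulCLM b) :=
    mulOp_eq_quotOp ha1 hb1 (fun x => (ha0 x).ne') (by norm_num) hlow fun x => rfl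
  have e2 : mulOp g = quotOp (mulCLM a * mulCLM a) (mulCLM b * mulCLM b) := by
    rw [mulCLM_mul ha1 ha1, mulCLM_mul hb1 hb1]
    refine mulOp_eq_quotOp haa1 hbb1 (fun x => (mul_pos (ha0 x) (ha0 x)).ne') (by norm_num) hlow'
      fun x => ?_
    rw [← hss x]
    simp only [ha, hb]
    ring
  have hpair : IsQuotPair (mulCLM a) (mulCLM b) := by
    refine ⟨isSelfAdjoint_mulCLM ha1, isSelfAdjoint_mulCLM hb1, ?_,
      injective_mulCLM ha1 fun x => (ha0 x).ne', ?_⟩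
    · rw [commute_iff_eq, mulCLM_mul ha1 hb1, mulCLM_mul hb1 ha1]
      simp only [mul_comm]
    · have hd : ∀ x, |(a x ^ 2 + b x ^ 2)⁻¹| ≤ 2 := fun x => by
        rw [abs_of_nonneg (by positivity)]
        have := inv_anti₀ (by norm_num) (hlow x)
        norm_num at this ⊢
        exact this
      have hmul : ∀ φ : L2 V, ∀ x, (mulCLM a * mulCLM a + mulCLM b * mulCLM b) φ x =
          ((a x ^ 2 + b x ^ 2 : ℝ) : ℂ) * φ x := fun φ x => by
        rw [add_apply, lp.coeFn_add, Pi.add_apply, mul_apply_eq_comp, mul_apply_eq_comp,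
          mulCLM_apply ha1, mulCLM_apply ha1, mulCLM_apply hb1, mulCLM_apply hb1]
        push_cast
        ring
      have hne : ∀ x, ((a x ^ 2 + b x ^ 2 : ℝ) : ℂ) ≠ 0 := fun x => by
        exact_mod_cast (show 0 < a x ^ 2 + b x ^ 2 by linarith [hlow x]).ne'
      refine ⟨⟨mulCLM a * mulCLM a + mulCLM b * mulCLM b,
        mulCLM fun x => (a x ^ 2 + b x ^ 2)⁻¹, ?_, ?_⟩, rfl⟩
      · ext φ x
        rw [mul_apply_eq_comp, hmul, mulCLM_apply hd, one_apply_eq_self, Complex.ofReal_inv,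
          mul_inv_cancel_left₀ (hne x)]
      · ext φ x
        rw [mul_apply_eq_comp, mulCLM_apply hd, hmul, one_apply_eq_self, Complex.ofReal_inv,
          inv_mul_cancel_left₀ (hne x)]
  rw [e2, e1]
  refine posSqrt_quotOp hpair ?_
  rw [mulCLM_mul ha1 hb1]
  refine mulCLM_nonneg (C := 1) (fun x => ?_) fun x => mul_nonneg (ha0 x).le (hb0 x)
  rw [abs_mul]
  exact mul_le_one₀ (ha1 x) (abs_nonneg _) (hb1 x)

end Multiplication
-- Bounded representation of the two forms
section FormRepresentation

variable {V : Type*}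

/-- The form `t` on the finitely supported functions is represented as `t(f) = ⟨k, M k⟩` for
`f = C k`, with `M` bounded and coercive with right inverse `N`; `j` is a right inverse of `C` on the
finitely supported functions, which are a form core. -/
structure IsFormRep (C M N : L2 V →L[ℂ] L2 V) (j : (V →₀ ℂ) →ₗ[ℂ] L2 V) (t : (V →₀ ℂ) → ℝ) :
    Prop where
  root_selfAdjoint : IsSelfAdjoint C
  root_injective : Function.Injective C
  selfAdjoint : IsSelfAdjoint M
  mul_inv : M * N = 1
  coercive : ∀ k, 1 / 2 * ‖k‖ ^ 2 ≤ (inner ℂ k (M k)).re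
  dense : DenseRange j
  root_apply : ∀ f, C (j f) = toL2 f
  form : ∀ f, (inner ℂ (j f) (M (j f))).re = t f

/-- Coercivity bounds `M` from below; self-adjointness makes its range dense, so the inverse extends
to the whole space. -/
theorem exists_inverse_of_coercive {H : Type*} [NormedAddCommGroup H] [InnerProductSpace ℂ H]
    [CompleteSpace H] {M : H →L[ℂ] H} (hM : IsSelfAdjoint M)
    (hc : ∀ k, 1 / 2 * ‖k‖ ^ 2 ≤ (inner ℂ k (M k)).re) :
    ∃ N : H →L[ℂ] H, M * N = 1 ∧ N * M = 1 := by
  have hbound : ∀ k, ‖k‖ ≤ 2 * ‖M k‖ := by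
    intro k
    have h1 := (hc k).trans (re_inner_le_norm (𝕜 := ℂ) k (M k))
    by_cases h0 : ‖k‖ = 0
    · rw [h0]
      positivity
    · have : 0 < ‖k‖ := lt_of_le_of_ne (norm_nonneg _) (Ne.symm h0)
      nlinarith
  have hinj : Function.Injective M := by
    rw [injective_iff_map_eq_zero]
    intro k hk
    have := hbound k
    rw [hk, norm_zero, mul_zero] at this
    exact norm_le_zero_iff.1 this
  have hd : DenseRange (M : H →ₗ[ℂ] H) := denseRange_of_injective hM hinj
  let N : H →L[ℂ] H := (LinearMap.id : H →ₗ[ℂ] H).extendOfNorm (M : H →ₗ[ℂ] H)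
  have hN : ∀ k, N (M k) = k :=
    LinearMap.extendOfNorm_eq (f := (LinearMap.id : H →ₗ[ℂ] H)) (e := (M : H →ₗ[ℂ] H)) hd
      ⟨2, hbound⟩
  refine ⟨N, ?_, ?_⟩
  · ext h
    refine hd.induction_on (p := fun h => (M * N) h = (1 : H →L[ℂ] H) h) h
      (isClosed_eq (by fun_prop) (by fun_prop)) fun k => ?_
    change M (N (M k)) = M k
    rw [hN]
  · ext k
    exact hN k

variable {G : SimpleGraph V} [G.LocallyFinite] {p : V → ℝ} {R : L2 V →L[ℂ] L2 V}

theorem resolvent_injective (hR : ∀ h : L2 V, schrodingerMap G p (R h) = h) :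
    Function.Injective R := by
  intro x y hxy
  apply lp.ext
  rw [← hR x, ← hR y, hxy]

theorem resolvent_eq (hp : ∀ x, 1 ≤ p x) (hR : ∀ h : L2 V, schrodingerMap G p (R h) = h) {u h : L2 V}
    (hu : schrodingerMap G p u = h) : R h = u := by
  rw [← sub_eq_zero]
  apply eq_zero_of_schrodingerMap_eq_zero hp (G := G)
  rw [lp.coeFn_sub, map_sub, hR, hu, sub_self]

theorem resolvent_finOp (hp : ∀ x, 1 ≤ p x) (hR : ∀ h : L2 V, schrodingerMap G p (R h) = h)
    (f : V →₀ ℂ) : R (finOp (schrodingerMap G p) (isLocalSymm_schrodingerMap G p) f) = toL2 f :=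
  resolvent_eq hp hR rfl

theorem quadForm_add_one (g : V → ℝ) (f : V →₀ ℂ) :
    quadForm (mulMap fun x => g x + 1) f = quadForm (mulMap g) f + normSqFin f := by
  rw [quadForm_mulMap, quadForm_mulMap, normSqFin, ← Finset.sum_add_distrib]
  exact Finset.sum_congr rfl fun x _ => by ring

/-- The right inverse is two-sided on the maximal domain because the maximum principle leaves `Δ + g
+ 1` no kernel in `ℓ²`. -/
theorem maxOp_schrodingerMap_eq {g : V → ℝ} (hg : ∀ x, 0 ≤ g x)
    (hR : ∀ h : L2 V, schrodingerMap G (fun x => g x + 1) (R h) = h) :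
    maxOp (schrodingerMap G g) = invSubOp R 1 := by
  have hp : ∀ x, 1 ≤ g x + 1 := fun x => by linarith [hg x]
  have hadd : ∀ u : L2 V, schrodingerMap G (fun x => g x + 1) u = schrodingerMap G g u + u := by
    intro u
    funext x
    rw [Pi.add_apply, schrodingerMap_apply, schrodingerMap_apply]
    push_cast
    ring
  apply LinearPMap.eq_of_eq_graph
  ext ⟨φ, ψ⟩
  rw [invSubOp, mem_graph_quotOp (resolvent_injective hR), mem_graph_maxOp]
  constructor
  · intro h
    have h1 : R (ψ + φ) = φ := by
      refine resolvent_eq hp hR ?_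
      rw [hadd, h, lp.coeFn_add]
    refine ⟨ψ + φ, h1, ?_⟩
    rw [sub_apply, smul_apply, one_apply_eq_self, h1, Complex.ofReal_one, one_smul,
      add_sub_cancel_right]
  · rintro ⟨k, rfl, rfl⟩
    have h1 := hR k
    rw [hadd] at h1
    rw [sub_apply, smul_apply, one_apply_eq_self, Complex.ofReal_one, one_smul, lp.coeFn_sub, ← h1]
    simp

/-- A concrete KLMN theorem. With `R = (Δ + q₊ + 1)⁻¹`, `C = R^(1/2)` and `φ = C k`, the form of `Δ
+ q₊` is `⟨k, (1 - R) k⟩` and that of `q₋` is `‖D k‖²` for the bounded operator `D = √q₋ C`. Adding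
`c = C₀ + 1` yields the coercive `M = 1 - R - D*D + c R`, with inverse `N`, and `C N C` is the
resolvent of the form sum. -/
theorem exists_isFormRep_schrodinger {q : V → ℝ} {C₀ : ℝ}
    (hC : ∀ f : V →₀ ℂ, quadForm (mulMap (negPot q)) f ≤
      1 / 2 * quadForm (schrodingerMap G (posPot q)) f + C₀ * normSqFin f) (hC₀ : 0 ≤ C₀) :
    ∃ C M N j, IsFormRep C M N j
      (fun f => quadForm (schrodingerMap G q) f + (C₀ + 1) * normSqFin f) ∧
      schrodinger G q = invSubOp (C * N * C) (C₀ + 1) := by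
  set c := C₀ + 1 with hc
  have hp : ∀ x, 1 ≤ posPot q x + 1 := fun x => by linarith [posPot_nonneg q x]
  obtain ⟨R, hR0, hR1, hR⟩ := exists_resolvent G hp
  have hRi := resolvent_injective hR
  obtain ⟨C, s, hCsa, hssa, hCi, hCC', hss', hSqrt⟩ := exists_posSqrt_invSubOp_one hR0 hR1 hRi
  have hCC : ∀ k, C (C k) = R k := fun k => DFunLike.congr_fun hCC' k
  have hss : ∀ k, s (s k) = k - R k := fun k => DFunLike.congr_fun hss' k
  set K := finOp (schrodingerMap G fun x => posPot q x + 1)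
    (isLocalSymm_schrodingerMap G fun x => posPot q x + 1) with hK
  have hRK : ∀ f, R (K f) = toL2 f := resolvent_finOp hp hR
  have hKd : DenseRange K := denseRange_finOp _ fun u hu => eq_zero_of_schrodingerMap_eq_zero hp u hu
  -- As `C² K f = R K f = f`, this is `C⁻¹` on finitely supported functions.
  let j : (V →₀ ℂ) →ₗ[ℂ] L2 V := (C : L2 V →ₗ[ℂ] L2 V) ∘ₗ K
  have hj : ∀ f, j f = C (K f) := fun _ => rfl
  have hCj : ∀ f, C (j f) = toL2 f := fun f => by rw [hj, hCC, hRK]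
  have hjd : DenseRange j := (denseRange_of_injective hCsa hCi).comp hKd C.continuous
  have hjn : ∀ f, ‖j f‖ ^ 2 = quadForm (schrodingerMap G (posPot q)) f + normSqFin f := by
    intro f
    rw [← inner_self_eq_norm_sq (𝕜 := ℂ), hj, clm_inner_left hCsa, hCC, hRK, ← inner_conj_symm]
    change (conj (inner ℂ (toL2 f) (K f))).re = _
    rw [Complex.conj_re, hK, re_inner_toL2_finOp, quadForm_schrodingerMap, quadForm_schrodingerMap,
      quadForm_add_one]
    ring
  -- the operator `√q₋ C`
  set σ : V → ℝ := fun x => Real.sqrt (negPot q x) with hσ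
  have hσσ : (fun x => σ x ^ 2) = negPot q := funext fun x => Real.sq_sqrt (negPot_nonneg q x)
  let J := finOp (mulMap σ) (isLocalSymm_mulMap σ)
  have hJn : ∀ f, ‖J f‖ ^ 2 = quadForm (mulMap (negPot q)) f := fun f => by
    rw [norm_finOp_mulMap_sq, hσσ]
  have hJb : ∀ f, ‖J f‖ ≤ c * ‖j f‖ := by
    intro f
    rw [← sq_le_sq₀ (norm_nonneg _) (by positivity), mul_pow, hJn, hjn]
    have h1 := hC f
    have h2 : 0 ≤ quadForm (schrodingerMap G (posPot q)) f := by
      rw [quadForm_schrodingerMap]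
      exact add_nonneg (energy_nonneg f) (quadForm_mulMap_nonneg (posPot_nonneg q) f)
    have h3 := normSqFin_nonneg f
    have h4 : 1 ≤ c ^ 2 := by nlinarith
    have h5 : C₀ ≤ c ^ 2 := by nlinarith
    nlinarith
  let D : L2 V →L[ℂ] L2 V := J.extendOfNorm j
  have hDj : ∀ f, D (j f) = J f := LinearMap.extendOfNorm_eq hjd ⟨c, hJb⟩
  have hDx : ∀ k x, D k x = (σ x : ℂ) * C k x := by
    intro k x
    refine hjd.induction_on (p := fun k => D k x = (σ x : ℂ) * C k x) k
      (isClosed_eq ((continuous_eval x).comp D.continuous)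
        (continuous_const.mul ((continuous_eval x).comp C.continuous))) fun f => ?_
    rw [hDj, hCj]
    rfl
  -- the coercive operator
  let A : L2 V →L[ℂ] L2 V := 1 - R - ContinuousLinearMap.adjoint D * D
  let M : L2 V →L[ℂ] L2 V := A + (c : ℂ) • R
  have hAinner : ∀ k l, inner ℂ k (A l) = inner ℂ k l - inner ℂ k (R l) - inner ℂ (D k) (D l) := by
    intro k l
    change inner ℂ k (l - R l - ContinuousLinearMap.adjoint D (D l)) = _
    rw [inner_sub_right, inner_sub_right, ContinuousLinearMap.adjoint_inner_right]
  have hRsa : IsSelfAdjoint R := IsSelfAdjoint.of_nonneg hR0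
  have hMsa : IsSelfAdjoint M := by
    refine IsSelfAdjoint.add (IsSelfAdjoint.sub ((IsSelfAdjoint.one _).sub hRsa) ?_) ?_
    · rw [ContinuousLinearMap.isSelfAdjoint_iff_isSymmetric]
      intro x y
      change inner ℂ (ContinuousLinearMap.adjoint D (D x)) y =
        inner ℂ x (ContinuousLinearMap.adjoint D (D y))
      rw [ContinuousLinearMap.adjoint_inner_left, ContinuousLinearMap.adjoint_inner_right]
    · exact IsSelfAdjoint.smul (by rw [isSelfAdjoint_iff, Complex.star_def, Complex.conj_ofReal]) hRsa
  have hform : ∀ f, (inner ℂ (j f) (M (j f))).re =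
      quadForm (schrodingerMap G q) f + c * normSqFin f := by
    intro f
    change (inner ℂ (j f) (A (j f) + (c : ℂ) • R (j f))).re = _
    have h1 : inner ℂ (j f) (R (j f)) = inner ℂ (toL2 f) (toL2 f) := by
      rw [← hCC, ← clm_inner_left hCsa, hCj]
    have hn : ∀ u : L2 V, (inner ℂ u u).re = ‖u‖ ^ 2 := fun u => inner_self_eq_norm_sq (𝕜 := ℂ) u
    rw [inner_add_right, hAinner, inner_smul_right, h1, Complex.add_re, Complex.sub_re,
      Complex.sub_re, Complex.re_ofReal_mul, hn, hn, hn, hDj, hJn, norm_toL2_sq, hjn,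
      quadForm_schrodingerMap, quadForm_schrodingerMap, quadForm_eq_posPot_sub q]
    ring
  -- The hypothesis costs half of the form of `Δ + q₊` and `C₀‖f‖²`; the shift leaves half the
  -- squared norm of `j f`.
  have hcoer : ∀ k, 1 / 2 * ‖k‖ ^ 2 ≤ (inner ℂ k (M k)).re := by
    intro k
    refine hjd.induction_on (p := fun k => 1 / 2 * ‖k‖ ^ 2 ≤ (inner ℂ k (M k)).re) k
      (isClosed_le (by fun_prop) (by fun_prop)) fun f => ?_
    rw [hform, hjn]
    have h1 := hC f
    have h3 := normSqFin_nonneg f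
    rw [quadForm_schrodingerMap] at h1 ⊢
    rw [quadForm_schrodingerMap, quadForm_eq_posPot_sub q]
    nlinarith
  obtain ⟨N, hMN, hNM⟩ := exists_inverse_of_coercive hMsa hcoer
  refine ⟨C, M, N, j, ⟨hCsa, hCi, hMsa, hMN, hcoer, hjd, hCj, hform⟩, ?_⟩
  -- identification of the form sum
  have hS : posSqrt (maxOp (schrodingerMap G (posPot q))) = quotOp C s := by
    rw [maxOp_schrodingerMap_eq (posPot_nonneg q) hR, hSqrt]
  have hT : posSqrt (mulOp (negPot q)) = mulOp σ := posSqrt_mulOp (negPot_nonneg q)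
  have hgraph : ∀ k, (C k, D k) ∈ (mulOp σ).graph := fun k => by
    rw [mulOp, mem_graph_maxOp]
    funext x
    exact (hDx k x).symm
  have hdomC : ∀ k, C k ∈ (quotOp C s).domain := fun k => mem_quotOp_domain k
  have hdomσ : ∀ k, C k ∈ (mulOp σ).domain := fun k => LinearPMap.mem_domain_of_mem_graph (hgraph k)
  have hvalS : ∀ k (h : C k ∈ (quotOp C s).domain), quotOp C s ⟨C k, h⟩ = s k := fun k h =>
    quotOp_apply hCi k h
  have hvalσ : ∀ k (h : C k ∈ (mulOp σ).domain), mulOp σ ⟨C k, h⟩ = D k := fun k h =>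
    LinearPMap.mem_graph_snd_inj _ ((mulOp σ).mem_graph ⟨C k, h⟩) (hgraph k) rfl
  -- The left side is the weak equation defining the form sum on `φ = C k`; the right side says `φ =
  -- C N C (g + c φ)`.
  have hMA : ∀ k g, A k = C g ↔ M k = C (g + (c : ℂ) • C k) := by
    intro k g
    change _ ↔ A k + (c : ℂ) • R k = _
    rw [map_add, map_smul, hCC, add_left_inj]
  rw [schrodinger, formDiff, hS, hT, invSubOp]
  conv_rhs => rw [quotOp]
  congr 1
  ext ⟨φ, ψ⟩
  constructor
  · rintro ⟨hφ, hφ', hall⟩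
    have hφr := hφ
    rw [quotOp_domain] at hφr
    obtain ⟨k, hk⟩ := hφr
    simp only [ContinuousLinearMap.coe_coe] at hk
    subst hk
    have hAk : A k = C ψ := by
      apply ext_inner_left ℂ
      intro l
      have h1 := hall (C l) (hdomC l) (hdomσ l)
      rw [hvalS, hvalS, hvalσ, hvalσ, clm_inner_left hssa, hss, clm_inner_left hCsa] at h1
      rw [← h1, hAinner, inner_sub_right]
    have hMk := (hMA k ψ).1 hAk
    have hk : k = N (C (ψ + (c : ℂ) • C k)) := by
      rw [← hMk]
      exact (DFunLike.congr_fun hNM k).symm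
    refine ⟨ψ + (c : ℂ) • C k, ?_⟩
    have h2 : (C * N * C) (ψ + (c : ℂ) • C k) = C k := by
      change C (N (C (ψ + (c : ℂ) • C k))) = C k
      rw [← hk]
    rw [LinearMap.prod_apply, Function.prod_apply, ContinuousLinearMap.coe_coe,
      ContinuousLinearMap.coe_coe, sub_apply, smul_apply, h2, one_apply_eq_self,
      add_sub_cancel_right]
  · rintro ⟨h, hh⟩
    rw [LinearMap.prod_apply, Function.prod_apply, ContinuousLinearMap.coe_coe,
      ContinuousLinearMap.coe_coe, Prod.mk.injEq] at hh
    obtain ⟨rfl, rfl⟩ := hh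
    set k := N (C h) with hk
    have hBh : (C * N * C) h = C k := rfl
    have hMk : M k = C h := DFunLike.congr_fun hMN (C h)
    have hψ : (1 - (c : ℂ) • (C * N * C)) h = h - (c : ℂ) • C k := rfl
    have hAk : A k = C (h - (c : ℂ) • C k) := by
      rw [hMA, sub_add_cancel]
      exact hMk
    rw [hBh, hψ]
    refine ⟨hdomC k, hdomσ k, fun u h₁ h₂ => ?_⟩
    have hur := h₁
    rw [quotOp_domain] at hur
    obtain ⟨l, rfl⟩ := hur
    change inner ℂ (quotOp C s ⟨C l, h₁⟩) (quotOp C s ⟨C k, _⟩) -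
      inner ℂ (mulOp σ ⟨C l, h₂⟩) (mulOp σ ⟨C k, _⟩) = inner ℂ (C l) _
    rw [hvalS, hvalS, hvalσ, hvalσ, clm_inner_left hssa, hss, clm_inner_left hCsa, ← hAk, hAinner,
      inner_sub_right]

/-- Here `C` is multiplication by `(g + c)^(-1/2)`, and the shifted form is simply `‖k‖²`. -/
theorem exists_isFormRep_mulOp {g : V → ℝ} {c : ℝ} (hg : ∀ x, 1 ≤ g x + c) :
    ∃ C M N j, IsFormRep C M N j (fun f => quadForm (mulMap g) f + c * normSqFin f) ∧
      C * N * C = mulCLM (fun x => (g x + c)⁻¹) := by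
  set r : V → ℝ := fun x => Real.sqrt (g x + c) with hr
  have hr1 : ∀ x, 1 ≤ r x := fun x => Real.one_le_sqrt.2 (hg x)
  have hr0 : ∀ x, r x ≠ 0 := fun x => by linarith [hr1 x]
  have hb : ∀ x, |(r x)⁻¹| ≤ 1 := fun x => by
    rw [abs_of_nonneg (inv_nonneg.2 (by linarith [hr1 x]))]
    exact inv_le_one_of_one_le₀ (hr1 x)
  have hrr : ∀ x, r x ^ 2 = g x + c := fun x => Real.sq_sqrt (by linarith [hg x])
  refine ⟨mulCLM fun x => (r x)⁻¹, 1, 1, finOp (mulMap r) (isLocalSymm_mulMap r),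
    ⟨isSelfAdjoint_mulCLM hb, injective_mulCLM hb fun x => inv_ne_zero (hr0 x), IsSelfAdjoint.one _,
      mul_one 1, fun k => ?_, ?_, fun f => ?_, fun f => ?_⟩, ?_⟩
  · rw [one_apply_eq_self]
    have : (inner ℂ k k).re = ‖k‖ ^ 2 := inner_self_eq_norm_sq (𝕜 := ℂ) k
    rw [this]
    linarith [sq_nonneg ‖k‖]
  · refine denseRange_finOp _ fun u hu => ?_
    ext x
    have h1 : (r x : ℂ) * u x = 0 := congrFun hu x
    exact (mul_eq_zero.1 h1).resolve_left (Complex.ofReal_ne_zero.2 (hr0 x))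
  · ext x
    rw [mulCLM_apply hb, finOp_coe]
    change (((r x)⁻¹ : ℝ) : ℂ) * ((r x : ℂ) * f x) = f x
    rw [Complex.ofReal_inv, inv_mul_cancel_left₀ (Complex.ofReal_ne_zero.2 (hr0 x))]
  · rw [one_apply_eq_self]
    have : ∀ u : L2 V, (inner ℂ u u).re = ‖u‖ ^ 2 := fun u => inner_self_eq_norm_sq (𝕜 := ℂ) u
    rw [this, norm_finOp_mulMap_sq, quadForm_mulMap, quadForm_mulMap, normSqFin, Finset.mul_sum,
      ← Finset.sum_add_distrib]
    refine Finset.sum_congr rfl fun x _ => ?_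
    rw [hrr]
    ring
  · rw [mul_one, mulCLM_mul hb hb]
    congr 1
    funext x
    rw [← mul_inv, ← sq, hrr]

end FormRepresentation
-- Factorization and eigenvalue bounds for bounded operators
section Comparison

variable {H : Type*} [NormedAddCommGroup H] [InnerProductSpace ℂ H] [CompleteSpace H]

/-- Douglas' factorization for self-adjoint operators. -/
theorem exists_factorization {P Q : H →L[ℂ] H} (hP : IsSelfAdjoint P) (hQ : IsSelfAdjoint Q)
    (hQi : Function.Injective Q) {K : ℝ} (h : ∀ x, ‖P x‖ ≤ K * ‖Q x‖) :
    ∃ X Z : H →L[ℂ] H, (∀ x, X (Q x) = P x) ∧ ∀ x, Q (Z x) = P x := by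
  have hd : DenseRange (Q : H →ₗ[ℂ] H) := denseRange_of_injective hQ hQi
  let X : H →L[ℂ] H := (P : H →ₗ[ℂ] H).extendOfNorm (Q : H →ₗ[ℂ] H)
  have hX : ∀ x, X (Q x) = P x :=
    LinearMap.extendOfNorm_eq (f := (P : H →ₗ[ℂ] H)) (e := (Q : H →ₗ[ℂ] H)) hd ⟨K, h⟩
  refine ⟨X, ContinuousLinearMap.adjoint X, hX, fun x => ?_⟩
  apply ext_inner_left ℂ
  intro y
  rw [← clm_inner_left hQ, ContinuousLinearMap.adjoint_inner_right, hX, clm_inner_left hP]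

theorem range_le_of_norm_le {P Q : H →L[ℂ] H} (hP : IsSelfAdjoint P) (hQ : IsSelfAdjoint Q)
    (hQi : Function.Injective Q) {K : ℝ} (h : ∀ x, ‖P x‖ ≤ K * ‖Q x‖) :
    LinearMap.range (P : H →ₗ[ℂ] H) ≤ LinearMap.range (Q : H →ₗ[ℂ] H) := by
  obtain ⟨_, Z, -, hZ⟩ := exists_factorization hP hQ hQi h
  rintro _ ⟨x, rfl⟩
  exact ⟨Z x, hZ x⟩

theorem isCompactOperator_of_norm_le {P Q : H →L[ℂ] H} (hP : IsSelfAdjoint P)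
    (hQ : IsSelfAdjoint Q) (hQi : Function.Injective Q) {K : ℝ} (h : ∀ x, ‖P x‖ ≤ K * ‖Q x‖)
    (hK : IsCompactOperator Q) : IsCompactOperator P := by
  obtain ⟨X, -, hX, -⟩ := exists_factorization hP hQ hQi h
  have : P = X ∘L Q := by
    ext x
    exact (hX x).symm
  rw [this]
  exact hK.clm_comp X

/-- In the eigenbasis expansion the coefficients below `n` vanish, and the remaining eigenvalues of
`B` are at most `β n`. -/
theorem re_inner_le_of_orthogonal {B : H →L[ℂ] H} (hB : IsSelfAdjoint B) {e : ℕ → H}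
    (he : Orthonormal ℂ e) (htot : ∀ x, (∀ i, inner ℂ (e i) x = 0) → x = 0) {β : ℕ → ℝ}
    (hβ : ∀ n, B (e n) = (β n : ℂ) • e n) (hpos : ∀ n, 0 < β n)
    (hanti : Monotone fun n => (β n)⁻¹) {n : ℕ} {x : H} (hx : ∀ m < n, inner ℂ (e m) x = 0) :
    (inner ℂ x (B x)).re ≤ β n * ‖x‖ ^ 2 := by
  have hsp : (Submodule.span ℂ (Set.range e))ᗮ = ⊥ := by
    rw [Submodule.eq_bot_iff]
    intro y hy
    exact htot y fun i => (Submodule.mem_orthogonal _ _).1 hy _ (Submodule.subset_span ⟨i, rfl⟩)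
  let b := HilbertBasis.mkOfOrthogonalEqBot he hsp
  have hb : ∀ i, b i = e i := fun i => by
    rw [HilbertBasis.coe_mkOfOrthogonalEqBot]
  have h1 := b.hasSum_inner_mul_inner x (B x)
  have h2 := (b.hasSum_inner_mul_inner x x).mul_left (β n : ℂ)
  have h1' := Complex.hasSum_re h1
  have h2' := Complex.hasSum_re h2
  have hxx : (inner ℂ x x).re = ‖x‖ ^ 2 := inner_self_eq_norm_sq (𝕜 := ℂ) x
  rw [Complex.re_ofReal_mul, hxx] at h2'
  refine hasSum_le (fun i => ?_) h1' h2'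
  have h3 : inner ℂ (e i) (B x) = (β i : ℂ) * inner ℂ (e i) x := by
    rw [← clm_inner_left hB, hβ, inner_smul_left, Complex.conj_ofReal]
  rw [hb, h3]
  have h4 : inner ℂ x (e i) * inner ℂ (e i) x = ((‖inner ℂ (e i) x‖ ^ 2 : ℝ) : ℂ) := by
    rw [← inner_conj_symm, mul_comm, Complex.mul_conj, Complex.normSq_eq_norm_sq]
  have h5 : inner ℂ x (e i) * ((β i : ℂ) * inner ℂ (e i) x) =
      (β i : ℂ) * (inner ℂ x (e i) * inner ℂ (e i) x) := by ring
  rw [h5, h4, Complex.re_ofReal_mul, Complex.re_ofReal_mul, Complex.ofReal_re]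
  by_cases hin : i < n
  · rw [hx i hin]
    simp
  · refine mul_le_mul_of_nonneg_right ?_ (by positivity)
    exact (inv_le_inv₀ (hpos n) (hpos i)).1 (hanti (not_lt.1 hin))

end Comparison

/-! ### Consequences of form comparison -/

section FormRepresentation

variable {V : Type*} {C M N : L2 V →L[ℂ] L2 V} {j : (V →₀ ℂ) →ₗ[ℂ] L2 V} {t : (V →₀ ℂ) → ℝ}

namespace IsFormRep

theorem apply_inv (h : IsFormRep C M N j t) (x : L2 V) : M (N x) = x :=
  DFunLike.congr_fun h.mul_inv x

theorem inner_apply (h : IsFormRep C M N j t) (x y : L2 V) :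
    inner ℂ x ((C * N * C) y) = inner ℂ (N (C x)) (M (N (C y))) := by
  change inner ℂ x (C (N (C y))) = _
  rw [← clm_inner_left h.root_selfAdjoint, ← clm_inner_left h.selfAdjoint, h.apply_inv]

theorem nonneg (h : IsFormRep C M N j t) : 0 ≤ C * N * C := by
  refine isPositive_of_symm (fun x y => ?_) fun x => ?_
  · rw [h.inner_apply, ← inner_conj_symm, h.inner_apply, inner_conj_symm,
      clm_inner_left h.selfAdjoint]
  · rw [h.inner_apply]
    exact le_trans (by positivity) (h.coercive _)

theorem injective (h : IsFormRep C M N j t) : Function.Injective (C * N * C) := by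
  intro x y hxy
  have h1 : M (N (C x)) = M (N (C y)) := congrArg M (h.root_injective hxy)
  rw [h.apply_inv, h.apply_inv] at h1
  exact h.root_injective h1

/-- Here `‖S x‖² = ⟨C x, N C x⟩`, comparable to `‖C x‖²` because `M` is bounded and coercive. So
`B^(1/2)` and `C` have the same range and are compact together. -/
theorem exists_root_bounds (h : IsFormRep C M N j t) {S : L2 V →L[ℂ] L2 V} (hS : IsSelfAdjoint S)
    (hSS : S * S = C * N * C) :
    (∀ x, ‖S x‖ ≤ (‖N‖ + 1) * ‖C x‖) ∧ ∀ x, ‖C x‖ ≤ 2 * ‖M‖ * ‖S x‖ := by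
  have hsq : ∀ x, ‖S x‖ ^ 2 = (inner ℂ x ((C * N * C) x)).re := fun x => by
    rw [← hSS, ← inner_self_eq_norm_sq (𝕜 := ℂ), clm_inner_left hS]
    rfl
  refine ⟨fun x => ?_, fun x => ?_⟩
  · rw [← sq_le_sq₀ (norm_nonneg _) (by positivity), hsq, h.inner_apply, h.apply_inv]
    have h1 := re_inner_le_norm (𝕜 := ℂ) (N (C x)) (C x)
    have h2 := N.le_opNorm (C x)
    have h3 := norm_nonneg (C x)
    have h4 := norm_nonneg N
    calc _ ≤ ‖N (C x)‖ * ‖C x‖ := h1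
      _ ≤ ‖N‖ * ‖C x‖ * ‖C x‖ := mul_le_mul_of_nonneg_right h2 h3
      _ ≤ _ := by nlinarith [mul_nonneg h3 h3, mul_nonneg h4 (mul_nonneg h3 h3)]
  · have h1 : ‖N (C x)‖ ≤ 2 * ‖S x‖ := by
      rw [← sq_le_sq₀ (norm_nonneg _) (by positivity), mul_pow, hsq, h.inner_apply]
      have := h.coercive (N (C x))
      nlinarith [sq_nonneg ‖N (C x)‖]
    have h2 := M.le_opNorm (N (C x))
    rw [h.apply_inv] at h2
    calc _ ≤ ‖M‖ * ‖N (C x)‖ := h2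
      _ ≤ ‖M‖ * (2 * ‖S x‖) := mul_le_mul_of_nonneg_left h1 (norm_nonneg _)
      _ = _ := by ring

theorem formDomain_eq (h : IsFormRep C M N j t) (c : ℝ) :
    formDomain (invSubOp (C * N * C) c) = LinearMap.range (C : L2 V →ₗ[ℂ] L2 V) := by
  obtain ⟨S, hS, hSi, hSS, hdom, -⟩ := exists_root_invSubOp h.nonneg h.injective c
  obtain ⟨h1, h2⟩ := h.exists_root_bounds hS hSS
  rw [hdom]
  exact le_antisymm (range_le_of_norm_le hS h.root_selfAdjoint h.root_injective h1)
    (range_le_of_norm_le h.root_selfAdjoint hS hSi h2)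

theorem isCompactOperator_root (h : IsFormRep C M N j t) {c : ℝ}
    (hd : HasPurelyDiscreteSpectrum (invSubOp (C * N * C) c)) : IsCompactOperator C := by
  obtain ⟨S, hS, hSi, hSS, -, hc⟩ := exists_root_invSubOp h.nonneg h.injective c
  exact isCompactOperator_of_norm_le h.root_selfAdjoint hS hSi (h.exists_root_bounds hS hSS).2
    (hc hd)

theorem isCompactOperator (h : IsFormRep C M N j t) {c : ℝ}
    (hd : HasPurelyDiscreteSpectrum (invSubOp (C * N * C) c)) : IsCompactOperator (C * N * C) :=
  (h.isCompactOperator_root hd).clm_comp (C * N)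

variable {C' M' N' : L2 V →L[ℂ] L2 V} {j' : (V →₀ ℂ) →ₗ[ℂ] L2 V} {t' : (V →₀ ℂ) → ℝ}

/-- The inclusion of form domains in bounded coordinates: the inequality makes `j' f ↦ j f` bounded
on a dense set, and both vectors represent the same `f`. -/
theorem exists_embedding (h : IsFormRep C M N j t) (h' : IsFormRep C' M' N' j' t') {κ r : ℝ}
    (hκ : 0 ≤ κ) (hr : 0 ≤ r) (ht : ∀ f, t f ≤ κ * t' f + r * normSqFin f) :
    ∃ Y : L2 V →L[ℂ] L2 V, (∀ k, C (Y k) = C' k) ∧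
      ∀ k, (inner ℂ (Y k) (M (Y k))).re ≤ κ * (inner ℂ k (M' k)).re + r * ‖C' k‖ ^ 2 := by
  -- This constant satisfies `t f ≤ L ‖j' f‖²`; coercivity doubles it, and `2L ≤ (2L + 1)²`.
  set L := κ * ‖M'‖ + r * ‖C'‖ ^ 2 with hL
  have hL0 : 0 ≤ L := by positivity
  have hn : ∀ f, ‖C' (j' f)‖ ^ 2 = normSqFin f := fun f => by
    rw [h'.root_apply, norm_toL2_sq]
  have hb : ∀ f, ‖j f‖ ≤ (2 * L + 1) * ‖j' f‖ := by
    intro f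
    rw [← sq_le_sq₀ (norm_nonneg _) (by positivity), mul_pow]
    have h1 := h.coercive (j f)
    rw [h.form] at h1
    have h2 : t' f ≤ ‖M'‖ * ‖j' f‖ ^ 2 := by
      rw [← h'.form]
      calc _ ≤ ‖j' f‖ * ‖M' (j' f)‖ := re_inner_le_norm (𝕜 := ℂ) _ _
        _ ≤ ‖j' f‖ * (‖M'‖ * ‖j' f‖) :=
          mul_le_mul_of_nonneg_left (M'.le_opNorm _) (norm_nonneg _)
        _ = _ := by ring
    have h3 : normSqFin f ≤ ‖C'‖ ^ 2 * ‖j' f‖ ^ 2 := by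
      rw [← hn, ← mul_pow]
      exact pow_le_pow_left₀ (norm_nonneg _) (C'.le_opNorm _) 2
    have h4 : t f ≤ L * ‖j' f‖ ^ 2 := by
      have e1 := mul_le_mul_of_nonneg_left h2 hκ
      have e2 := mul_le_mul_of_nonneg_left h3 hr
      have := ht f
      rw [hL]
      linarith
    nlinarith [sq_nonneg ‖j' f‖, mul_nonneg hL0 (sq_nonneg ‖j' f‖),
      mul_nonneg (mul_nonneg hL0 hL0) (sq_nonneg ‖j' f‖)]
  let Y : L2 V →L[ℂ] L2 V := j.extendOfNorm j'
  have hY : ∀ f, Y (j' f) = j f := LinearMap.extendOfNorm_eq h'.dense ⟨_, hb⟩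
  refine ⟨Y, fun k => ?_, fun k => ?_⟩
  · refine h'.dense.induction_on (p := fun k => C (Y k) = C' k) k
      (isClosed_eq (by fun_prop) (by fun_prop)) fun f => ?_
    rw [hY, h.root_apply, h'.root_apply]
  · refine h'.dense.induction_on (p := fun k => (inner ℂ (Y k) (M (Y k))).re ≤
      κ * (inner ℂ k (M' k)).re + r * ‖C' k‖ ^ 2) k
      (isClosed_le (by fun_prop) (by fun_prop)) fun f => ?_
    rw [hY, h.form, h'.form, hn]
    exact ht f

theorem range_le (h : IsFormRep C M N j t) (h' : IsFormRep C' M' N' j' t') {κ r : ℝ}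
    (hκ : 0 ≤ κ) (hr : 0 ≤ r) (ht : ∀ f, t f ≤ κ * t' f + r * normSqFin f) :
    LinearMap.range (C' : L2 V →ₗ[ℂ] L2 V) ≤ LinearMap.range (C : L2 V →ₗ[ℂ] L2 V) := by
  obtain ⟨Y, hY, -⟩ := h.exists_embedding h' hκ hr ht
  rintro _ ⟨k, rfl⟩
  exact ⟨Y k, hY k⟩

theorem hasPurelyDiscreteSpectrum (h : IsFormRep C M N j t) (h' : IsFormRep C' M' N' j' t')
    {κ r : ℝ} (hκ : 0 ≤ κ) (hr : 0 ≤ r) (ht : ∀ f, t f ≤ κ * t' f + r * normSqFin f) {c : ℝ}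
    (hd : HasPurelyDiscreteSpectrum (invSubOp (C * N * C) c)) :
    HasPurelyDiscreteSpectrum (invSubOp (C' * N' * C') c) := by
  obtain ⟨Y, hY, -⟩ := h.exists_embedding h' hκ hr ht
  have hC' : C' = C ∘L Y := by
    ext1 k
    exact (hY k).symm
  have hc : IsCompactOperator C' := by
    rw [hC']
    exact (h.isCompactOperator_root hd).comp_clm Y
  exact hasPurelyDiscreteSpectrum_of_isCompactOperator h'.nonneg h'.injective
    (hc.clm_comp (C' * N')) c

/-- The min-max comparison of the eigenvalues of two comparable forms. -/
theorem inv_eigenvalue_le (h : IsFormRep C M N j t) (h' : IsFormRep C' M' N' j' t') {κ r : ℝ}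
    (hκ : 0 ≤ κ) (hr : 0 ≤ r) (ht : ∀ f, t f ≤ κ * t' f + r * normSqFin f)
    {e e' : ℕ → L2 V} {β β' : ℕ → ℝ} (he : Orthonormal ℂ e)
    (htot : ∀ x, (∀ i, inner ℂ (e i) x = 0) → x = 0)
    (hβ : ∀ n, (C * N * C) (e n) = (β n : ℂ) • e n) (hpos : ∀ n, 0 < β n)
    (hanti : Monotone fun n => (β n)⁻¹) (he' : Orthonormal ℂ e')
    (hβ' : ∀ n, (C' * N' * C') (e' n) = (β' n : ℂ) • e' n) (hpos' : ∀ n, 0 < β' n)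
    (hanti' : Monotone fun n => (β' n)⁻¹) (n : ℕ) : (β n)⁻¹ ≤ κ * (β' n)⁻¹ + r := by
  obtain ⟨Y, hY, hform⟩ := h.exists_embedding h' hκ hr ht
  -- a vector in the span of the first `n + 1` vectors `e'`, orthogonal to the first `n` vectors `e`
  let A : Matrix (Fin n) (Fin (n + 1)) ℂ := fun m i => inner ℂ (e m) (e' i)
  obtain ⟨a, ha, ha0⟩ := Submodule.exists_mem_ne_zero_of_ne_bot
    (LinearMap.ker_ne_bot_of_finrank_lt (f := A.mulVecLin) (by simp))
  rw [LinearMap.mem_ker, Matrix.mulVecLin_apply] at ha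
  have he'' : Orthonormal ℂ fun i : Fin (n + 1) => e' i := he'.comp _ Fin.val_injective
  set φ : L2 V := ∑ i, a i • e' i with hφ
  -- A preimage of `φ` under `C' N' C'`, which places `φ` in the form domain with an explicit
  -- representative.
  set g : L2 V := ∑ i, (a i * (β' i : ℂ)⁻¹) • e' i with hg
  have horth : ∀ m < n, inner ℂ (e m) φ = 0 := by
    intro m hm
    have h1 := congrFun ha ⟨m, hm⟩
    rw [hφ, inner_sum]
    simp only [inner_smul_right]
    rw [Pi.zero_apply, Matrix.mulVec, dotProduct] at h1
    rw [← h1]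
    exact Finset.sum_congr rfl fun i _ => mul_comm _ _
  have hBg : (C' * N' * C') g = φ := by
    rw [hg, map_sum]
    refine Finset.sum_congr rfl fun i _ => ?_
    rw [map_smul, hβ', smul_smul, inv_mul_cancel_right₀]
    exact_mod_cast (hpos' i).ne'
  have hnorm : ‖φ‖ ^ 2 = ∑ i, ‖a i‖ ^ 2 := by
    have h1 : inner ℂ φ φ = ∑ i, conj (a i) * a i := he''.inner_sum a a Finset.univ
    rw [← inner_self_eq_norm_sq (𝕜 := ℂ)]
    change (inner ℂ φ φ).re = _
    rw [h1, Complex.re_sum]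
    refine Finset.sum_congr rfl fun i _ => ?_
    rw [← Complex.normSq_eq_conj_mul_self, Complex.ofReal_re, Complex.normSq_eq_norm_sq]
  have hφpos : 0 < ‖φ‖ ^ 2 := by
    obtain ⟨i, hi⟩ := Function.ne_iff.1 ha0
    rw [hnorm]
    refine Finset.sum_pos' (fun i _ => by positivity) ⟨i, Finset.mem_univ i, ?_⟩
    have : 0 < ‖a i‖ := norm_pos_iff.2 hi
    positivity
  set k' := N' (C' g) with hk'
  have hCk' : C' k' = φ := hBg
  have hupper : (inner ℂ k' (M' k')).re ≤ (β' n)⁻¹ * ‖φ‖ ^ 2 := by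
    rw [h'.apply_inv, ← clm_inner_left h'.root_selfAdjoint, hCk']
    have h1 : inner ℂ φ g = ∑ i, conj (a i) * (a i * (β' i : ℂ)⁻¹) :=
      he''.inner_sum a (fun i => a i * (β' i : ℂ)⁻¹) Finset.univ
    rw [h1, Complex.re_sum, hnorm, Finset.mul_sum]
    refine Finset.sum_le_sum fun i _ => ?_
    rw [← mul_assoc, ← Complex.normSq_eq_conj_mul_self, ← Complex.ofReal_inv, ← Complex.ofReal_mul,
      Complex.ofReal_re, Complex.normSq_eq_norm_sq, mul_comm]
    exact mul_le_mul_of_nonneg_right (hanti' (Nat.lt_succ_iff.1 i.2)) (by positivity)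
  set k := Y k' with hk
  have hCk : C k = φ := by rw [hk, hY, hCk']
  -- As `φ` may only lie in the form domain of the first operator, its eigenbasis is not applied to
  -- the form directly. Positivity of `M` on `k - s N C φ`, with `s = (β n)⁻¹`, gives `t(φ) ≥ 2s‖φ‖²
  -- - s²⟨φ, B φ⟩`, and the last term is at most `s‖φ‖²`.
  have hlower : (β n)⁻¹ * ‖φ‖ ^ 2 ≤ (inner ℂ k (M k)).re := by
    set l := N (C φ) with hl
    set s := (β n)⁻¹ with hs
    have hMl : M l = C φ := h.apply_inv _
    have h0 : 0 ≤ (inner ℂ (k - (s : ℂ) • l) (M (k - (s : ℂ) • l))).re :=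
      le_trans (by positivity) (h.coercive _)
    have hφφ : (inner ℂ φ φ).re = ‖φ‖ ^ 2 := inner_self_eq_norm_sq (𝕜 := ℂ) φ
    have h1 : inner ℂ k (M l) = inner ℂ φ φ := by
      rw [hMl, ← clm_inner_left h.root_selfAdjoint, hCk]
    have h2 : inner ℂ l (M k) = inner ℂ φ φ := by
      rw [← clm_inner_left h.selfAdjoint, hMl, clm_inner_left h.root_selfAdjoint, hCk]
    have h3 : inner ℂ l (M l) = inner ℂ φ ((C * N * C) φ) := (h.inner_apply φ φ).symm
    have h4 := re_inner_le_of_orthogonal (IsSelfAdjoint.of_nonneg h.nonneg) he htot hβ hpos hanti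
      horth
    rw [map_sub, map_smul, inner_sub_left, inner_sub_right, inner_sub_right, inner_smul_left,
      inner_smul_left, inner_smul_right, inner_smul_right, h1, h2, h3, Complex.conj_ofReal,
      Complex.sub_re, Complex.sub_re, Complex.sub_re, Complex.re_ofReal_mul, Complex.re_ofReal_mul,
      Complex.re_ofReal_mul, hφφ] at h0
    have h5 : s * (s * (inner ℂ φ ((C * N * C) φ)).re) ≤ s * ‖φ‖ ^ 2 := by
      have hs0 : 0 < s := inv_pos.2 (hpos n)
      refine mul_le_mul_of_nonneg_left ?_ hs0.le
      refine (mul_le_mul_of_nonneg_left h4 hs0.le).trans_eq ?_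
      rw [hs, inv_mul_cancel_left₀ (hpos n).ne']
    linarith
  have h6 := hform k'
  rw [hCk'] at h6
  have h7 : (β n)⁻¹ * ‖φ‖ ^ 2 ≤ (κ * (β' n)⁻¹ + r) * ‖φ‖ ^ 2 := by
    have := mul_le_mul_of_nonneg_left hupper hκ
    linarith
  exact le_of_mul_le_mul_right h7 hφpos

end IsFormRep

end FormRepresentation
-- Multiplication by a function growing at infinity
section DiscreteSpectrum

variable {V : Type*}

open scoped Classical in
/-- The unit mass at a vertex. -/
noncomputable def unitMass (x : V) : L2 V := lp.single 2 x 1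

theorem inner_unitMass (x : V) (u : L2 V) : inner ℂ (unitMass x) u = u x := by
  classical
  rw [unitMass, lp.inner_single_left, RCLike.inner_apply, map_one, mul_one]

theorem unitMass_self (x : V) : unitMass x x = 1 := by
  classical
  rw [unitMass, lp.single_apply_self]

theorem unitMass_of_ne {x y : V} (h : y ≠ x) : unitMass x y = 0 := by
  classical
  rw [unitMass, lp.single_apply_ne _ _ _ h]

theorem orthonormal_unitMass : Orthonormal ℂ (unitMass : V → L2 V) := by
  classical
  rw [orthonormal_iff_ite]
  intro x y
  rw [inner_unitMass]
  split_ifs with h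
  · rw [h, unitMass_self]
  · exact unitMass_of_ne h

theorem unitMass_total (u : L2 V) (h : ∀ x, inner ℂ (unitMass x) u = 0) : u = 0 := by
  ext x
  rw [← inner_unitMass, h]
  rfl

theorem mulCLM_unitMass {w : V → ℝ} {C : ℝ} (hw : ∀ x, |w x| ≤ C) (x : V) :
    mulCLM w (unitMass x) = (w x : ℂ) • unitMass x := by
  ext y
  rw [mulCLM_apply hw, lp.coeFn_smul, Pi.smul_apply, smul_eq_mul]
  by_cases h : y = x
  · rw [h]
  · rw [unitMass_of_ne h, mul_zero, mul_zero]

theorem not_finiteDimensional_L2 [Infinite V] : ¬ FiniteDimensional ℂ (L2 V) := fun _ =>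
  not_finite_iff_infinite.2 ‹Infinite V›
    (orthonormal_unitMass (V := V)).linearIndependent.finite_of_isNoetherian

/-- Truncating `w` to the finite set where `|w| ≥ ε/2` gives a finite-rank operator within `ε/2` in
norm. -/
theorem isCompactOperator_mulCLM {w : V → ℝ} {C : ℝ} (hw : ∀ x, |w x| ≤ C)
    (hfin : ∀ δ > 0, {x | δ ≤ |w x|}.Finite) : IsCompactOperator (mulCLM w) := by
  classical
  have hcl : IsClosed {A : L2 V →L[ℂ] L2 V | IsCompactOperator A} :=
    isClosed_setOfPred_isCompactOperator
  have hmem : mulCLM w ∈ closure {A : L2 V →L[ℂ] L2 V | IsCompactOperator A} := by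
    rw [Metric.mem_closure_iff]
    intro ε hε
    set S := (hfin (ε / 2) (by positivity)).toFinset with hS
    set v : V → ℝ := fun x => if x ∈ S then w x else 0 with hv
    have hvb : ∀ x, |v x| ≤ C := fun x => by
      rw [hv]
      dsimp only
      split_ifs
      · exact hw x
      · rw [abs_zero]
        exact (abs_nonneg _).trans (hw x)
    refine ⟨mulCLM v, ?_, ?_⟩
    · have : FiniteDimensional ℂ (Submodule.span ℂ (unitMass '' (S : Set V))) :=
        FiniteDimensional.span_of_finite ℂ (S.finite_toSet.image _)
      refine isCompactOperator_of_forall_mem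
        (K := Submodule.span ℂ (unitMass '' (S : Set V))) fun u => ?_
      rw [eq_sum_of_total orthonormal_unitMass unitMass_total S (x := mulCLM v u)]
      · exact Submodule.sum_mem _ fun x hx => Submodule.smul_mem _ _
          (Submodule.subset_span ⟨x, hx, rfl⟩)
      · intro x hx
        rw [inner_unitMass, mulCLM_apply hvb, hv]
        simp [hx]
    · rw [dist_eq_norm]
      refine lt_of_le_of_lt (b := ε / 2) ?_ (by linarith)
      refine ContinuousLinearMap.opNorm_le_bound _ (by positivity) fun u => ?_
      refine norm_le_of_norm_apply_le (by positivity) fun x => ?_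
      rw [sub_apply, lp.coeFn_sub, Pi.sub_apply, mulCLM_apply hw, mulCLM_apply hvb, ← sub_mul,
        norm_mul]
      refine mul_le_mul_of_nonneg_right ?_ (norm_nonneg _)
      rw [← Complex.ofReal_sub, Complex.norm_real, Real.norm_eq_abs, hv]
      dsimp only
      split_ifs with hx
      · rw [sub_self, abs_zero]
        positivity
      · rw [sub_zero]
        by_contra hlt
        exact hx (by simpa [hS] using (not_le.1 hlt).le)
  rwa [hcl.closure_eq] at hmem

theorem liminfAtInfinity_eq_top_iff {g : V → ℝ} :
    liminfAtInfinity g = ⊤ ↔ ∀ K : ℝ, {x | g x ≤ K}.Finite := by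
  rw [liminfAtInfinity]
  constructor
  · intro h K
    have h1 : (K : EReal) < ⨆ W : Finset V, ⨅ x : {x : V // x ∉ W}, ((g x : ℝ) : EReal) := by
      rw [h]
      exact EReal.coe_lt_top K
    obtain ⟨W, hW⟩ := lt_iSup_iff.1 h1
    refine W.finite_toSet.subset fun x hx => ?_
    by_contra hxW
    have h2 := hW.trans_le (iInf_le _ (⟨x, hxW⟩ : {x : V // x ∉ W}))
    exact absurd hx (not_le.2 (EReal.coe_lt_coe_iff.1 h2))
  · intro h
    rw [EReal.eq_top_iff_forall_lt]
    intro K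
    refine lt_of_lt_of_le (EReal.coe_lt_coe_iff.2 (lt_add_one K))
      (le_iSup_of_le (h (K + 1)).toFinset (le_iInf fun x => ?_))
    have := x.2
    rw [Set.Finite.mem_toFinset, Set.mem_ofPred_eq, not_le] at this
    exact EReal.coe_le_coe_iff.2 this.le

/-- The unit masses are orthonormal eigenvectors, so compactness means that `(g + c)⁻¹` exceeds each
positive level only finitely often. -/
theorem isCompactOperator_mulCLM_inv_iff {g : V → ℝ} {c : ℝ} (hg : ∀ x, 1 ≤ g x + c) :
    IsCompactOperator (mulCLM fun x => (g x + c)⁻¹) ↔ liminfAtInfinity g = ⊤ := by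
  have hb : ∀ x, |(g x + c)⁻¹| ≤ 1 := fun x => by
    rw [abs_of_nonneg (inv_nonneg.2 (by linarith [hg x]))]
    exact inv_le_one_of_one_le₀ (hg x)
  have hpos : ∀ x, 0 < g x + c := fun x => by linarith [hg x]
  rw [liminfAtInfinity_eq_top_iff]
  constructor
  · intro h K
    refine (finite_setOf_le_norm_eigenvalue h orthonormal_unitMass (mulCLM_unitMass hb)
      (δ := (max (K + c) 1)⁻¹) (by positivity)).subset fun x hx => ?_
    rw [Set.mem_ofPred_eq] at hx ⊢
    rw [Complex.norm_real, Real.norm_of_nonneg (inv_pos.2 (hpos x)).le]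
    exact inv_anti₀ (hpos x) (le_max_of_le_left (by linarith))
  · intro h
    refine isCompactOperator_mulCLM hb fun δ hδ => (h (δ⁻¹ - c)).subset fun x hx => ?_
    rw [Set.mem_ofPred_eq] at hx ⊢
    rw [abs_of_pos (inv_pos.2 (hpos x))] at hx
    have := (le_inv_comm₀ hδ (hpos x)).1 hx
    linarith

theorem tendsto_div_of_comparison {x y : ℕ → ℝ} (hy : Tendsto y atTop atTop) (c : ℝ)
    (h : ∀ ε : ℝ, 0 < ε → ε < 1 → ∃ k : ℝ, ∀ n, (1 - ε) * y n ≤ x n + k ∧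
      x n ≤ (1 + ε) * y n + k) :
    Tendsto (fun n => (x n - c) / (y n - c)) atTop (𝓝 1) := by
  rw [Metric.tendsto_nhds]
  intro η hη
  obtain ⟨k, hk⟩ := h (min η 1 / 2) (by positivity) (by linarith [min_le_right η 1])
  -- The last threshold says `k + η c < η y / 2`, so `|x - y| ≤ η y / 2 + k` is below `η (y - c)`.
  filter_upwards [hy.eventually_gt_atTop c, hy.eventually_gt_atTop 0,
    hy.eventually_gt_atTop (2 * (k + η * c) / η)] with n h1 h2 h3
  have h4 : 0 < y n - c := by linarith
  rw [div_lt_iff₀ hη] at h3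
  rw [Real.dist_eq, div_sub_one h4.ne', abs_div, abs_of_pos h4, div_lt_iff₀ h4, abs_lt]
  obtain ⟨h5, h6⟩ := hk n
  have h7 : min η 1 / 2 * y n ≤ η / 2 * y n :=
    mul_le_mul_of_nonneg_right (by linarith [min_le_left η 1]) h2.le
  constructor <;> nlinarith

end DiscreteSpectrum
-- Spectral comparison and the theorem
section Main

variable {V : Type*} {G : SimpleGraph V} [G.LocallyFinite] {q : V → ℝ}

theorem InK.one_le_degAdd_add {C : ℝ} (hC : ∀ f : V →₀ ℂ, quadForm (mulMap (negPot q)) f ≤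
      1 / 2 * quadForm (schrodingerMap G (posPot q)) f + C * normSqFin f) (x : V) :
    1 ≤ degAdd G q x + (C + 1) := by
  classical
  have h := InK.degAdd_form_ge hC (Finsupp.single x 1)
  rw [quadForm_mulMap, normSqFin, Finsupp.support_single _ one_ne_zero,
    Finset.sum_singleton, Finset.sum_singleton, Finsupp.single_eq_same, norm_one] at h
  linarith

theorem spectral_comparison {C₀ : ℝ} (hC₀ : 0 ≤ C₀)
    (hC : ∀ f : V →₀ ℂ, quadForm (mulMap (negPot q)) f ≤
      1 / 2 * quadForm (schrodingerMap G (posPot q)) f + C₀ * normSqFin f)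
    (hLU : ∀ ε : ℝ, 0 < ε → ∃ k : ℝ, 0 ≤ k ∧ LowerBound G q ε k ∧ UpperBound G q ε k) :
    formDomain (schrodinger G q) = formDomain (mulOp (degAdd G q)) ∧
      (HasPurelyDiscreteSpectrum (schrodinger G q) ↔ liminfAtInfinity (degAdd G q) = ⊤) ∧
      (HasPurelyDiscreteSpectrum (schrodinger G q) → Infinite V →
        ∃ lam mu : ℕ → ℝ, IsEigenvalueSequence (schrodinger G q) lam ∧
          IsEigenvalueSequence (mulOp (degAdd G q)) mu ∧
          Tendsto (fun n => lam n / mu n) atTop (𝓝 1)) := by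
  have hm := InK.one_le_degAdd_add hC
  obtain ⟨C, M, N, j, h, hT⟩ := exists_isFormRep_schrodinger hC hC₀
  obtain ⟨C', M', N', j', h', hB'⟩ := exists_isFormRep_mulOp hm
  have hT' : mulOp (degAdd G q) = invSubOp (C' * N' * C') (C₀ + 1) := by
    rw [hB', mulOp_eq_invSubOp hm]
  -- Adding the same shift `C₀ + 1` to both forms costs nothing: the surplus `ε (C₀ + 1)‖f‖²` has
  -- the favourable sign, here and in the lower bound.
  have hupper : ∀ ε : ℝ, 0 < ε → ∀ k : ℝ, UpperBound G q ε k → ∀ f : V →₀ ℂ,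
      quadForm (schrodingerMap G q) f + (C₀ + 1) * normSqFin f ≤
        (1 + ε) * (quadForm (mulMap (degAdd G q)) f + (C₀ + 1) * normSqFin f) +
          k * normSqFin f := by
    intro ε hε k hU f
    have h1 := hU f
    have h2 : 0 ≤ ε * ((C₀ + 1) * normSqFin f) :=
      mul_nonneg hε.le (mul_nonneg (by linarith) (normSqFin_nonneg f))
    linarith
  have hlower : ∀ ε : ℝ, 0 < ε → ε < 1 → ∀ k : ℝ, LowerBound G q ε k → ∀ f : V →₀ ℂ,
      quadForm (mulMap (degAdd G q)) f + (C₀ + 1) * normSqFin f ≤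
        (1 - ε)⁻¹ * (quadForm (schrodingerMap G q) f + (C₀ + 1) * normSqFin f) +
          (1 - ε)⁻¹ * k * normSqFin f := by
    intro ε hε hε1 k hL f
    have h1 := hL f
    have h2 : 0 ≤ ε * ((C₀ + 1) * normSqFin f) :=
      mul_nonneg hε.le (mul_nonneg (by linarith) (normSqFin_nonneg f))
    rw [mul_assoc, ← mul_add, le_inv_mul_iff₀ (by linarith)]
    linarith
  obtain ⟨k₀, hk₀, hL₀, hU₀⟩ := hLU (1 / 2) (by norm_num)
  have htU := hupper _ (by norm_num) _ hU₀
  have htL := hlower _ (by norm_num) (by norm_num) _ hL₀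
  have hdisc : HasPurelyDiscreteSpectrum (schrodinger G q) ↔
      HasPurelyDiscreteSpectrum (mulOp (degAdd G q)) := by
    rw [hT, hT']
    exact ⟨h.hasPurelyDiscreteSpectrum h' (by norm_num) hk₀ htU,
      h'.hasPurelyDiscreteSpectrum h (by norm_num) (by positivity) htL⟩
  refine ⟨?_, ?_, fun hd hV => ?_⟩
  · rw [hT, hT', h.formDomain_eq, h'.formDomain_eq]
    exact le_antisymm (h'.range_le h (by norm_num) (by positivity) htL)
      (h.range_le h' (by norm_num) hk₀ htU)
  · rw [hdisc, ← isCompactOperator_mulCLM_inv_iff hm, ← hB', hT']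
    exact ⟨h'.isCompactOperator, fun hK =>
      hasPurelyDiscreteSpectrum_of_isCompactOperator h'.nonneg h'.injective hK _⟩
  · have hd' := hdisc.1 hd
    rw [hT] at hd
    rw [hT'] at hd'
    have hK := h.isCompactOperator hd
    have hK' := h'.isCompactOperator hd'
    obtain ⟨ι, e, β, he, htot, hβ, hpos⟩ := exists_eigenbasis h.nonneg h.injective hK
    obtain ⟨σ, hσ, hfin⟩ := exists_sorted_eigenbasis hK not_finiteDimensional_L2 he htot hβ hpos
    obtain ⟨ι', e', β', he', htot', hβ', hpos'⟩ := exists_eigenbasis h'.nonneg h'.injective hK'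
    obtain ⟨σ', hσ', hfin'⟩ :=
      exists_sorted_eigenbasis hK' not_finiteDimensional_L2 he' htot' hβ' hpos'
    have heσ : Orthonormal ℂ (e ∘ σ) := he.comp _ σ.injective
    have heσ' : Orthonormal ℂ (e' ∘ σ') := he'.comp _ σ'.injective
    have hts : ∀ x, (∀ n, inner ℂ ((e ∘ σ) n) x = 0) → x = 0 := fun x hx =>
      htot x fun i => by simpa using hx (σ.symm i)
    have hts' : ∀ x, (∀ n, inner ℂ ((e' ∘ σ') n) x = 0) → x = 0 := fun x hx =>
      htot' x fun i => by simpa using hx (σ'.symm i)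
    refine ⟨fun n => (β (σ n))⁻¹ - (C₀ + 1), fun n => (β' (σ' n))⁻¹ - (C₀ + 1), ?_, ?_, ?_⟩
    · rw [hT]
      exact isEigenvalueSequence_invSubOp h.nonneg h.injective hd heσ hts (fun n => hβ _)
        (fun n => hpos _) hσ hfin
    · rw [hT']
      exact isEigenvalueSequence_invSubOp h'.nonneg h'.injective hd' heσ' hts' (fun n => hβ' _)
        (fun n => hpos' _) hσ' hfin'
    -- The comparison concerns the inverse eigenvalues of the bounded operators, that is, the
    -- eigenvalues shifted by `C₀ + 1`; the common shift disappears in the limit of the ratio.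
    · refine tendsto_div_of_comparison ?_ _ fun ε hε hε1 => ?_
      · refine tendsto_atTop_atTop_of_monotone hσ' fun K => ?_
        obtain ⟨n, hn⟩ := (hfin' (max K 1)⁻¹ (by positivity)).exists_notMem
        rw [Set.mem_ofPred_eq, not_le] at hn
        refine ⟨n, (le_max_left K 1).trans ?_⟩
        exact ((lt_inv_comm₀ (hpos' _) (by positivity)).1 hn).le
      · obtain ⟨k, hk, hL, hU⟩ := hLU ε hε
        have hε' : 0 < 1 - ε := by linarith
        refine ⟨k, fun n => ⟨?_, ?_⟩⟩
        · have := h'.inv_eigenvalue_le h (inv_nonneg.2 hε'.le) (mul_nonneg (inv_nonneg.2 hε'.le) hk)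
            (hlower ε hε hε1 k hL) heσ' hts' (fun n => hβ' _) (fun n => hpos' _) hσ' heσ
            (fun n => hβ _) (fun n => hpos _) hσ n
          rwa [← mul_add, le_inv_mul_iff₀ hε'] at this
        · exact h.inv_eigenvalue_le h' (by linarith) hk (hupper ε hε k hU) heσ hts (fun n => hβ _)
            (fun n => hpos _) hσ heσ' (fun n => hβ' _) (fun n => hpos' _) hσ' n

end Main
end SparseGraph

theorem theoremt {V : Type*} [Countable V] (G : SimpleGraph V) [G.LocallyFinite]
    (q : V → ℝ) (hq : SparseGraph.InKZeroPlus G q) :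
    List.TFAE
      [ SparseGraph.AlmostSparse G q,
        ∀ ε : ℝ, 0 < ε → ∃ k : ℝ, 0 ≤ k ∧
          SparseGraph.LowerBound G q ε k ∧ SparseGraph.UpperBound G q ε k,
        ∀ ε : ℝ, 0 < ε → ∃ k : ℝ, 0 ≤ k ∧ SparseGraph.LowerBound G q ε k ] ∧
    (SparseGraph.AlmostSparse G q →
      SparseGraph.formDomain (SparseGraph.schrodinger G q) =
        SparseGraph.formDomain (SparseGraph.mulOp (SparseGraph.degAdd G q)) ∧
      (SparseGraph.HasPurelyDiscreteSpectrum (SparseGraph.schrodinger G q) ↔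
        SparseGraph.liminfAtInfinity (SparseGraph.degAdd G q) = ⊤) ∧
      (SparseGraph.HasPurelyDiscreteSpectrum (SparseGraph.schrodinger G q) → Infinite V →
        ∃ lam mu : ℕ → ℝ,
          SparseGraph.IsEigenvalueSequence (SparseGraph.schrodinger G q) lam ∧
          SparseGraph.IsEigenvalueSequence (SparseGraph.mulOp (SparseGraph.degAdd G q)) mu ∧
          Tendsto (fun n => lam n / mu n) atTop (𝓝 1))) := by
  have htfae := SparseGraph.tfae_almostSparse (G := G) hq
  refine ⟨htfae, fun hs => ?_⟩
  obtain ⟨C₀, hC₀, hC⟩ := hq (1 / 2) (by norm_num)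
  exact SparseGraph.spectral_comparison hC₀ hC ((htfae.out 0 1).1 hs)
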